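/- Let $X$ be a connected Riemann surface, $\mathbb S=\{x_1,\dots,x_d\}\subset X$ a nonempty finite subset, $S=\sum_i x_i$ the reduced divisor, $K_X$ the canonical bundle, and $\mathbb T=TX\otimes\mathcal O_X(S)$. Let $F^1=\ker(J^2(\mathbb T)\to J^1(\mathbb T))\subset F^2=\ker(J^2(\mathbb T)\to\mathbb T)$ be the canonical filtration of the second jet bundle, so $F^1=K_X(S)$, $F^2/F^1=\mathcal O_X(S)$, $J^2(\mathbb T)/F^2=\mathbb T$ and $\bigwedge^3J^2(\mathbb T)=\mathcal O_X(3S)$. **Branched opers.** A branched $\mathrm{SO}(3,\mathbb C)$-oper of type $S$ is a holomorphic vector bundle $W$ of rank three with a fiberwise nondegenerate holomorphic symmetric bilinear form $B_W$, a holomorphic isomorphism $\bigwedge^3W\cong\mathcal O_X$ taking the form induced by $B_W$ to the standard form, holomorphic subbundles $F_1^W\subset F_2^W\subset W$ with $B_W(F_1^W\otimes F_1^W)=0$ and $(F_1^W)^\perp=F_2^W$, isomorphisms $F_1^W\cong K_X\otimes\mathcal O_X(-S)$ and $F_2^W/F_1^W\cong\mathcal O_X$, and a holomorphic connection $D_W$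 on $W$ preserving $B_W$, inducing the de Rham differential on $\bigwedge^3W\cong\mathcal O_X$, with $D_W(F_1^W)\subset F_2^W\otimes K_X$, and such that the second fundamental form of $F_1^W$, a section of $\mathrm{Hom}(K_X\otimes\mathcal O_X(-S),\mathcal O_X)\otimes K_X=\mathcal O_X(S)$, is the constant function $1$. **The pair.** Let $\mathbb B\in H^0(X,\mathrm{Sym}^2(J^2(\mathbb T)^*)\otimes\mathcal O_X(2S))$ be fiberwise nondegenerate and let $\mathbf D$ be a logarithmic connection on $J^2(\mathbb T)$ singular over $S$, such that: 1. $\mathbb B(F^1\otimes F^1)=0$ and $(F^1)^\perp=F^2$; 2. $\mathbb B$ is parallel for the connection induced by $\mathbf D$ and by the de Rham differential on $\mathcal O_X(2S)$; 3. $\mathbf D(F^1)\subset F^2\otimes K_X(S)$, and the second fundamental forms $F^1\to(F^2/F^1)\otimes K_X(S)$ and $F^2/F^1\to(J^2(\mathbb T)/F^2)\otimes K_X(S)$, which are sections of $\mathcal O_X(S)$, have divisor exactly $S$ (that is, they are the section $1$ of $\mathcal O_X(S)$ up to nowhere vanishing holomorphic functions); 4. for every $x_i\in\mathbb S$ the residue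 $\mathrm{Res}(\mathbf D,x_i)$ has eigenvalues $-2,-1,0$; 5. the eigenspace of $\mathrm{Res}(\mathbf D,x_i)$ for $-2$ is $F^1_{x_i}$, and the eigenspace for $-1$ is contained in $F^2_{x_i}$. If $X$ is not compact, assume moreover that the discriminant of $\mathbb B$, i.e. the nowhere vanishing holomorphic function on $X$ given by the form that $\mathbb B$ induces on $\bigwedge^3J^2(\mathbb T)=\mathcal O_X(3S)$ with values in $\mathcal O_X(6S)$, has a holomorphic square root on $X$. (This is automatic if $X$ is compact.) **The oper defined by the pair.** Let $L^i_2,L^i_1,L^i_0\subset J^2(\mathbb T)_{x_i}$ be the eigenspaces of $\mathrm{Res}(\mathbf D,x_i)$ for $-2,-1,0$. Let $\mathcal F\subset J^2(\mathbb T)$ be the kernel of $J^2(\mathbb T)\to\bigoplus_iJ^2(\mathbb T)_{x_i}/L^i_0$; $\mathbf D$ induces a logarithmic connection $\mathbf D'$ on $\mathcal F$. Let $M_i\subset\mathcal F_{x_i}$ be the eigenspace of $\mathrm{Res}(\mathbf D',x_i)$ for $0$, and $\mathcal E\subset\mathcal F$ the kernel of $\mathcal F\to\bigoplus_i\mathcal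 F_{x_i}/M_i$. The pair $(\mathbb B,\mathbf D)$ is said to define a branched $\mathrm{SO}(3,\mathbb C)$-oper if $\mathcal E$, with the form, connection and filtration induced by $\mathbb B$, $\mathbf D$ and $F^1\subset F^2$, is a branched $\mathrm{SO}(3,\mathbb C)$-oper of type $S$ (for some isomorphisms $\bigwedge^3\mathcal E\cong\mathcal O_X$, etc., as in the definition). **The homomorphisms $\varphi_i$.** For $v\in L^i_1\otimes(K_X)_{x_i}$ choose a holomorphic section $\widetilde v$ of $J^2(\mathbb T)\otimes\mathcal O_X(-x_i)$ near $x_i$ with $\widetilde v(x_i)=v$, using $\mathcal O_X(-x_i)_{x_i}=(K_X)_{x_i}$. Then $\mathbf D(\widetilde v)$ is a section of $J^2(\mathbb T)\otimes K_X\otimes\mathcal O_X(-x_i)$, and the component of $\mathbf D(\widetilde v)(x_i)\in J^2(\mathbb T)_{x_i}\otimes(K_X^{\otimes2})_{x_i}$ in $L^i_2\otimes(K_X^{\otimes2})_{x_i}$, for the decomposition $J^2(\mathbb T)_{x_i}=L^i_2\oplus L^i_1\oplus L^i_0$, depends only on $v$. This defines $\varphi_i\in\mathrm{Hom}(L^i_1\otimes(K_X)_{x_i},L^i_2\otimes(K_X^{\otimes2})_{x_i})=\mathrm{Hom}(L^i_1,L^i_2\otimes(K_X)_{x_i})$.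 **Theorem.** The pair $(\mathbb B,\mathbf D)$ defines a branched $\mathrm{SO}(3,\mathbb C)$-oper of type $S$ if and only if $\varphi_i=0$ for every $x_i\in\mathbb S$. -/

import Mathlib

open Set Filter Topology Bundle
open scoped Manifold ContDiff
noncomputable section
namespace BranchedOper
universe u

/-- A holomorphic coordinate `z` on the Riemann surface `X` whose domain contains at most one point
of the finite set `S`. -/
structure AdaptedChart {X : Type u} [TopologicalSpace X] [ChartedSpace ℂ X]
    (S : Finset X) where
  chart : OpenPartialHomeomorph X ℂ
  mem_maximalAtlas : chart ∈ IsManifold.maximalAtlas 𝓘(ℂ) ω X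
  subsingleton : ∀ y ∈ S, ∀ y' ∈ S, y ∈ chart.source → y' ∈ chart.source → y = y'

section Frames

variable {X : Type u} [TopologicalSpace X] [ChartedSpace ℂ X] {S : Finset X}

open Classical in
/-- The local equation `m` of the reduced divisor `S` in the domain of the coordinate `z`: it is
`z - z(y)` if the domain contains the point `y` of `S`, and `1` if it contains no point of `S`. -/
def AdaptedChart.eqn (φ : AdaptedChart S) (x : X) : ℂ :=
  ∏ y ∈ S with y ∈ φ.chart.source, (φ.chart x - φ.chart y)

/-- The change of coordinates: `z = trans φ ψ w`, where `z` and `w` are the coordinates of `φ` and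
`ψ`. -/
def trans (φ ψ : AdaptedChart S) : ℂ → ℂ := fun w => φ.chart (ψ.chart.symm w)

open Classical in
/-- The holomorphic unit `m_ψ / m_φ`, the ratio of the local equations of `S` in two coordinates. At
a point of `S` its value is the derivative `dw / dz` (`z`, `w` the coordinates of `φ`, `ψ`). -/
def unitRatio (φ ψ : AdaptedChart S) (x : X) : ℂ :=
  if x ∈ S then deriv (trans ψ φ) (φ.chart x) else ψ.eqn x / φ.eqn x

/-- Over the domain of a coordinate `z` with local equation `m` of `S`, the line bundle
`K_X^a ⊗ O_X(b S)` has the frame `(dz)^a m^(-b)`. If `c` is the coefficient of a section in the frame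
of `φ` and `d` its coefficient in the frame of `ψ`, then `d = lineCoeff a b φ ψ * c`. -/
def lineCoeff (a b : ℤ) (φ ψ : AdaptedChart S) (x : X) : ℂ :=
  deriv (trans φ ψ) (ψ.chart x) ^ a * unitRatio φ ψ x ^ b

lemma AdaptedChart.eqn_of_mem (φ : AdaptedChart S) {y : X} (hy : y ∈ S)
    (hyφ : y ∈ φ.chart.source) (x : X) : φ.eqn x = φ.chart x - φ.chart y := by
  classical
  have : S.filter (· ∈ φ.chart.source) = {y} := by
    ext y'
    simp only [Finset.mem_filter, Finset.mem_singleton]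
    exact ⟨fun h => φ.subsingleton _ h.1 _ hy h.2 hyφ, fun h => h ▸ ⟨hy, hyφ⟩⟩
  have h2 : φ.eqn x = ∏ y ∈ S.filter (· ∈ φ.chart.source), (φ.chart x - φ.chart y) := by
    unfold AdaptedChart.eqn; congr!
  rw [h2, this, Finset.prod_singleton]

lemma AdaptedChart.eqn_ne_zero (φ : AdaptedChart S) {x : X} (hx : x ∈ φ.chart.source)
    (hxS : x ∉ S) : φ.eqn x ≠ 0 := by
  classical
  unfold AdaptedChart.eqn
  refine Finset.prod_ne_zero_iff.mpr fun y hy h => hxS ?_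
  rw [Finset.mem_filter] at hy
  rw [φ.chart.injOn hx hy.2 (sub_eq_zero.mp h)]
  exact hy.1

lemma trans_apply (φ ψ : AdaptedChart S) {x : X} (hx : x ∈ ψ.chart.source) :
    trans φ ψ (ψ.chart x) = φ.chart x := by
  simp [trans, ψ.chart.left_inv hx]

lemma eventually_mem (φ ψ : AdaptedChart S) {x : X} (hφ : x ∈ φ.chart.source)
    (hψ : x ∈ ψ.chart.source) : ∀ᶠ w in 𝓝 (ψ.chart x),
      w ∈ ψ.chart.target ∧ ψ.chart.symm w ∈ φ.chart.source ∧ ψ.chart.symm w ∈ ψ.chart.source := by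
  have h1 : ∀ᶠ w in 𝓝 (ψ.chart x), w ∈ ψ.chart.target :=
    ψ.chart.open_target.mem_nhds (ψ.chart.map_source hψ)
  have h2 : ∀ᶠ w in 𝓝 (ψ.chart x), ψ.chart.symm w ∈ φ.chart.source := by
    have := ψ.chart.tendsto_symm hψ
    exact this.eventually (φ.chart.open_source.mem_nhds hφ)
  filter_upwards [h1, h2] with w hw hw2
  exact ⟨hw, hw2, ψ.chart.map_target hw⟩

lemma trans_trans (φ ψ χ : AdaptedChart S) {x : X} (hψ : x ∈ ψ.chart.source)
    (hχ : x ∈ χ.chart.source) :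
    trans φ χ =ᶠ[𝓝 (χ.chart x)] trans φ ψ ∘ trans ψ χ := by
  filter_upwards [eventually_mem ψ χ hψ hχ] with w hw
  simp [trans, ψ.chart.left_inv hw.2.1]

lemma trans_analyticAt (φ ψ : AdaptedChart S) {x : X} (hφ : x ∈ φ.chart.source)
    (hψ : x ∈ ψ.chart.source) : AnalyticAt ℂ (trans φ ψ) (ψ.chart x) := by
  have h1 := contMDiffAt_symm_of_mem_maximalAtlas ψ.mem_maximalAtlas (ψ.chart.map_source hψ)
  have h2 := contMDiffAt_of_mem_maximalAtlas φ.mem_maximalAtlas hφ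
  rw [← ψ.chart.left_inv hψ] at h2
  have h3 := h2.comp _ h1
  rw [contMDiffAt_iff_contDiffAt] at h3
  exact h3.analyticAt

lemma trans_self (φ : AdaptedChart S) {x : X} (hφ : x ∈ φ.chart.source) :
    trans φ φ =ᶠ[𝓝 (φ.chart x)] id := by
  filter_upwards [eventually_mem φ φ hφ hφ] with w hw
  simp [trans, φ.chart.right_inv hw.1]

lemma deriv_trans_mul (φ ψ χ : AdaptedChart S) {x : X} (hφ : x ∈ φ.chart.source)
    (hψ : x ∈ ψ.chart.source) (hχ : x ∈ χ.chart.source) :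
    deriv (trans φ χ) (χ.chart x) =
      deriv (trans φ ψ) (ψ.chart x) * deriv (trans ψ χ) (χ.chart x) := by
  rw [(trans_trans φ ψ χ hψ hχ).deriv_eq]
  have e := trans_apply ψ χ hχ
  rw [deriv_comp, e]
  · rw [e]; exact (trans_analyticAt φ ψ hφ hψ).differentiableAt
  · exact (trans_analyticAt ψ χ hψ hχ).differentiableAt

lemma deriv_trans_mul_symm (φ ψ : AdaptedChart S) {x : X} (hφ : x ∈ φ.chart.source)
    (hψ : x ∈ ψ.chart.source) :
    deriv (trans φ ψ) (ψ.chart x) * deriv (trans ψ φ) (φ.chart x) = 1 := by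
  rw [← deriv_trans_mul φ ψ φ hφ hψ hφ, (trans_self φ hφ).deriv_eq, deriv_id]

lemma deriv_trans_ne_zero (φ ψ : AdaptedChart S) {x : X} (hφ : x ∈ φ.chart.source)
    (hψ : x ∈ ψ.chart.source) : deriv (trans φ ψ) (ψ.chart x) ≠ 0 :=
  left_ne_zero_of_mul_eq_one (deriv_trans_mul_symm φ ψ hφ hψ)

lemma unitRatio_mul (φ ψ χ : AdaptedChart S) {x : X} (hφ : x ∈ φ.chart.source)
    (hψ : x ∈ ψ.chart.source) (hχ : x ∈ χ.chart.source) :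
    unitRatio φ ψ x * unitRatio ψ χ x = unitRatio φ χ x := by
  unfold unitRatio
  split_ifs with h
  · rw [deriv_trans_mul χ ψ φ hχ hψ hφ, mul_comm]
  · have := ψ.eqn_ne_zero hψ h
    have := φ.eqn_ne_zero hφ h
    field_simp

lemma unitRatio_self (φ : AdaptedChart S) {x : X} (hφ : x ∈ φ.chart.source) :
    unitRatio φ φ x = 1 := by
  unfold unitRatio
  split_ifs with h
  · rw [(trans_self φ hφ).deriv_eq, deriv_id]
  · exact div_self (φ.eqn_ne_zero hφ h)

lemma unitRatio_ne_zero (φ ψ : AdaptedChart S) {x : X} (hφ : x ∈ φ.chart.source)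
    (hψ : x ∈ ψ.chart.source) : unitRatio φ ψ x ≠ 0 := by
  have h := unitRatio_mul φ ψ φ hφ hψ hφ
  rw [unitRatio_self φ hφ] at h
  exact left_ne_zero_of_mul_eq_one h

lemma eqn_analyticAt (φ ψ : AdaptedChart S) {x : X} (hφ : x ∈ φ.chart.source)
    (hψ : x ∈ ψ.chart.source) :
    AnalyticAt ℂ (fun w => φ.eqn (ψ.chart.symm w)) (ψ.chart x) := by
  unfold AdaptedChart.eqn
  refine Finset.analyticAt_fun_prod _ fun y _ => ?_
  exact (trans_analyticAt φ ψ hφ hψ).sub analyticAt_const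

lemma unitRatio_analyticAt [T2Space X] (φ ψ : AdaptedChart S) {x : X}
    (hφ : x ∈ φ.chart.source) (hψ : x ∈ ψ.chart.source) :
    AnalyticAt ℂ (fun w => unitRatio φ ψ (ψ.chart.symm w)) (ψ.chart x) := by
  by_cases hx : x ∈ S
  · have hT := trans_analyticAt φ ψ hφ hψ
    have hd : AnalyticAt ℂ (dslope (trans φ ψ) (ψ.chart x)) (ψ.chart x) := by
      obtain ⟨p, hp⟩ := hT
      exact ⟨_, hp.has_fpower_series_dslope_fslope⟩
    have hne : dslope (trans φ ψ) (ψ.chart x) (ψ.chart x) ≠ 0 := by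
      rw [dslope_same]; exact deriv_trans_ne_zero φ ψ hφ hψ
    refine (hd.inv hne).congr ?_
    filter_upwards [eventually_mem φ ψ hφ hψ] with w hw
    simp only [Pi.inv_apply]
    by_cases hw0 : w = ψ.chart x
    · subst hw0
      rw [dslope_same, ψ.chart.left_inv hψ, unitRatio, if_pos hx]
      exact inv_eq_of_mul_eq_one_right (deriv_trans_mul_symm φ ψ hφ hψ)
    · have hwS : ψ.chart.symm w ∉ S := fun h => hw0 (by
        rw [← ψ.subsingleton _ h _ hx hw.2.2 hψ, ψ.chart.right_inv hw.1])
      rw [unitRatio, if_neg hwS, ψ.eqn_of_mem hx hψ, φ.eqn_of_mem hx hφ,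
        dslope_of_ne _ hw0, slope_def_field, ψ.chart.right_inv hw.1, trans_apply φ ψ hψ, inv_div]
      rfl
  · have h1 := (eqn_analyticAt ψ ψ hψ hψ).div (eqn_analyticAt φ ψ hφ hψ) (by
      rw [ψ.chart.left_inv hψ]; exact φ.eqn_ne_zero hφ hx)
    refine h1.congr ?_
    have hS : ∀ᶠ w in 𝓝 (ψ.chart x), ψ.chart.symm w ∉ S :=
      (ψ.chart.tendsto_symm hψ).eventually
        ((Finset.finite_toSet S).isClosed.isOpen_compl.mem_nhds hx)
    filter_upwards [hS] with w hw
    simp [unitRatio, hw]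

lemma lineCoeff_analyticAt [T2Space X] (a b : ℤ) (φ ψ : AdaptedChart S) {x : X}
    (hφ : x ∈ φ.chart.source) (hψ : x ∈ ψ.chart.source) :
    AnalyticAt ℂ (fun w => lineCoeff a b φ ψ (ψ.chart.symm w)) (ψ.chart x) := by
  have h1 : AnalyticAt ℂ (fun w => deriv (trans φ ψ) w ^ a) (ψ.chart x) :=
    (trans_analyticAt φ ψ hφ hψ).deriv.zpow (deriv_trans_ne_zero φ ψ hφ hψ)
  have h2 : AnalyticAt ℂ (fun w => unitRatio φ ψ (ψ.chart.symm w) ^ b) (ψ.chart x) :=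
    (unitRatio_analyticAt φ ψ hφ hψ).zpow (by
      rw [ψ.chart.left_inv hψ]; exact unitRatio_ne_zero φ ψ hφ hψ)
  refine (h1.mul h2).congr ?_
  filter_upwards [eventually_mem φ ψ hφ hψ] with w hw
  simp [lineCoeff, ψ.chart.right_inv hw.1]

lemma lineCoeff_mul (a b : ℤ) (φ ψ χ : AdaptedChart S) {x : X} (hφ : x ∈ φ.chart.source)
    (hψ : x ∈ ψ.chart.source) (hχ : x ∈ χ.chart.source) :
    lineCoeff a b φ ψ x * lineCoeff a b ψ χ x = lineCoeff a b φ χ x := by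
  unfold lineCoeff
  rw [← unitRatio_mul φ ψ χ hφ hψ hχ, deriv_trans_mul φ ψ χ hφ hψ hχ, mul_zpow, mul_zpow]
  ring

lemma lineCoeff_self (a b : ℤ) (φ : AdaptedChart S) {x : X} (hφ : x ∈ φ.chart.source) :
    lineCoeff a b φ φ x = 1 := by
  rw [lineCoeff, unitRatio_self φ hφ, (trans_self φ hφ).deriv_eq, deriv_id]
  simp

lemma exists_adaptedChart [T2Space X] [IsManifold 𝓘(ℂ) ω X] (S : Finset X) (x : X) :
    ∃ φ : AdaptedChart S, x ∈ φ.chart.source := by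
  have hO : IsOpen (((S : Set X) \ {x})ᶜ) :=
    ((Finset.finite_toSet S).subset sdiff_subset).isClosed.isOpen_compl
  refine ⟨⟨(chartAt ℂ x).restr (((S : Set X) \ {x})ᶜ),
    restr_mem_maximalAtlas _ (IsManifold.chart_mem_maximalAtlas x) hO, ?_⟩, ?_⟩
  · intro y hy y' hy' h h'
    rw [OpenPartialHomeomorph.restr_source, hO.interior_eq] at h h'
    have e : ∀ z ∈ S, z ∈ ((S : Set X) \ {x})ᶜ → z = x := fun z hz hz' => by
      by_contra hne
      exact hz' ⟨hz, hne⟩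
    rw [e y hy h.2, e y' hy' h'.2]
  · rw [OpenPartialHomeomorph.restr_source, hO.interior_eq]
    exact ⟨mem_chart_source ℂ x, fun h => h.2 rfl⟩


/-- An adapted coordinate around a given point. -/
def adaptedChartAt [T2Space X] [IsManifold 𝓘(ℂ) ω X] (S : Finset X) (x : X) : AdaptedChart S :=
  (exists_adaptedChart S x).choose

lemma mem_adaptedChartAt [T2Space X] [IsManifold 𝓘(ℂ) ω X] (S : Finset X) (x : X) :
    x ∈ (adaptedChartAt S x).chart.source :=
  (exists_adaptedChart S x).choose_spec

lemma contMDiffAt_of_coord {E : Type*} [NormedAddCommGroup E] [NormedSpace ℂ E]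
    (ψ : AdaptedChart S) {x : X} (hψ : x ∈ ψ.chart.source) {f : X → E}
    (hf : ContDiffAt ℂ ω (fun w => f (ψ.chart.symm w)) (ψ.chart x)) :
    ContMDiffAt 𝓘(ℂ) 𝓘(ℂ, E) ω f x := by
  have h1 := contMDiffAt_of_mem_maximalAtlas ψ.mem_maximalAtlas hψ
  have h2 := hf.contMDiffAt.comp x h1
  refine h2.congr_of_eventuallyEq ?_
  filter_upwards [ψ.chart.open_source.mem_nhds hψ] with y hy
  simp [ψ.chart.left_inv hy]

lemma contMDiffAt_clm {E : Type*} [NormedAddCommGroup E] [NormedSpace ℂ E]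
    [FiniteDimensional ℂ E]
    (ψ : AdaptedChart S) {x : X} (hψ : x ∈ ψ.chart.source) {f : X → E →L[ℂ] E}
    (hf : ∀ v, AnalyticAt ℂ (fun w => f (ψ.chart.symm w) v) (ψ.chart x)) :
    ContMDiffAt 𝓘(ℂ) 𝓘(ℂ, E →L[ℂ] E) ω f x := by
  refine contMDiffAt_of_coord ψ hψ ?_
  let e₁ := ContinuousLinearEquiv.ofFinrankEq
    (Module.finrank_fin_fun ℂ (n := Module.finrank ℂ E)).symm
  let e₂ := (e₁.arrowCongr (1 : E ≃L[ℂ] E)).trans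
    (ContinuousLinearEquiv.piRing (Fin (Module.finrank ℂ E)))
  have h : ContDiffAt ℂ ω (fun w => e₂ (f (ψ.chart.symm w))) (ψ.chart x) :=
    contDiffAt_pi.mpr fun i => (hf _).contDiffAt
  have h2 := e₂.symm.contDiff.contDiffAt.comp _ h
  refine h2.congr_of_eventuallyEq (Eventually.of_forall fun w => ?_)
  simp

/-- The holomorphic line bundle `K_X^a ⊗ O_X(b S)`, in the frames `(dz)^a m^(-b)`. Thus
`lineBundle S (-1) 1` is `𝕋 = TX ⊗ O_X(S)`, `lineBundle S 0 b` is `O_X(b S)`, and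
`lineBundle S 1 (-1)` is `K_X ⊗ O_X(-S)`. -/
def lineBundle [T2Space X] [IsManifold 𝓘(ℂ) ω X] (S : Finset X) (a b : ℤ) :
    VectorBundleCore ℂ X ℂ (AdaptedChart S) where
  baseSet φ := φ.chart.source
  isOpen_baseSet φ := φ.chart.open_source
  indexAt := adaptedChartAt S
  mem_baseSet_at := mem_adaptedChartAt S
  coordChange φ ψ x := lineCoeff a b φ ψ x • ContinuousLinearMap.id ℂ ℂ
  coordChange_self φ _ hx v := by simp [lineCoeff_self a b φ hx]
  continuousOn_coordChange φ ψ := fun _ hx =>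
    (contMDiffAt_clm ψ hx.2 fun _ =>
      (lineCoeff_analyticAt a b φ ψ hx.1 hx.2).mul analyticAt_const).continuousAt.continuousWithinAt
  coordChange_comp φ ψ χ _ hx v := by
    simp [← lineCoeff_mul a b φ ψ χ hx.1.1 hx.1.2 hx.2]; ring

instance [T2Space X] [IsManifold 𝓘(ℂ) ω X] (S : Finset X) (a b : ℤ) :
    (lineBundle S a b).IsContMDiff 𝓘(ℂ) ω where
  contMDiffOn_coordChange φ ψ := fun _ hx =>
    (contMDiffAt_clm ψ hx.2 fun _ =>
      (lineCoeff_analyticAt a b φ ψ hx.1 hx.2).mul analyticAt_const).contMDiffWithinAt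


lemma deriv_mul_comp {r f h : ℂ → ℂ} {w : ℂ} (hr : AnalyticAt ℂ r w) (hh : AnalyticAt ℂ h w)
    (hf : AnalyticAt ℂ f (h w)) :
    deriv (fun t => r t * f (h t)) w = deriv r w * f (h w) + r w * (deriv f (h w) * deriv h w) := by
  have h1 : HasDerivAt (fun t => f (h t)) (deriv f (h w) * deriv h w) w :=
    hf.differentiableAt.hasDerivAt.comp w hh.differentiableAt.hasDerivAt
  exact (hr.differentiableAt.hasDerivAt.mul h1).deriv

lemma deriv_deriv_mul_comp {r f h : ℂ → ℂ} {w : ℂ} (hr : AnalyticAt ℂ r w)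
    (hh : AnalyticAt ℂ h w) (hf : AnalyticAt ℂ f (h w)) :
    deriv (deriv fun t => r t * f (h t)) w =
      deriv (deriv r) w * f (h w) +
        (2 * deriv r w * deriv h w + r w * deriv (deriv h) w) * deriv f (h w) +
        r w * deriv h w ^ 2 * deriv (deriv f) (h w) := by
  have h0 : (deriv fun t => r t * f (h t)) =ᶠ[𝓝 w]
      fun t => deriv r t * f (h t) + r t * (deriv f (h t) * deriv h t) := by
    filter_upwards [hr.eventually_analyticAt, hh.eventually_analyticAt,
      hh.continuousAt.eventually hf.eventually_analyticAt] with t h1 h2 h3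
    exact deriv_mul_comp h1 h2 h3
  rw [h0.deriv_eq]
  have hD {g : ℂ → ℂ} {z : ℂ} (hg : AnalyticAt ℂ g z) : HasDerivAt g (deriv g z) z :=
    hg.differentiableAt.hasDerivAt
  have e1 := (hD hf).comp w (hD hh)
  have e2 := (hD hf.deriv).comp w (hD hh)
  have := ((hD hr.deriv).mul e1).add ((hD hr).mul (e2.mul (hD hh.deriv)))
  refine this.deriv.trans ?_
  simp only [Function.comp_apply, Pi.mul_apply]
  ring

/-- The transition function of `𝕋 = TX ⊗ O_X(S)` from the frame of `φ` to the frame of `ψ`, as a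
function of the coordinate of `ψ`. -/
def jetCoeff (φ ψ : AdaptedChart S) : ℂ → ℂ := fun w => lineCoeff (-1) 1 φ ψ (ψ.chart.symm w)

/-- The transition matrix of `J²(𝕋)`. A section of `𝕋` with coefficient `f(z)` in the frame of `φ` has
coefficient `r(w) f(h(w))` in the frame of `ψ`, where `r` is the transition function of `𝕋` and
`z = h(w)`; the matrix takes `(f, f', f'')` to the value and the first two derivatives of
`r(w) f(h(w))`, see `jetChange_spec`. -/
def jetChange (φ ψ : AdaptedChart S) (x : X) : Matrix (Fin 3) (Fin 3) ℂ :=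
  let r := jetCoeff φ ψ
  let h := trans φ ψ
  let w := ψ.chart x
  !![r w, 0, 0;
     deriv r w, r w * deriv h w, 0;
     deriv (deriv r) w, 2 * deriv r w * deriv h w + r w * deriv (deriv h) w, r w * deriv h w ^ 2]

/-- The coordinates `(f, f', f'')` of the `2`-jet of `f` at `z`. -/
def jetVec (f : ℂ → ℂ) (z : ℂ) : Fin 3 → ℂ := ![f z, deriv f z, deriv (deriv f) z]

lemma jetVec_congr {f g : ℂ → ℂ} {z : ℂ} (h : f =ᶠ[𝓝 z] g) : jetVec f z = jetVec g z := by
  have h0 := h.eq_of_nhds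
  unfold jetVec
  rw [h.deriv_eq, h.deriv.deriv_eq, h0]

lemma jetChange_spec [T2Space X] (φ ψ : AdaptedChart S) {x : X} (hφ : x ∈ φ.chart.source)
    (hψ : x ∈ ψ.chart.source) {f : ℂ → ℂ} (hf : AnalyticAt ℂ f (φ.chart x)) :
    (jetChange φ ψ x).mulVec (jetVec f (φ.chart x)) =
      jetVec (fun w => jetCoeff φ ψ w * f (trans φ ψ w)) (ψ.chart x) := by
  have e := trans_apply φ ψ hψ
  have hr : AnalyticAt ℂ (jetCoeff φ ψ) (ψ.chart x) := lineCoeff_analyticAt _ _ φ ψ hφ hψ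
  have hh := trans_analyticAt φ ψ hφ hψ
  rw [← e] at hf ⊢
  ext k
  fin_cases k
  · simp [jetChange, jetVec, Matrix.mulVec, dotProduct, Fin.sum_univ_three]
  · simp [jetChange, jetVec, Matrix.mulVec, dotProduct, Fin.sum_univ_three,
      deriv_mul_comp hr hh hf]
    ring
  · simp [jetChange, jetVec, Matrix.mulVec, dotProduct, Fin.sum_univ_three,
      deriv_deriv_mul_comp hr hh hf]

lemma exists_jetVec (u : Fin 3 → ℂ) (z : ℂ) : ∃ f : ℂ → ℂ, AnalyticAt ℂ f z ∧ jetVec f z = u := by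
  have h0 (t : ℂ) : HasDerivAt (fun t => u 0 + u 1 * (t - z) + u 2 / 2 * (t - z) ^ 2)
      (u 1 + u 2 * (t - z)) t := by
    have h := (hasDerivAt_id t).sub_const z
    refine (((h.const_mul (u 1)).const_add (u 0)).add ((h.pow 2).const_mul (u 2 / 2))).congr_deriv ?_
    simp only [id_eq]; push_cast; ring
  have h1 (t : ℂ) : HasDerivAt (fun t => u 1 + u 2 * (t - z)) (u 2) t := by
    simpa using (((hasDerivAt_id t).sub_const z).const_mul (u 2)).const_add (u 1)
  refine ⟨fun t => u 0 + u 1 * (t - z) + u 2 / 2 * (t - z) ^ 2, by fun_prop, ?_⟩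
  have e : deriv (fun t => u 0 + u 1 * (t - z) + u 2 / 2 * (t - z) ^ 2) =
      fun t => u 1 + u 2 * (t - z) := funext fun t => (h0 t).deriv
  ext k
  fin_cases k
  · simp [jetVec]
  · simp [jetVec, e]
  · simp only [jetVec, e, (h1 z).deriv]; rfl

lemma jetChange_mulVec_mulVec [T2Space X] (φ ψ χ : AdaptedChart S) {x : X}
    (hφ : x ∈ φ.chart.source) (hψ : x ∈ ψ.chart.source) (hχ : x ∈ χ.chart.source)
    (u : Fin 3 → ℂ) :
    (jetChange ψ χ x).mulVec ((jetChange φ ψ x).mulVec u) = (jetChange φ χ x).mulVec u := by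
  obtain ⟨f, hf, rfl⟩ := exists_jetVec u (φ.chart x)
  have hr : AnalyticAt ℂ (jetCoeff φ ψ) (ψ.chart x) := lineCoeff_analyticAt _ _ φ ψ hφ hψ
  have hf' : AnalyticAt ℂ (fun w => jetCoeff φ ψ w * f (trans φ ψ w)) (ψ.chart x) :=
    hr.mul (AnalyticAt.fun_comp (by rwa [trans_apply φ ψ hψ]) (trans_analyticAt φ ψ hφ hψ))
  rw [jetChange_spec φ ψ hφ hψ hf, jetChange_spec ψ χ hψ hχ hf', jetChange_spec φ χ hφ hχ hf]
  have key : (fun w => jetCoeff ψ χ w * (jetCoeff φ ψ (trans ψ χ w) *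
      f (trans φ ψ (trans ψ χ w)))) =ᶠ[𝓝 (χ.chart x)]
      fun w => jetCoeff φ χ w * f (trans φ χ w) := by
    filter_upwards [eventually_mem ψ χ hψ hχ, eventually_mem φ χ hφ hχ] with w hw hw'
    have e1 : ψ.chart.symm (trans ψ χ w) = χ.chart.symm w := ψ.chart.left_inv hw.2.1
    have e2 : trans φ ψ (trans ψ χ w) = trans φ χ w := by
      rw [trans, e1]; rfl
    rw [e2, ← mul_assoc]
    congr 1
    rw [jetCoeff, jetCoeff, jetCoeff, e1, mul_comm]
    exact lineCoeff_mul _ _ φ ψ χ hw'.2.1 hw.2.1 hw.2.2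
  exact jetVec_congr key

lemma jetChange_self [T2Space X] (φ : AdaptedChart S) {x : X} (hφ : x ∈ φ.chart.source)
    (u : Fin 3 → ℂ) : (jetChange φ φ x).mulVec u = u := by
  obtain ⟨f, hf, rfl⟩ := exists_jetVec u (φ.chart x)
  rw [jetChange_spec φ φ hφ hφ hf]
  have key : (fun w => jetCoeff φ φ w * f (trans φ φ w)) =ᶠ[𝓝 (φ.chart x)] f := by
    filter_upwards [eventually_mem φ φ hφ hφ] with w hw
    simp [jetCoeff, lineCoeff_self _ _ φ hw.2.1, trans, φ.chart.right_inv hw.1]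
  exact jetVec_congr key

lemma jetChange_analyticAt [T2Space X] (φ ψ : AdaptedChart S) {x : X}
    (hφ : x ∈ φ.chart.source) (hψ : x ∈ ψ.chart.source) (u : Fin 3 → ℂ) :
    AnalyticAt ℂ (fun w => (jetChange φ ψ (ψ.chart.symm w)).mulVec u) (ψ.chart x) := by
  have hr : AnalyticAt ℂ (jetCoeff φ ψ) (ψ.chart x) := lineCoeff_analyticAt _ _ φ ψ hφ hψ
  have hr1 := hr.deriv
  have hr2 := hr1.deriv
  have hh := trans_analyticAt φ ψ hφ hψ
  have hh1 := hh.deriv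
  have hh2 := hh1.deriv
  have : AnalyticAt ℂ (fun w => (![jetCoeff φ ψ w * u 0,
      deriv (jetCoeff φ ψ) w * u 0 + jetCoeff φ ψ w * deriv (trans φ ψ) w * u 1,
      deriv (deriv (jetCoeff φ ψ)) w * u 0 + (2 * deriv (jetCoeff φ ψ) w * deriv (trans φ ψ) w +
        jetCoeff φ ψ w * deriv (deriv (trans φ ψ)) w) * u 1 +
        jetCoeff φ ψ w * deriv (trans φ ψ) w ^ 2 * u 2] : Fin 3 → ℂ)) (ψ.chart x) := by
    rw [analyticAt_pi_iff]
    intro k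
    fin_cases k
    · exact hr.mul analyticAt_const
    · exact (hr1.mul analyticAt_const).add ((hr.mul hh1).mul analyticAt_const)
    · exact ((hr2.mul analyticAt_const).add ((((analyticAt_const.mul hr1).mul hh1).add
        (hr.mul hh2)).mul analyticAt_const)).add ((hr.mul (hh1.pow 2)).mul analyticAt_const)
  refine this.congr ?_
  filter_upwards [eventually_mem φ ψ hφ hψ] with w hw
  ext k
  fin_cases k <;>
    simp [jetChange, Matrix.mulVec, dotProduct, Fin.sum_univ_three, ψ.chart.right_inv hw.1]

/-- The second jet bundle `J²(𝕋)` of `𝕋 = TX ⊗ O_X(S)`. Over the domain of a coordinate `z`, the jet of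
the section of `𝕋` with coefficient `f(z)` has the coordinates `(f, f', f'')`. -/
def jetBundle [T2Space X] [IsManifold 𝓘(ℂ) ω X] (S : Finset X) :
    VectorBundleCore ℂ X (Fin 3 → ℂ) (AdaptedChart S) where
  baseSet φ := φ.chart.source
  isOpen_baseSet φ := φ.chart.open_source
  indexAt := adaptedChartAt S
  mem_baseSet_at := mem_adaptedChartAt S
  coordChange φ ψ x := (Matrix.mulVecLin (jetChange φ ψ x)).toContinuousLinearMap
  coordChange_self φ _ hx v := jetChange_self φ hx v
  continuousOn_coordChange φ ψ := fun _ hx =>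
    (contMDiffAt_clm ψ hx.2 fun v =>
      jetChange_analyticAt φ ψ hx.1 hx.2 v).continuousAt.continuousWithinAt
  coordChange_comp φ ψ χ _ hx v := jetChange_mulVec_mulVec φ ψ χ hx.1.1 hx.1.2 hx.2 v

instance [T2Space X] [IsManifold 𝓘(ℂ) ω X] (S : Finset X) : (jetBundle S).IsContMDiff 𝓘(ℂ) ω where
  contMDiffOn_coordChange φ ψ := fun _ hx =>
    (contMDiffAt_clm ψ hx.2 fun v => jetChange_analyticAt φ ψ hx.1 hx.2 v).contMDiffWithinAt

end Frames

section Sections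

variable {X : Type u} [TopologicalSpace X] [ChartedSpace ℂ X]
  {F : Type*} [NormedAddCommGroup F] [NormedSpace ℂ F] {ι : Type*}

instance (Z : VectorBundleCore ℂ X F ι) (x : X) : IsTopologicalAddGroup (Z.Fiber x) :=
  inferInstanceAs (IsTopologicalAddGroup F)

instance (Z : VectorBundleCore ℂ X F ι) (x : X) : ContinuousSMul ℂ (Z.Fiber x) :=
  inferInstanceAs (ContinuousSMul ℂ F)

/-- `σ` is a holomorphic section of `Z` over `U`. It is used for open sets `U` only; the values of
`σ` outside `U` are irrelevant. -/
def HolOn (Z : VectorBundleCore ℂ X F ι) (U : Set X) (σ : ∀ x, Z.Fiber x) : Prop :=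
  MDifferentiableOn 𝓘(ℂ) (𝓘(ℂ).prod 𝓘(ℂ, F)) (fun x => TotalSpace.mk' F x (σ x)) U

/-- The subspaces `A x` are the fibers of a holomorphic subbundle of rank `r`. -/
def IsHolSubbundle (Z : VectorBundleCore ℂ X F ι) (r : ℕ)
    (A : ∀ x, Submodule ℂ (Z.Fiber x)) : Prop :=
  ∀ x, ∃ U, IsOpen U ∧ x ∈ U ∧ ∃ s : Fin r → ∀ y, Z.Fiber y, (∀ k, HolOn Z U (s k)) ∧
    ∀ y ∈ U, LinearIndependent ℂ (fun k => s k y) ∧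
      Submodule.span ℂ (Set.range fun k => s k y) = A y

/-- A logarithmic connection on `Z` singular over `S`: a covariant derivative `cov σ x v = D_v σ (x)`
outside `S` (the values of `cov` at the points of `S` are irrelevant) such that, for a holomorphic
section `σ`, `D σ = τ ⊗ dz / m` with a holomorphic section `τ`, where `m` is the local equation of
`S`. The endomorphism `res y`, for `y ∈ S`, is the residue at `y`: it takes `σ(y)` to the coefficient
`τ(y)` of `dz / m = dz / (z - z(y))`. These conditions determine `res y` for `y ∈ S`; for other
points `res` is irrelevant. -/
structure LogConnection (S : Finset X) (Z : VectorBundleCore ℂ X F ι) where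
  cov : (∀ x, Z.Fiber x) → ∀ x, TangentSpace 𝓘(ℂ) x →L[ℂ] Z.Fiber x
  isCov : IsCovariantDerivativeOn F cov (S : Set X)ᶜ
  res : ∀ x, Z.Fiber x →ₗ[ℂ] Z.Fiber x
  isLog : ∀ (φ : AdaptedChart S) (U : Set X), IsOpen U → U ⊆ φ.chart.source →
    ∀ σ, HolOn Z U σ → ∃ τ, HolOn Z U τ ∧
      (∀ x ∈ U, x ∉ S → ∀ v : TangentSpace 𝓘(ℂ) x,
        φ.eqn x • cov σ x v = mvfderiv 𝓘(ℂ) φ.chart x v • τ x) ∧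
      ∀ x ∈ U, x ∈ S → τ x = res x (σ x)

/-- A holomorphic connection: a logarithmic connection with empty singular locus. -/
abbrev HolConnection (Z : VectorBundleCore ℂ X F ι) := LogConnection (∅ : Finset X) Z

/-- For holomorphic subbundles `A ⊆ B ⊆ C` with `D(A) ⊆ B ⊗ K_X(S)` and `D(B) ⊆ C ⊗ K_X(S)`: the second
fundamental form `B / A ⟶ (C / B) ⊗ K_X(S)` maps `B / A` onto the subsheaf `(C / B) ⊗ K_X`. Explicitly,
if a section `σ` of `B` generates `B / A` at `x`, then `D σ = τ ⊗ dz` modulo `B ⊗ K_X(S)` near `x`,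
where the section `τ` of `C` generates `C / B` at `x`. Used for `B / A` and `C / B` of rank one. -/
def SecondFormOnto {S : Finset X} {Z : VectorBundleCore ℂ X F ι} (D : LogConnection S Z)
    (A B C : ∀ x, Submodule ℂ (Z.Fiber x)) : Prop :=
  ∀ (φ : AdaptedChart S) (U : Set X), IsOpen U → U ⊆ φ.chart.source →
    ∀ σ, HolOn Z U σ → (∀ x ∈ U, σ x ∈ B x) → ∀ x ∈ U, σ x ∉ A x →
      ∃ V, IsOpen V ∧ x ∈ V ∧ V ⊆ U ∧ ∃ τ κ, HolOn Z V τ ∧ HolOn Z V κ ∧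
        (∀ y ∈ V, τ y ∈ C y ∧ κ y ∈ B y) ∧ τ x ∉ B x ∧
        ∀ y ∈ V, y ∉ S → ∀ v : TangentSpace 𝓘(ℂ) y,
          φ.eqn y • D.cov σ y v = mvfderiv 𝓘(ℂ) φ.chart y v • (φ.eqn y • τ y + κ y)

variable [T2Space X] [IsManifold 𝓘(ℂ) ω X]

/-- The line subbundle `F¹ = ker (J²(𝕋) ⟶ J¹(𝕋))`. -/
def jetF1 (S : Finset X) (x : X) : Submodule ℂ ((jetBundle S).Fiber x) :=
  (LinearMap.ker (LinearMap.proj 0 : (Fin 3 → ℂ) →ₗ[ℂ] ℂ) ⊓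
    LinearMap.ker (LinearMap.proj 1 : (Fin 3 → ℂ) →ₗ[ℂ] ℂ) : Submodule ℂ (Fin 3 → ℂ))

/-- The subbundle `F² = ker (J²(𝕋) ⟶ 𝕋)`. -/
def jetF2 (S : Finset X) (x : X) : Submodule ℂ ((jetBundle S).Fiber x) :=
  (LinearMap.ker (LinearMap.proj 0 : (Fin 3 → ℂ) →ₗ[ℂ] ℂ) : Submodule ℂ (Fin 3 → ℂ))

/-- The canonical identification `O_X(b S)_x = ℂ` for `x ∉ S`: a section of `O_X(b S)` is viewed as a
meromorphic function. -/
def toMero (S : Finset X) (b : ℤ) (x : X) (c : (lineBundle S 0 b).Fiber x) : ℂ :=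
  (show ℂ from c) * (adaptedChartAt S x).eqn x ^ (-b)

/-- The canonical map `(K_X ⊗ O_X(-S))_x ⟶ (K_X)_x`: a section of `K_X ⊗ O_X(-S)` is viewed as a
holomorphic `1`-form vanishing on `S`. -/
def toForm (S : Finset X) (x : X) (c : (lineBundle S 1 (-1)).Fiber x) :
    TangentSpace 𝓘(ℂ) x →L[ℂ] ℂ :=
  ((show ℂ from c) * (adaptedChartAt S x).eqn x) •
    mvfderiv 𝓘(ℂ) (adaptedChartAt S x).chart x

/-- A fiberwise nondegenerate holomorphic symmetric bilinear form with values in `O_X(2 S)`. -/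
structure TwistedForm (S : Finset X) (Z : VectorBundleCore ℂ X F ι) where
  form : ∀ x, Z.Fiber x →ₗ[ℂ] Z.Fiber x →ₗ[ℂ] (lineBundle S 0 2).Fiber x
  symm : ∀ x u w, form x u w = form x w u
  hol : ∀ U, IsOpen U → ∀ σ τ, HolOn Z U σ → HolOn Z U τ →
    HolOn (lineBundle S 0 2) U fun x => form x (σ x) (τ x)
  nondeg : ∀ x u, (∀ w, form x u w = 0) → u = 0

/-- The discriminant of the form: the holomorphic function without zeros by which the form induced on
`⋀³ J²(𝕋) = O_X(3 S)`, with values in `O_X(6 S)`, differs from multiplication. (The determinants of the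
transition matrices of `J²(𝕋)` are those of `O_X(3 S)`, so that the determinant of the Gram matrix does
not depend on the coordinate.) -/
def discr {S : Finset X} (𝔹 : TwistedForm S (jetBundle S)) (x : X) : ℂ :=
  Matrix.det (Matrix.of fun a b : Fin 3 =>
    (show ℂ from 𝔹.form x (Pi.single a 1 : Fin 3 → ℂ) (Pi.single b 1 : Fin 3 → ℂ)))

/-- The five conditions on a pair `(𝔹, D)` on `J²(𝕋)`. -/
structure AdmissiblePair {S : Finset X} (𝔹 : TwistedForm S (jetBundle S))
    (D : LogConnection S (jetBundle S)) : Prop where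
  /-- `F¹` is isotropic. -/
  isotropic : ∀ x, ∀ u ∈ jetF1 S x, ∀ w ∈ jetF1 S x, 𝔹.form x u w = 0
  /-- `F²` is the orthogonal of `F¹`. -/
  orthogonal : ∀ x w, (∀ u ∈ jetF1 S x, 𝔹.form x u w = 0) ↔ w ∈ jetF2 S x
  /-- `𝔹` is parallel, for the logarithmic connection induced by `D` and by the de Rham differential
  on `O_X(2 S)`; it suffices to say so outside `S`. -/
  parallel : ∀ U, IsOpen U → ∀ σ τ, HolOn (jetBundle S) U σ → HolOn (jetBundle S) U τ →
    ∀ x ∈ U, x ∉ S → ∀ v : TangentSpace 𝓘(ℂ) x,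
      mvfderiv 𝓘(ℂ) (fun y => toMero S 2 y (𝔹.form y (σ y) (τ y))) x v =
        toMero S 2 x (𝔹.form x (D.cov σ x v) (τ x)) + toMero S 2 x (𝔹.form x (σ x) (D.cov τ x v))
  /-- `D(F¹) ⊆ F² ⊗ K_X(S)`. -/
  griffiths : ∀ U, IsOpen U → ∀ σ, HolOn (jetBundle S) U σ → (∀ x ∈ U, σ x ∈ jetF1 S x) →
    ∀ x ∈ U, x ∉ S → ∀ v : TangentSpace 𝓘(ℂ) x, D.cov σ x v ∈ jetF2 S x
  /-- The second fundamental form of `F¹`, a section of `O_X(S)`, has divisor `S`. -/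
  transversal₁ : SecondFormOnto D (fun _ => ⊥) (jetF1 S) (jetF2 S)
  /-- The second fundamental form of `F²`, a section of `O_X(S)`, has divisor `S`. -/
  transversal₂ : SecondFormOnto D (jetF1 S) (jetF2 S) (fun _ => ⊤)
  /-- The eigenvalues of the residues. -/
  eigenvalues : ∀ y ∈ S, ∀ μ : ℂ,
    Module.End.HasEigenvalue (D.res y) μ ↔ μ = -2 ∨ μ = -1 ∨ μ = 0
  eigenspace_neg_two : ∀ y ∈ S, Module.End.eigenspace (D.res y) (-2) = jetF1 S y
  eigenspace_neg_one : ∀ y ∈ S, Module.End.eigenspace (D.res y) (-1) ≤ jetF2 S y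

/-- With `L_2, L_1, L_0` the eigenspaces of the residue at `y ∈ S` for `-2, -1, 0`, and `z` a
coordinate around `y`: the homomorphism `v ⊗ dz ↦ f(v) ⊗ dz²` from `L_1 ⊗ K_y` to `L_2 ⊗ K_y²` is the one
constructed from `D`. A holomorphic section `(z - z(y)) s` of `J²(𝕋) ⊗ O_X(-y)` with `s(y) = v ∈ L_1` has
the value `v ⊗ dz` at `y`; its derivative is a section `(z - z(y)) τ ⊗ dz` of
`J²(𝕋) ⊗ K_X ⊗ O_X(-y)`, with the value `τ(y) ⊗ dz²` at `y`; and `f(v)` is the component of `τ(y)` in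
`L_2`. -/
def IsPhi {S : Finset X} (D : LogConnection S (jetBundle S)) (φ : AdaptedChart S) (y : X)
    (f : Module.End.eigenspace (D.res y) (-1) →ₗ[ℂ] Module.End.eigenspace (D.res y) (-2)) : Prop :=
  ∀ (v : Module.End.eigenspace (D.res y) (-1)) (U : Set X), IsOpen U → y ∈ U →
    U ⊆ φ.chart.source → ∀ s, HolOn (jetBundle S) U s → s y = v →
      ∃ τ, HolOn (jetBundle S) U τ ∧
        (∀ x ∈ U, x ∉ S → ∀ t : TangentSpace 𝓘(ℂ) x,
          D.cov (fun p => (φ.chart p - φ.chart y) • s p) x t =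
            mvfderiv 𝓘(ℂ) φ.chart x t • (φ.chart x - φ.chart y) • τ x) ∧
        τ y - (f v : (jetBundle S).Fiber y) ∈
          Module.End.eigenspace (D.res y) (-1) ⊔ Module.End.eigenspace (D.res y) 0

/-- A branched `SO(3,ℂ)`-oper of type `S` on the holomorphic vector bundle `Z` of rank three. -/
structure BranchedSO3Oper (S : Finset X) (Z : VectorBundleCore ℂ X (Fin 3 → ℂ) ι) where
  /-- The symmetric bilinear form. -/
  form : ∀ x, Z.Fiber x →ₗ[ℂ] Z.Fiber x →ₗ[ℂ] ℂ
  form_symm : ∀ x u w, form x u w = form x w u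
  form_hol : ∀ U, IsOpen U → ∀ σ τ, HolOn Z U σ → HolOn Z U τ →
    MDifferentiableOn 𝓘(ℂ) 𝓘(ℂ) (fun x => form x (σ x) (τ x)) U
  form_nondeg : ∀ x u, (∀ w, form x u w = 0) → u = 0
  /-- The isomorphism of `⋀³ Z` with the trivial line bundle, as an alternating form. -/
  vol : ∀ x, Z.Fiber x [⋀^Fin 3]→ₗ[ℂ] ℂ
  vol_hol : ∀ U, IsOpen U → ∀ σ : Fin 3 → ∀ x, Z.Fiber x, (∀ k, HolOn Z U (σ k)) →
    MDifferentiableOn 𝓘(ℂ) 𝓘(ℂ) (fun x => vol x fun k => σ k x) U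
  vol_ne_zero : ∀ x, vol x ≠ 0
  /-- The isomorphism takes the form induced on `⋀³ Z` to the standard form. -/
  vol_form : ∀ x (u w : Fin 3 → Z.Fiber x),
    Matrix.det (Matrix.of fun a b => form x (u a) (w b)) = vol x u * vol x w
  /-- The filtration. -/
  F1 : ∀ x, Submodule ℂ (Z.Fiber x)
  F2 : ∀ x, Submodule ℂ (Z.Fiber x)
  F1_le_F2 : ∀ x, F1 x ≤ F2 x
  F1_subbundle : IsHolSubbundle Z 1 F1
  F2_subbundle : IsHolSubbundle Z 2 F2
  F1_isotropic : ∀ x, ∀ u ∈ F1 x, ∀ w ∈ F1 x, form x u w = 0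
  F1_orthogonal : ∀ x w, (∀ u ∈ F1 x, form x u w = 0) ↔ w ∈ F2 x
  /-- The isomorphism of `K_X ⊗ O_X(-S)` with `F1`. -/
  iso₁ : ∀ x, (lineBundle S 1 (-1)).Fiber x ≃ₗ[ℂ] F1 x
  iso₁_hol : ∀ U, IsOpen U → ∀ c, HolOn (lineBundle S 1 (-1)) U c →
    HolOn Z U fun x => (iso₁ x (c x) : Z.Fiber x)
  /-- The isomorphism of `F2 / F1` with the trivial line bundle, as a map on `F2`. -/
  iso₂ : ∀ x, F2 x →ₗ[ℂ] ℂ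
  iso₂_hol : ∀ U, IsOpen U → ∀ σ : ∀ x, F2 x, HolOn Z U (fun x => (σ x : Z.Fiber x)) →
    MDifferentiableOn 𝓘(ℂ) 𝓘(ℂ) (fun x => iso₂ x (σ x)) U
  iso₂_surjective : ∀ x, Function.Surjective (iso₂ x)
  iso₂_eq_zero_iff : ∀ x (w : F2 x), iso₂ x w = 0 ↔ (w : Z.Fiber x) ∈ F1 x
  /-- The connection. -/
  conn : HolConnection Z
  conn_form : ∀ U, IsOpen U → ∀ σ τ, HolOn Z U σ → HolOn Z U τ →
    ∀ x ∈ U, ∀ v : TangentSpace 𝓘(ℂ) x,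
      mvfderiv 𝓘(ℂ) (fun y => form y (σ y) (τ y)) x v =
        form x (conn.cov σ x v) (τ x) + form x (σ x) (conn.cov τ x v)
  /-- The connection induced on `⋀³ Z` is the de Rham differential. -/
  conn_vol : ∀ U, IsOpen U → ∀ σ : Fin 3 → ∀ x, Z.Fiber x, (∀ k, HolOn Z U (σ k)) →
    ∀ x ∈ U, ∀ v : TangentSpace 𝓘(ℂ) x,
      mvfderiv 𝓘(ℂ) (fun y => vol y fun k => σ k y) x v =
        ∑ k, vol x (Function.update (fun l => σ l x) k (conn.cov (σ k) x v))
  conn_F1 : ∀ U, IsOpen U → ∀ σ, HolOn Z U σ → (∀ x ∈ U, σ x ∈ F1 x) →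
    ∀ x ∈ U, ∀ v : TangentSpace 𝓘(ℂ) x, conn.cov σ x v ∈ F2 x
  /-- The second fundamental form of `F1`, as a section of
  `Hom(K_X ⊗ O_X(-S), O_X) ⊗ K_X = O_X(S)`, is the constant function `1`: it is the inclusion of
  `K_X ⊗ O_X(-S)` in `K_X`. -/
  secondForm : ∀ U, IsOpen U → ∀ c, HolOn (lineBundle S 1 (-1)) U c →
    ∀ x ∈ U, ∀ (v : TangentSpace 𝓘(ℂ) x)
      (h : conn.cov (fun y => (iso₁ y (c y) : Z.Fiber y)) x v ∈ F2 x),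
      iso₂ x ⟨conn.cov (fun y => (iso₁ y (c y) : Z.Fiber y)) x v, h⟩ = toForm S x (c x) v

/-- Sections over `U` of the sheaf `𝓕 ⊆ J²(𝕋)`, the kernel of
`J²(𝕋) ⟶ ⨁ J²(𝕋)_y / L_0(y)`, where `L_0(y)` is the eigenspace for `0` of the residue of `D` at `y ∈ S`. -/
def IsSecF {S : Finset X} (D : LogConnection S (jetBundle S)) (U : Set X)
    (σ : ∀ x, (jetBundle S).Fiber x) : Prop :=
  HolOn (jetBundle S) U σ ∧ ∀ y ∈ U, y ∈ S → σ y ∈ Module.End.eigenspace (D.res y) 0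

/-- Sections over `U` of the sheaf `𝓔 ⊆ 𝓕`, the kernel of `𝓕 ⟶ ⨁ 𝓕_y / M(y)`, where `M(y)` is the
eigenspace for `0` of the residue at `y` of the logarithmic connection induced by `D` on `𝓕`. That this
residue annihilates the class of `σ` in `𝓕_y` means that `D σ` is a section of `𝓕 ⊗ K_X` near `y`. -/
def IsSecE {S : Finset X} (D : LogConnection S (jetBundle S)) (U : Set X)
    (σ : ∀ x, (jetBundle S).Fiber x) : Prop :=
  IsSecF D U σ ∧ ∀ y ∈ U, y ∈ S → ∃ (φ : AdaptedChart S) (V : Set X), IsOpen V ∧ y ∈ V ∧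
    V ⊆ U ∩ φ.chart.source ∧ ∃ τ, IsSecF D V τ ∧
      ∀ x ∈ V, x ∉ S → ∀ v : TangentSpace 𝓘(ℂ) x,
        D.cov σ x v = mvfderiv 𝓘(ℂ) φ.chart x v • τ x

/-- The homomorphism `Ψ : Z ⟶ J²(𝕋)` identifies `Z` with the sheaf `𝓔`, in such a way that the form,
the connection and the filtration of the branched oper on `Z` are those given by `𝔹`, `D` and
`F¹ ⊆ F²`. (All of these are determined by their restrictions to the complement of `S`.) -/
structure Identifies {S : Finset X} (𝔹 : TwistedForm S (jetBundle S))
    (D : LogConnection S (jetBundle S)) {Z : VectorBundleCore ℂ X (Fin 3 → ℂ) ι}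
    (W : BranchedSO3Oper S Z) (Ψ : ∀ x, Z.Fiber x →ₗ[ℂ] (jetBundle S).Fiber x) : Prop where
  maps_to : ∀ U, IsOpen U → ∀ w, HolOn Z U w → IsSecE D U fun x => Ψ x (w x)
  surjective : ∀ U, IsOpen U → ∀ σ, IsSecE D U σ →
    ∃ w, HolOn Z U w ∧ ∀ x ∈ U, Ψ x (w x) = σ x
  injective : ∀ U, IsOpen U → ∀ w, HolOn Z U w → (∀ x ∈ U, Ψ x (w x) = 0) → ∀ x ∈ U, w x = 0
  form_eq : ∀ x, x ∉ S → ∀ u w, toMero S 2 x (𝔹.form x (Ψ x u) (Ψ x w)) = W.form x u w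
  conn_eq : ∀ U, IsOpen U → ∀ w, HolOn Z U w → ∀ x ∈ U, x ∉ S → ∀ v : TangentSpace 𝓘(ℂ) x,
    D.cov (fun y => Ψ y (w y)) x v = Ψ x (W.conn.cov w x v)
  F1_eq : ∀ x, x ∉ S → ∀ u, u ∈ W.F1 x ↔ Ψ x u ∈ jetF1 S x
  F2_eq : ∀ x, x ∉ S → ∀ u, u ∈ W.F2 x ↔ Ψ x u ∈ jetF2 S x

/-- The pair `(𝔹, D)` defines a branched `SO(3,ℂ)`-oper: the sheaf `𝓔`, with the form, the connection
and the filtration induced by `𝔹`, `D` and `F¹ ⊆ F²`, is a branched `SO(3,ℂ)`-oper of type `S`. -/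
def DefinesBranchedOper {S : Finset X} (𝔹 : TwistedForm S (jetBundle S))
    (D : LogConnection S (jetBundle S)) : Prop :=
  ∃ (J : Type u) (Z : VectorBundleCore ℂ X (Fin 3 → ℂ) J) (_ : Z.IsContMDiff 𝓘(ℂ) ω)
    (W : BranchedSO3Oper S Z) (Ψ : ∀ x, Z.Fiber x →ₗ[ℂ] (jetBundle S).Fiber x),
    Identifies 𝔹 D W Ψ

end Sections

end BranchedOper

end

open BranchedOper

noncomputable section
set_option linter.unusedSectionVars false
namespace BranchedOper
universe u

/-! ### Functions on the surface read in a holomorphic coordinate. -/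

section Coordinates

variable {X : Type u} [TopologicalSpace X] [ChartedSpace ℂ X] {T : Finset X}
  {E : Type*} [NormedAddCommGroup E] [NormedSpace ℂ E]

/-! The heart of the matter is local at a point of `S`. In a coordinate `w` with value `c` at the
point, put `m = w - c`, write `D = d + A dw/m` and let `b` be the Gram matrix of `𝔹` in the jet
frame. The eigenvalue conditions give a constant lower unitriangular change of frame after which
`A(c) = diag(0, -1, -2)`, while `F¹` and `F²` remain spanned by the last one and the last two
vectors (`exists_unip`). A few Taylor coefficients then decide everything. Expanding `D(m s)` shows
that `φ_i` is multiplication by `A'₂₁(c)` (`isPhi_zero_iff`). Expanding the definition of `𝓔` shows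
that its sections `u` satisfy `u₁(c) = u₂(c) = 0`, `A'₁₀(c) u₀(c) = 0` and `u₂'(c) = a u₀(c)` with
`a = A'₂₀(c)` (`section_conditions`). The two entries are tied by the parallelism of `𝔹`, whose
first-order part contains `A'₁₀ b₁₁ + b₀₂ A'₂₁ = 0` with `b₁₁(c)` and `b₀₂(c)` nonzero
(`LocalPair.sub_diag`). So `φ_i = 0` exactly when `A'₁₀(c) = 0`. Necessity: if `A'₁₀(c) ≠ 0`, every
section of `𝓔` is `m` times a section without `F¹` component at `c`. On such sections `m⁻² b` has
rank at most one at `c`, so the form on `𝓔` degenerates (`LocalPair.gram_rank_one`,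
`isPhi_zero_of_definesBranchedOper`). Sufficiency: if `A'₁₀(c) = 0`, then `𝓔` has the frame `(1, 0,
a m)`, `(0, m, 0)`, `(0, 0, m²)` (`modif`). The form extends to a nondegenerate one by the other
first-order identity, `LocalPair.corner` (`LocalPair.exists_gram`). In this frame the connection can
have a residue only in the lower left corner, and a residue that is skew for the extended form has
no such entry (`LocalPair.exists_conn`). Globally, these frames and the frames `(1, m, m²)` away
from `S` are glued to `operBundle`. The transition matrices are lower triangular of determinant 1,
with middle diagonal entry 1 and with the cocycle of `K_X(-S)` as last diagonal entry
(`operChange_entries`); this yields the isomorphisms for `F¹` and `F²/F¹` and a global determinant.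
The volume form is `g · det` with `g² = discr`. It is parallel because the logarithmic derivative of
`discr` is twice the trace of the connection matrix. The second fundamental form of `F¹` is `m s`
with a global function `s` without zeros (`exists_operSecondForm`), and rescaling the isomorphism of
`F²/F¹` by `s⁻¹` makes it equal to 1. -/

lemma AdaptedChart.mem_maximalAtlas_one (ψ : AdaptedChart T) :
    ψ.chart ∈ IsManifold.maximalAtlas 𝓘(ℂ) 1 X :=
  IsManifold.maximalAtlas_subset_of_le le_top ψ.mem_maximalAtlas

/-- The derivative of a function on `X` with respect to a coordinate. -/
def cderiv (ψ : AdaptedChart T) (f : X → E) (x : X) : E :=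
  deriv (fun w => f (ψ.chart.symm w)) (ψ.chart x)

lemma eventually_symm (ψ : AdaptedChart T) {x : X} (hx : x ∈ ψ.chart.source) {p : X → Prop}
    (h : ∀ᶠ y in 𝓝 x, p y) : ∀ᶠ w in 𝓝 (ψ.chart x), p (ψ.chart.symm w) :=
  (ψ.chart.tendsto_symm hx).eventually h

lemma eventually_chart (ψ : AdaptedChart T) {x : X} (hx : x ∈ ψ.chart.source) {p : ℂ → Prop}
    (h : ∀ᶠ w in 𝓝 (ψ.chart x), p w) : ∀ᶠ y in 𝓝 x, p (ψ.chart y) :=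
  (ψ.chart.continuousAt hx).eventually h

lemma eventually_right_inv (ψ : AdaptedChart T) {x : X} (hx : x ∈ ψ.chart.source) :
    ∀ᶠ w in 𝓝 (ψ.chart x), ψ.chart (ψ.chart.symm w) = w := by
  filter_upwards [eventually_mem ψ ψ hx hx] with w hw
  exact ψ.chart.right_inv hw.1

lemma cderiv_congr (ψ : AdaptedChart T) {x : X} (hx : x ∈ ψ.chart.source) {f g : X → E}
    (h : f =ᶠ[𝓝 x] g) : cderiv ψ f x = cderiv ψ g x :=
  EventuallyEq.deriv_eq (eventually_symm ψ hx h)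

lemma mdifferentiableAt_iff_coord (ψ : AdaptedChart T) {x : X} (hx : x ∈ ψ.chart.source)
    {f : X → E} : MDifferentiableAt 𝓘(ℂ) 𝓘(ℂ, E) f x ↔
      DifferentiableAt ℂ (fun w => f (ψ.chart.symm w)) (ψ.chart x) := by
  rw [← mdifferentiableWithinAt_univ,
    mdifferentiableWithinAt_iff_source_of_mem_maximalAtlas ψ.mem_maximalAtlas_one hx]
  simp only [mfld_simps,
    mdifferentiableWithinAt_univ, mdifferentiableAt_iff_differentiableAt]
  rfl

lemma mdifferentiableAt_chart (ψ : AdaptedChart T) {x : X} (hx : x ∈ ψ.chart.source) :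
    MDifferentiableAt 𝓘(ℂ) 𝓘(ℂ) ψ.chart x :=
  mdifferentiableAt_of_mem_maximalAtlas ψ.mem_maximalAtlas_one hx

lemma mvfderiv_eq_cderiv (ψ : AdaptedChart T) {x : X} (hx : x ∈ ψ.chart.source) {f : X → E}
    (hf : MDifferentiableAt 𝓘(ℂ) 𝓘(ℂ, E) f x) (v : TangentSpace 𝓘(ℂ) x) :
    mvfderiv 𝓘(ℂ) f x v = mvfderiv 𝓘(ℂ) ψ.chart x v • cderiv ψ f x := by
  have hd := (mdifferentiableAt_iff_coord ψ hx).mp hf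
  have h1 : HasMFDerivAt 𝓘(ℂ) 𝓘(ℂ, E) ((fun w => f (ψ.chart.symm w)) ∘ ψ.chart) x _ :=
    hd.hasFDerivAt.hasMFDerivAt.comp x (mdifferentiableAt_chart ψ hx).hasMFDerivAt
  have h2 : HasMFDerivAt 𝓘(ℂ) 𝓘(ℂ, E) f x _ := h1.congr_of_eventuallyEq (by
    filter_upwards [ψ.chart.open_source.mem_nhds hx] with y hy
    simp [ψ.chart.left_inv hy])
  have h3 : mvfderiv 𝓘(ℂ) f x v = fderiv ℂ (fun w => f (ψ.chart.symm w)) (ψ.chart x)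
      (mvfderiv 𝓘(ℂ) ψ.chart x v) := by
    unfold mvfderiv
    rw [h2.mfderiv]
    rfl
  rw [h3, cderiv, ← fderiv_apply_one_eq_deriv, ← map_smul]
  simp

/-- Evaluation on such a vector extracts the coefficient of `dz` from an identity of 1-forms. The
vector is the image of 1 under the derivative of the inverse chart. -/
lemma exists_mvfderiv_chart_eq_one (ψ : AdaptedChart T) {x : X} (hx : x ∈ ψ.chart.source) :
    ∃ v : TangentSpace 𝓘(ℂ) x, mvfderiv 𝓘(ℂ) ψ.chart x v = 1 := by
  have h1 := mdifferentiableAt_chart ψ hx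
  have h2 : MDifferentiableAt 𝓘(ℂ) 𝓘(ℂ) ψ.chart.symm (ψ.chart x) :=
    mdifferentiableAt_symm_of_mem_maximalAtlas ψ.mem_maximalAtlas_one (ψ.chart.map_source hx)
  have h1' : MDifferentiableAt 𝓘(ℂ) 𝓘(ℂ) ψ.chart (ψ.chart.symm (ψ.chart x)) := by
    rwa [ψ.chart.left_inv hx]
  have h3 := mfderiv_comp (ψ.chart x) h1' h2
  have h4 : mfderiv 𝓘(ℂ) 𝓘(ℂ) (ψ.chart ∘ ψ.chart.symm) (ψ.chart x) =
      ContinuousLinearMap.id ℂ ℂ := by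
    rw [EventuallyEq.mfderiv_eq (f := id)]
    · exact mfderiv_id
    · exact eventually_right_inv ψ hx
  rw [h4] at h3
  have h5 := congrArg (fun L : ℂ →L[ℂ] ℂ => L 1) h3
  have key : ∃ v : TangentSpace 𝓘(ℂ) (ψ.chart.symm (ψ.chart x)),
      mvfderiv 𝓘(ℂ) ψ.chart (ψ.chart.symm (ψ.chart x)) v = 1 :=
    ⟨mfderiv 𝓘(ℂ) 𝓘(ℂ) ψ.chart.symm (ψ.chart x) (1 : ℂ), h5.symm⟩
  rwa [ψ.chart.left_inv hx] at key

/-- Holomorphy near a point, expressed in a coordinate. -/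
lemma analyticAt_coord_of_forall [CompleteSpace E] (ψ : AdaptedChart T) {x : X}
    (hx : x ∈ ψ.chart.source) {f : X → E} {U : Set X} (hU : IsOpen U) (hxU : x ∈ U)
    (hf : MDifferentiableOn 𝓘(ℂ) 𝓘(ℂ, E) f U) :
    AnalyticAt ℂ (fun w => f (ψ.chart.symm w)) (ψ.chart x) := by
  rw [Complex.analyticAt_iff_eventually_differentiableAt]
  filter_upwards [eventually_mem ψ ψ hx hx, eventually_symm ψ hx (hU.mem_nhds hxU)] with w hw hwU
  have h := (hf _ hwU).mdifferentiableAt (hU.mem_nhds hwU)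
  rw [mdifferentiableAt_iff_coord ψ hw.2.1, ψ.chart.right_inv hw.1] at h
  exact h

lemma mdifferentiableOn_of_analyticAt {f : X → E} {U : Set X}
    (hf : ∀ x ∈ U, ∃ (T : Finset X) (ψ : AdaptedChart T), x ∈ ψ.chart.source ∧
      AnalyticAt ℂ (fun w => f (ψ.chart.symm w)) (ψ.chart x)) :
    MDifferentiableOn 𝓘(ℂ) 𝓘(ℂ, E) f U := by
  intro x hx
  obtain ⟨T, ψ, hψ, h⟩ := hf x hx
  exact ((mdifferentiableAt_iff_coord ψ hψ).mpr h.differentiableAt).mdifferentiableWithinAt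

/-- The change of coordinate for functions on `X`. -/
lemma analyticAt_coord_change {T' : Finset X} (ψ : AdaptedChart T) (χ : AdaptedChart T')
    {x : X} (hx : x ∈ ψ.chart.source) (hx' : x ∈ χ.chart.source) {f : X → E}
    (hf : AnalyticAt ℂ (fun w => f (ψ.chart.symm w)) (ψ.chart x)) :
    AnalyticAt ℂ (fun w => f (χ.chart.symm w)) (χ.chart x) := by
  have h1 := contMDiffAt_symm_of_mem_maximalAtlas χ.mem_maximalAtlas (χ.chart.map_source hx')
  have h2 := contMDiffAt_of_mem_maximalAtlas ψ.mem_maximalAtlas hx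
  rw [← χ.chart.left_inv hx'] at h2
  have h3 := h2.comp _ h1
  rw [contMDiffAt_iff_contDiffAt] at h3
  have h4 := h3.analyticAt
  have h5 : AnalyticAt ℂ (fun w => f (ψ.chart.symm w))
      ((ψ.chart ∘ χ.chart.symm) (χ.chart x)) := by
    simpa [χ.chart.left_inv hx'] using hf
  refine (h5.comp h4).congr ?_
  filter_upwards [eventually_symm χ hx' (ψ.chart.open_source.mem_nhds hx)] with w hw
  simp [ψ.chart.left_inv hw]

end Coordinates

/-! ### Sections of a bundle read in its frames. -/

section Bundles

variable {X : Type u} [TopologicalSpace X] [ChartedSpace ℂ X] {T : Finset X}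
  {F : Type*} [NormedAddCommGroup F] [NormedSpace ℂ F] {ι : Type*}
  (Z : VectorBundleCore ℂ X F ι)

/-- The coordinates of a vector in the frame `i`. -/
def toFrame (i : ι) (x : X) : Z.Fiber x →L[ℂ] F := Z.coordChange (Z.indexAt x) i x

/-- The vector with given coordinates in the frame `i`. -/
def ofFrame (i : ι) (x : X) : F →L[ℂ] Z.Fiber x := Z.coordChange i (Z.indexAt x) x

variable {Z}

lemma toFrame_ofFrame {i : ι} {x : X} (hx : x ∈ Z.baseSet i) (v : F) :
    toFrame Z i x (ofFrame Z i x v) = v := by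
  have h := Z.coordChange_comp i (Z.indexAt x) i x ⟨⟨hx, Z.mem_baseSet_at x⟩, hx⟩ v
  rw [Z.coordChange_self i x hx] at h
  exact h

lemma ofFrame_toFrame {i : ι} {x : X} (hx : x ∈ Z.baseSet i) (v : Z.Fiber x) :
    ofFrame Z i x (toFrame Z i x v) = v := by
  have h := Z.coordChange_comp (Z.indexAt x) i (Z.indexAt x) x
    ⟨⟨Z.mem_baseSet_at x, hx⟩, Z.mem_baseSet_at x⟩ v
  exact h.trans (Z.coordChange_self _ x (Z.mem_baseSet_at x) v)

lemma toFrame_injective {i : ι} {x : X} (hx : x ∈ Z.baseSet i) {u v : Z.Fiber x}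
    (h : toFrame Z i x u = toFrame Z i x v) : u = v := by
  rw [← ofFrame_toFrame hx u, h, ofFrame_toFrame hx]

lemma coordChange_toFrame {i j : ι} {x : X} (hi : x ∈ Z.baseSet i) (hj : x ∈ Z.baseSet j)
    (v : Z.Fiber x) : Z.coordChange i j x (toFrame Z i x v) = toFrame Z j x v :=
  Z.coordChange_comp (Z.indexAt x) i j x ⟨⟨Z.mem_baseSet_at x, hi⟩, hj⟩ v

lemma toFrame_indexAt (x : X) (v : Z.Fiber x) : toFrame Z (Z.indexAt x) x v = v :=
  Z.coordChange_self _ x (Z.mem_baseSet_at x) v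

lemma ofFrame_indexAt (x : X) (v : F) : ofFrame Z (Z.indexAt x) x v = v :=
  Z.coordChange_self _ x (Z.mem_baseSet_at x) v

lemma HolOn.mdifferentiableAt {U : Set X} (hU : IsOpen U) {σ : ∀ x, Z.Fiber x}
    (h : HolOn Z U σ) {x : X} (hx : x ∈ U) :
    MDifferentiableAt 𝓘(ℂ) (𝓘(ℂ).prod 𝓘(ℂ, F)) (fun x => TotalSpace.mk' F x (σ x)) x :=
  (h x hx).mdifferentiableAt (hU.mem_nhds hx)

lemma HolOn.mono {U V : Set X} {σ : ∀ x, Z.Fiber x} (h : HolOn Z U σ) (hV : V ⊆ U) :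
    HolOn Z V σ := MDifferentiableOn.mono h hV

variable [Z.IsContMDiff 𝓘(ℂ) ω]

lemma mdifferentiableAt_section_iff_frame {i : ι} {x : X} (hi : x ∈ Z.baseSet i)
    {σ : ∀ x, Z.Fiber x} :
    MDifferentiableAt 𝓘(ℂ) (𝓘(ℂ).prod 𝓘(ℂ, F)) (fun x => TotalSpace.mk' F x (σ x)) x ↔
      MDifferentiableAt 𝓘(ℂ) 𝓘(ℂ, F) (fun y => toFrame Z i y (σ y)) x := by
  have : ContMDiffVectorBundle 1 F Z.Fiber 𝓘(ℂ) := ContMDiffVectorBundle.of_le (n := ω) le_top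
  have hm : MemTrivializationAtlas (Z.localTriv i) := ⟨mem_range_self i⟩
  exact (Z.localTriv i).mdifferentiableAt_section_iff 𝓘(ℂ) σ hi

lemma holOn_iff_frame {U : Set X} (hU : IsOpen U) {σ : ∀ x, Z.Fiber x} :
    HolOn Z U σ ↔ ∀ x ∈ U, ∃ i, x ∈ Z.baseSet i ∧
      MDifferentiableAt 𝓘(ℂ) 𝓘(ℂ, F) (fun y => toFrame Z i y (σ y)) x := by
  constructor
  · intro h x hx
    exact ⟨Z.indexAt x, Z.mem_baseSet_at x,
      (mdifferentiableAt_section_iff_frame (Z.mem_baseSet_at x)).mp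
        ((h x hx).mdifferentiableAt (hU.mem_nhds hx))⟩
  · intro h x hx
    obtain ⟨i, hi, hd⟩ := h x hx
    exact ((mdifferentiableAt_section_iff_frame hi).mpr hd).mdifferentiableWithinAt

lemma HolOn.mdifferentiableAt_frame {U : Set X} (hU : IsOpen U) {σ : ∀ x, Z.Fiber x}
    (h : HolOn Z U σ) {x : X} (hx : x ∈ U) {i : ι} (hi : x ∈ Z.baseSet i) :
    MDifferentiableAt 𝓘(ℂ) 𝓘(ℂ, F) (fun y => toFrame Z i y (σ y)) x :=
  (mdifferentiableAt_section_iff_frame hi).mp (h.mdifferentiableAt hU hx)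

lemma HolOn.analyticAt [CompleteSpace F] {U : Set X} (hU : IsOpen U) {σ : ∀ x, Z.Fiber x}
    (h : HolOn Z U σ) {x : X} (hx : x ∈ U) {i : ι} (hi : x ∈ Z.baseSet i)
    (ψ : AdaptedChart T) (hψ : x ∈ ψ.chart.source) :
    AnalyticAt ℂ (fun w => toFrame Z i (ψ.chart.symm w) (σ (ψ.chart.symm w))) (ψ.chart x) :=
  analyticAt_coord_of_forall (f := fun y => toFrame Z i y (σ y)) ψ hψ
    (hU.inter (Z.isOpen_baseSet i)) ⟨hx, hi⟩
    fun _ hy => (h.mdifferentiableAt_frame hU hy.1 hy.2).mdifferentiableWithinAt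

lemma holOn_of_analyticAt {U : Set X} {σ : ∀ x, Z.Fiber x}
    (h : ∀ x ∈ U, ∃ i, x ∈ Z.baseSet i ∧ ∃ (T : Finset X) (ψ : AdaptedChart T),
      x ∈ ψ.chart.source ∧ AnalyticAt ℂ
        (fun w => toFrame Z i (ψ.chart.symm w) (σ (ψ.chart.symm w))) (ψ.chart x)) :
    HolOn Z U σ := by
  intro x hx
  obtain ⟨i, hi, T, ψ, hψ, ha⟩ := h x hx
  exact ((mdifferentiableAt_section_iff_frame hi).mpr
    ((mdifferentiableAt_iff_coord (f := fun y => toFrame Z i y (σ y)) ψ hψ).mpr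
      ha.differentiableAt)).mdifferentiableWithinAt

lemma holOn_ofFrame {i : ι} {U : Set X} (hU : IsOpen U) (hi : U ⊆ Z.baseSet i) {f : X → F}
    (hf : MDifferentiableOn 𝓘(ℂ) 𝓘(ℂ, F) f U) : HolOn Z U fun x => ofFrame Z i x (f x) := by
  refine (holOn_iff_frame hU).mpr fun x hx => ⟨i, hi hx, ?_⟩
  refine ((hf x hx).mdifferentiableAt (hU.mem_nhds hx)).congr_of_eventuallyEq ?_
  filter_upwards [hU.mem_nhds hx] with y hy
  exact toFrame_ofFrame (hi hy) _

end Bundles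

/-! ### Removing punctures and dividing by powers of `w - c`. -/

section Division

variable {E : Type*} [NormedAddCommGroup E] [NormedSpace ℂ E]

/-- The hypotheses on `𝔹` and `D` are stated away from `S`; this continuity argument carries their
consequences to the points of `S`. -/
lemma eq_of_eventuallyEq_punctured {f g : ℂ → E} {c : ℂ} (hf : ContinuousAt f c)
    (hg : ContinuousAt g c) (h : ∀ᶠ w in 𝓝[≠] c, f w = g w) : f c = g c := by
  have h1 : Tendsto f (𝓝[≠] c) (𝓝 (f c)) := hf.tendsto.mono_left nhdsWithin_le_nhds
  have h2 : Tendsto g (𝓝[≠] c) (𝓝 (g c)) := hg.tendsto.mono_left nhdsWithin_le_nhds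
  exact tendsto_nhds_unique (h1.congr' h) h2

lemma eventually_of_punctured {p : ℂ → Prop} {c : ℂ} (h : ∀ᶠ w in 𝓝[≠] c, p w) (hc : p c) :
    ∀ᶠ w in 𝓝 c, p w := by
  rw [eventually_nhdsWithin_iff] at h
  filter_upwards [h] with w hw
  by_cases hwc : w = c
  · rwa [hwc]
  · exact hw hwc

lemma eventuallyEq_of_punctured {f g : ℂ → E} {c : ℂ} (hf : ContinuousAt f c)
    (hg : ContinuousAt g c) (h : ∀ᶠ w in 𝓝[≠] c, f w = g w) : f =ᶠ[𝓝 c] g :=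
  eventually_of_punctured h (eq_of_eventuallyEq_punctured hf hg h)

/-- The quotient is `dslope f c`, so the factorization holds at every `w` and not only near `c`. -/
lemma exists_eq_sub_smul {f : ℂ → E} {c : ℂ} (hf : AnalyticAt ℂ f c) (h0 : f c = 0) :
    ∃ g : ℂ → E, AnalyticAt ℂ g c ∧ (∀ w, f w = (w - c) • g w) ∧ g c = deriv f c := by
  obtain ⟨p, hp⟩ := hf
  refine ⟨dslope f c, ⟨_, hp.has_fpower_series_dslope_fslope⟩, fun w => ?_, dslope_same f c⟩
  rw [sub_smul_dslope, h0, sub_zero]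

lemma deriv_sub_mul {g : ℂ → ℂ} {c : ℂ} (hg : DifferentiableAt ℂ g c) :
    deriv (fun w => (w - c) * g w) c = g c := by
  have h := ((hasDerivAt_id c).sub_const c).mul hg.hasDerivAt
  simpa using! h.deriv

lemma exists_eq_sub_sq_mul {f : ℂ → ℂ} {c : ℂ} (hf : AnalyticAt ℂ f c) (h0 : f c = 0)
    (h1 : deriv f c = 0) :
    ∃ g : ℂ → ℂ, AnalyticAt ℂ g c ∧ ∀ w, f w = (w - c) ^ 2 * g w := by
  obtain ⟨g, hg, e, hgc⟩ := exists_eq_sub_smul hf h0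
  obtain ⟨k, hk, e', -⟩ := exists_eq_sub_smul hg (hgc.trans h1)
  refine ⟨k, hk, fun w => ?_⟩
  rw [e, e', smul_eq_mul, smul_eq_mul]
  ring

end Division

/-! ### Calculus of analytic 3×3 matrix functions. -/

section MatrixFunctions

abbrev Mat3 := Matrix (Fin 3) (Fin 3) ℂ

/-- A matrix function with entries analytic at `c`. -/
def AnalyticM (A : ℂ → Mat3) (c : ℂ) : Prop := ∀ i j, AnalyticAt ℂ (fun w => A w i j) c

/-- The matrix of the derivatives of the entries. -/
def derivM (A : ℂ → Mat3) (w : ℂ) : Mat3 := Matrix.of fun i j => deriv (fun t => A t i j) w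

lemma derivM_apply (A : ℂ → Mat3) (w : ℂ) (i j : Fin 3) :
    derivM A w i j = deriv (fun t => A t i j) w := rfl

/-- Entrywise differentiability of a matrix function. -/
def HasDerivM (A : ℂ → Mat3) (A' : Mat3) (w : ℂ) : Prop :=
  ∀ i j, HasDerivAt (fun t => A t i j) (A' i j) w

variable {A B : ℂ → Mat3} {A' B' : Mat3} {c w : ℂ}

lemma AnalyticM.hasDerivM (h : AnalyticM A c) : HasDerivM A (derivM A c) c :=
  fun i j => (h i j).differentiableAt.hasDerivAt

lemma HasDerivM.derivM_eq (h : HasDerivM A A' w) : derivM A w = A' := by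
  ext i j
  exact (h i j).deriv

lemma AnalyticM.eventually (h : AnalyticM A c) : ∀ᶠ w in 𝓝 c, AnalyticM A w := by
  simp only [AnalyticM, eventually_all]
  exact fun i j => (h i j).eventually_analyticAt

lemma AnalyticM.congr (h : AnalyticM A c) (e : A =ᶠ[𝓝 c] B) : AnalyticM B c :=
  fun i j => (h i j).congr (e.mono fun w hw => by simp only [hw])

lemma AnalyticM.derivM (h : AnalyticM A c) : AnalyticM (derivM A) c :=
  fun i j => (h i j).deriv

lemma AnalyticM.mul (hA : AnalyticM A c) (hB : AnalyticM B c) :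
    AnalyticM (fun w => A w * B w) c := fun i j => by
  simp only [Matrix.mul_apply]
  exact Finset.analyticAt_fun_sum _ fun k _ => (hA i k).mul (hB k j)

lemma AnalyticM.add (hA : AnalyticM A c) (hB : AnalyticM B c) :
    AnalyticM (fun w => A w + B w) c := fun i j => (hA i j).add (hB i j)

lemma AnalyticM.smul {f : ℂ → ℂ} (hf : AnalyticAt ℂ f c) (hA : AnalyticM A c) :
    AnalyticM (fun w => f w • A w) c := fun i j => hf.mul (hA i j)

lemma AnalyticM.transpose (hA : AnalyticM A c) :
    AnalyticM (fun w => (A w).transpose) c := fun i j => hA j i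

lemma analyticM_const (M : Mat3) : AnalyticM (fun _ => M) c := fun _ _ => analyticAt_const

lemma AnalyticM.det (hA : AnalyticM A c) : AnalyticAt ℂ (fun w => (A w).det) c := by
  simp only [Matrix.det_fin_three]
  have h := hA
  unfold AnalyticM at h
  exact ((((((h _ _).mul (h _ _)).mul (h _ _)).sub (((h _ _).mul (h _ _)).mul (h _ _))).sub
    (((h _ _).mul (h _ _)).mul (h _ _))).add (((h _ _).mul (h _ _)).mul (h _ _))).add
    (((h _ _).mul (h _ _)).mul (h _ _)) |>.sub (((h _ _).mul (h _ _)).mul (h _ _))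

lemma AnalyticM.inv (hA : AnalyticM A c) (h0 : (A c).det ≠ 0) :
    AnalyticM (fun w => (A w)⁻¹) c := by
  intro i j
  simp only [Matrix.inv_def, Matrix.smul_apply, Ring.inverse_eq_inv', smul_eq_mul]
  refine (hA.det.inv h0).mul ?_
  simp only [Matrix.adjugate_fin_three]
  have h := hA
  unfold AnalyticM at h
  fin_cases i <;> fin_cases j <;> simp <;>
    first
      | exact ((h _ _).mul (h _ _)).sub ((h _ _).mul (h _ _))
      | exact ((h _ _).mul (h _ _)).neg.add ((h _ _).mul (h _ _))

lemma AnalyticM.mulVec {u : ℂ → Fin 3 → ℂ} (hA : AnalyticM A c) (hu : AnalyticAt ℂ u c) :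
    AnalyticAt ℂ (fun w => (A w).mulVec (u w)) c := by
  rw [analyticAt_pi_iff] at hu ⊢
  intro i
  simp only [Matrix.mulVec, dotProduct]
  exact Finset.analyticAt_fun_sum _ fun k _ => (hA i k).mul (hu k)

lemma HasDerivM.mul (hA : HasDerivM A A' w) (hB : HasDerivM B B' w) :
    HasDerivM (fun t => A t * B t) (A' * B w + A w * B') w := fun i j => by
  simp only [Matrix.mul_apply, Matrix.add_apply, ← Finset.sum_add_distrib]
  exact HasDerivAt.fun_sum fun k _ => (hA i k).mul (hB k j)

lemma HasDerivM.smul {f : ℂ → ℂ} {f' : ℂ} (hf : HasDerivAt f f' w) (hA : HasDerivM A A' w) :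
    HasDerivM (fun t => f t • A t) (f' • A w + f w • A') w := fun i j => hf.mul (hA i j)

lemma HasDerivM.transpose (hA : HasDerivM A A' w) :
    HasDerivM (fun t => (A t).transpose) A'.transpose w := fun i j => hA j i

lemma hasDerivM_const (M : Mat3) : HasDerivM (fun _ => M) 0 w := fun _ _ => hasDerivAt_const _ _

lemma HasDerivM.congr (hA : HasDerivM A A' w) (e : B =ᶠ[𝓝 w] A) : HasDerivM B A' w :=
  fun i j => (hA i j).congr_of_eventuallyEq (e.mono fun t ht => by simp only [ht])

lemma HasDerivM.mulVec {u : ℂ → Fin 3 → ℂ} {u' : Fin 3 → ℂ} (hA : HasDerivM A A' w)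
    (hu : HasDerivAt u u' w) :
    HasDerivAt (fun t => (A t).mulVec (u t)) (A'.mulVec (u w) + (A w).mulVec u') w := by
  rw [hasDerivAt_pi] at hu ⊢
  intro i
  simp only [Matrix.mulVec, dotProduct, Pi.add_apply, ← Finset.sum_add_distrib]
  exact HasDerivAt.fun_sum fun k _ => (hA i k).mul (hu k)

/-- If the form `b`, with values in `O(2 S)`, is parallel for `d + A / m`, and if the connection has the
matrix `C` in the frame `G`, then the Gram matrix of this frame is parallel. -/
lemma gram_parallel {m : ℂ → ℂ} {m' : ℂ} {A b G C H : ℂ → Mat3} {b' G' : Mat3}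
    (hm : HasDerivAt m m' w) (hm0 : m w ≠ 0) (hb : HasDerivM b b' w) (hG : HasDerivM G G' w)
    (hpar : m w • b' - (2 * m') • b w = (A w).transpose * b w + b w * A w)
    (hC : G w * C w = G' + (m w)⁻¹ • (A w * G w))
    (hH : ∀ᶠ t in 𝓝 w, H t = ((m t) ^ 2)⁻¹ • ((G t).transpose * b t * G t)) :
    HasDerivM H ((C w).transpose * H w + H w * C w) w := by
  have hm2 : HasDerivAt (fun t => ((m t) ^ 2)⁻¹) (-(2 * m w * m') / (m w ^ 2) ^ 2) w := by
    have := (hm.pow 2).fun_inv (pow_ne_zero 2 hm0)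
    simpa using! this
  have h1 := ((hG.transpose.mul hb).mul hG).smul hm2 |>.congr hH
  have hG' : G' = G w * C w - (m w)⁻¹ • (A w * G w) := by rw [hC]; simp
  have hb' : b' = (m w)⁻¹ • ((2 * m') • b w + ((A w).transpose * b w + b w * A w)) := by
    rw [← hpar]
    simp [smul_smul, hm0]
  convert h1 using 1
  rw [hH.self_of_nhds, hG', hb']
  simp only [Matrix.transpose_sub, Matrix.transpose_mul, Matrix.transpose_smul, Matrix.mul_add,
    Matrix.add_mul, Matrix.mul_sub, Matrix.sub_mul, Matrix.smul_mul, Matrix.mul_smul, smul_add,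
    smul_sub, smul_smul, Matrix.mul_assoc]
  -- The twist of `b` by `O(2 S)` contributes `2 m' b / m`, which cancels the derivative of the
  -- factor `m⁻²`.
  have e : (m w ^ 2)⁻¹ * ((m w)⁻¹ * (2 * m')) = -(-(2 * m w * m') / (m w ^ 2) ^ 2) := by
    field_simp
  rw [e]
  module

/-- This is Jacobi's formula, checked as a polynomial identity so that `H` need not be invertible.
-/
lemma det_hasDerivAt {H : ℂ → Mat3} {C : Mat3}
    (h : HasDerivM H (C.transpose * H w + H w * C) w) :
    HasDerivAt (fun t => (H t).det) (2 * C.trace * (H w).det) w := by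
  have h1 := ((((((h 0 0).mul (h 1 1)).mul (h 2 2)).sub (((h 0 0).mul (h 1 2)).mul (h 2 1))).sub
    (((h 0 1).mul (h 1 0)).mul (h 2 2))).add (((h 0 1).mul (h 1 2)).mul (h 2 0))).add
    (((h 0 2).mul (h 1 0)).mul (h 2 1)) |>.sub (((h 0 2).mul (h 1 1)).mul (h 2 0))
  refine (h1.congr_deriv ?_).congr_of_eventuallyEq (Eventually.of_forall fun t => ?_)
  · simp only [Matrix.add_apply, Matrix.mul_apply, Matrix.transpose_apply, Fin.sum_univ_three,
      Matrix.det_fin_three, Matrix.trace, Matrix.diag, Pi.mul_apply]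
    ring
  · simp [Matrix.det_fin_three]

end MatrixFunctions

/-! ### Taylor coefficients of the pair at a point of `S`. -/

section LocalModel

/-- The matrices `A` of a logarithmic connection `d + A dz / (z - c)` and `b` of a parallel form with
values in `O(2 c)`, in a frame adapted to the filtration. -/
structure LocalPair (c : ℂ) (A b : ℂ → Mat3) : Prop where
  anA : AnalyticM A c
  anb : AnalyticM b c
  symm : ∀ᶠ w in 𝓝 c, (b w).transpose = b w
  b12 : ∀ᶠ w in 𝓝 c, b w 1 2 = 0
  b22 : ∀ᶠ w in 𝓝 c, b w 2 2 = 0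
  A02 : ∀ᶠ w in 𝓝 c, A w 0 2 = 0
  det_ne : (b c).det ≠ 0
  par : ∀ᶠ w in 𝓝[≠] c,
    (w - c) • derivM b w - (2 : ℂ) • b w = (A w).transpose * b w + b w * A w

/-- The change of frame from a basis adapted to the filtration. -/
def unip (p q r : ℂ) : Mat3 := !![1, 0, 0; q, 1, 0; r, p, 1]

def unipInv (p q r : ℂ) : Mat3 := !![1, 0, 0; -q, 1, 0; p * q - r, -p, 1]

lemma unip_mul_unipInv (p q r : ℂ) : unip p q r * unipInv p q r = 1 := by
  ext i j
  fin_cases i <;> fin_cases j <;>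
    simp [unip, unipInv, Matrix.mul_apply, Fin.sum_univ_three]
  ring

lemma unipInv_mul_unip (p q r : ℂ) : unipInv p q r * unip p q r = 1 :=
  mul_eq_one_comm.mp (unip_mul_unipInv p q r)

/-- The eigenvalues `0, -1, -2` of the residue. -/
def resDiag : Mat3 := Matrix.diagonal ![0, -1, -2]

variable {c : ℂ} {A b : ℂ → Mat3}

lemma derivM_conj {M N : Mat3} {A : ℂ → Mat3} {w : ℂ} (hA : AnalyticM A w) :
    derivM (fun t => M * A t * N) w = M * derivM A w * N := by
  have h := ((hasDerivM_const (w := w) M).mul hA.hasDerivM).mul (hasDerivM_const N)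
  rw [h.derivM_eq]
  simp

/-- The change of frame is constant, so no derivative of it appears, and lower triangular, so the
zero entries of `A` and `b` that express the filtration survive. -/
lemma LocalPair.conj (h : LocalPair c A b) (p q r : ℂ) :
    LocalPair c (fun w => unipInv p q r * A w * unip p q r)
      (fun w => (unip p q r).transpose * b w * unip p q r) where
  anA := ((analyticM_const _).mul h.anA).mul (analyticM_const _)
  anb := ((analyticM_const _).mul h.anb).mul (analyticM_const _)
  symm := by
    filter_upwards [h.symm] with w hw
    simp [Matrix.transpose_mul, hw, Matrix.mul_assoc]
  b12 := by
    filter_upwards [h.b12, h.b22] with w h1 h2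
    simp [Matrix.mul_apply, Fin.sum_univ_three, unip, h1, h2]
  b22 := by
    filter_upwards [h.b22] with w h2
    simp [Matrix.mul_apply, Fin.sum_univ_three, unip, h2]
  A02 := by
    filter_upwards [h.A02] with w h2
    simp only [Matrix.mul_apply, Fin.sum_univ_three]
    simp [unip, unipInv, h2]
  det_ne := by
    have e : (unip p q r).det = 1 := by simp [unip, Matrix.det_fin_three]
    simp [Matrix.det_mul, e, h.det_ne]
  par := by
    filter_upwards [h.par, h.anb.eventually.filter_mono nhdsWithin_le_nhds] with w hw hb
    rw [derivM_conj hb]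
    have e := unip_mul_unipInv p q r
    have e' : (unipInv p q r).transpose * (unip p q r).transpose = 1 := by
      rw [← Matrix.transpose_mul, e, Matrix.transpose_one]
    have h1 := congrArg (fun M => (unip p q r).transpose * M * unip p q r) hw
    simp only [Matrix.mul_sub, Matrix.sub_mul, Matrix.mul_smul, Matrix.smul_mul, Matrix.mul_add,
      Matrix.add_mul] at h1
    rw [h1]
    simp only [Matrix.transpose_mul]
    congr 1
    · calc _ = (unip p q r).transpose * (A w).transpose * (1 * b w) * unip p q r := by
            simp only [Matrix.mul_assoc, Matrix.one_mul]
        _ = _ := by rw [← e']; simp only [Matrix.mul_assoc]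
    · calc _ = (unip p q r).transpose * b w * (1 * (A w * unip p q r)) := by
            simp only [Matrix.mul_assoc, Matrix.one_mul]
        _ = _ := by rw [← e]; simp only [Matrix.mul_assoc]

lemma LocalPair.par_full (h : LocalPair c A b) (j k : Fin 3) : ∀ᶠ w in 𝓝 c,
    (w - c) * deriv (fun t => b t j k) w - 2 * b w j k =
      ∑ l, (A w l j * b w l k + b w j l * A w l k) := by
  refine eventuallyEq_of_punctured ?_ ?_ ?_
  · exact ((((analyticAt_id (𝕜 := ℂ) (z := c)).sub analyticAt_const).mul (h.anb j k).deriv).sub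
      (analyticAt_const.mul (h.anb j k))).continuousAt
  · exact (Finset.analyticAt_fun_sum _ fun l _ =>
      ((h.anA l j).mul (h.anb l k)).add ((h.anb j l).mul (h.anA l k))).continuousAt
  · filter_upwards [h.par] with w hw
    have := congrFun (congrFun hw j) k
    simpa [Matrix.mul_apply, derivM_apply, Finset.sum_add_distrib] using this

/-- The equation of parallelism differentiated once at `c`: on the left `b' + (w - c) b'' - 2 b'`
reduces to `-b'`. -/
lemma LocalPair.par_one (h : LocalPair c A b) (j k : Fin 3) :
    - derivM b c j k = ∑ l, (derivM A c l j * b c l k + A c l j * derivM b c l k +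
      (derivM b c j l * A c l k + b c j l * derivM A c l k)) := by
  have h1 := ((hasDerivAt_id c).sub_const c).mul (h.anb j k).deriv.differentiableAt.hasDerivAt
    |>.sub ((h.anb.hasDerivM j k).const_mul 2)
  have h2 : HasDerivAt (fun w => ∑ l, (A w l j * b w l k + b w j l * A w l k)) _ c :=
    HasDerivAt.fun_sum fun l _ =>
    ((h.anA.hasDerivM l j).mul (h.anb.hasDerivM l k)).add
      ((h.anb.hasDerivM j l).mul (h.anA.hasDerivM l k))
  have h3 := EventuallyEq.deriv_eq (h.par_full j k)
  have h1' : deriv (fun w => (w - c) * deriv (fun t => b t j k) w - 2 * b w j k) c = _ := h1.deriv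
  rw [h1', h2.deriv] at h3
  rw [← h3]
  simp [derivM_apply]
  ring

variable (hR : A c = resDiag)
include hR

/-- At order zero parallelism reads `(λ_j + λ_k + 2) b_jk(c) = 0` for the eigenvalues `λ = (0, -1,
-2)`. Only `b₁₁`, `b₀₂` and `b₂₀` can survive, and nondegeneracy forces them to be nonzero. -/
lemma LocalPair.b_zero (h : LocalPair c A b) :
    b c 0 0 = 0 ∧ b c 0 1 = 0 ∧ b c 1 0 = 0 ∧ b c 1 2 = 0 ∧ b c 2 1 = 0 ∧ b c 2 2 = 0 ∧
      b c 2 0 = b c 0 2 ∧ b c 0 2 ≠ 0 ∧ b c 1 1 ≠ 0 := by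
  have hs := h.symm.self_of_nhds
  have s (i j : Fin 3) : b c j i = b c i j := congrFun (congrFun hs i) j
  have h0 (j k : Fin 3) := (h.par_full j k).self_of_nhds
  have h00 := h0 0 0
  have h01 := h0 0 1
  simp [hR, resDiag, Fin.sum_univ_three] at h00 h01
  have e01 : b c 0 1 = 0 := by linear_combination h01
  have e12 := h.b12.self_of_nhds
  have e22 := h.b22.self_of_nhds
  have hd := h.det_ne
  rw [Matrix.det_fin_three, s 0 1, s 1 2, s 0 2, h00, e01, e12, e22] at hd
  refine ⟨h00, e01, by rw [s 0 1, e01], e12, by rw [s 1 2, e12], e22, s 0 2, ?_, ?_⟩ <;>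
    · intro h
      rw [h] at hd
      simp at hd

/-- In the entry (0, 1) of the first-order equation the unknown `b₀₁'` has coefficient `-1` on the
left and `λ₀ + λ₁ = -1` on the right, so it drops out and a relation between the entries of `A'`
alone remains. -/
lemma LocalPair.sub_diag (h : LocalPair c A b) :
    derivM A c 1 0 * b c 1 1 + b c 0 2 * derivM A c 2 1 = 0 := by
  obtain ⟨h00, h01, h10, h12, h21, h22, h20, -, -⟩ := h.b_zero hR
  have h1 := h.par_one 0 1
  simp [hR, resDiag, Fin.sum_univ_three, h00, h01, h21] at h1
  linear_combination -h1

/-- In the entry (0, 0), `λ₀ = 0` leaves `b₀₀'` on the left only. This identity makes the Gram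
matrix of `𝓔` finite at `c`. -/
lemma LocalPair.corner (h : LocalPair c A b) :
    - derivM b c 0 0 = 2 * derivM A c 2 0 * b c 0 2 := by
  obtain ⟨h00, h01, h10, h12, h21, h22, h20, -, -⟩ := h.b_zero hR
  have h1 := h.par_one 0 0
  simp [hR, resDiag, Fin.sum_univ_three, h00, h01, h10, h20] at h1
  linear_combination h1

/-- The entry (2, 1) is the homomorphism `φ_i`; the entry (1, 0) is the obstruction met by sections
of `𝓔`. -/
lemma LocalPair.symm_of_phi (h : LocalPair c A b) :
    derivM A c 1 0 = 0 ↔ derivM A c 2 1 = 0 := by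
  obtain ⟨-, -, -, -, -, -, -, h02, h11⟩ := h.b_zero hR
  have h1 := h.sub_diag hR
  constructor <;> intro h0 <;> rw [h0] at h1 <;> simpa [h02, h11] using h1

end LocalModel

/-- The frame of `𝓔` in a frame of eigenvectors. -/
def modif (a m : ℂ) : Mat3 := !![1, 0, 0; 0, m, 0; a * m, 0, m ^ 2]

/-! ### Extension of the form and of the connection to the frame of `𝓔`. -/

section LocalModel

variable {c : ℂ} {A b : ℂ → Mat3}

lemma hasDerivM_modif (a : ℂ) {m : ℂ → ℂ} {m' w : ℂ} (hm : HasDerivAt m m' w) :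
    HasDerivM (fun t => modif a (m t)) !![0, 0, 0; 0, m', 0; a * m', 0, 2 * m w * m'] w := by
  intro i j
  fin_cases i <;> fin_cases j <;> simp [modif]
  all_goals first
    | exact hasDerivAt_const _ _
    | exact hm
    | exact hm.const_mul a
    | simpa using! hm.pow 2

/-- Division by `(w - c)²` is harmless except in the entries (0, 0) and (0, 1), where
`LocalPair.corner` and `b₀₁(c) = 0` supply the needed zeros. The limit is antitriangular with
antidiagonal `b₀₂, b₁₁, b₀₂`, hence invertible. The vanishing of `φ_i` plays no role here. -/
lemma LocalPair.exists_gram (h : LocalPair c A b) (hR : A c = resDiag) :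
    ∃ H : ℂ → Mat3, AnalyticM H c ∧ (∀ᶠ w in 𝓝[≠] c, H w = ((w - c) ^ 2)⁻¹ •
      ((modif (derivM A c 2 0) (w - c)).transpose * b w * modif (derivM A c 2 0) (w - c))) ∧
      (H c).det ≠ 0 := by
  obtain ⟨h00, h01, h10, h12, h21, h22, h20, n02, n11⟩ := h.b_zero hR
  set a := derivM A c 2 0 with ha
  have an := h.anb
  have hc := h.corner hR
  have hid : AnalyticAt ℂ (fun w : ℂ => w - c) c := analyticAt_id.sub analyticAt_const
  obtain ⟨g, hg, eg⟩ := exists_eq_sub_sq_mul (f := fun w => b w 0 0 + 2 * a * (w - c) * b w 0 2)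
    (c := c) ((an 0 0).add ((analyticAt_const.mul hid).mul (an 0 2))) (by simp [h00]) (by
      have h1 := (an.hasDerivM 0 0).add
        ((((hasDerivAt_id c).sub_const c).const_mul (2 * a)).mul (an.hasDerivM 0 2))
      refine h1.deriv.trans ?_
      simp
      linear_combination -hc)
  obtain ⟨k, hk, ek, -⟩ := exists_eq_sub_smul (an 0 1) h01
  refine ⟨fun w => !![g w, k w, b w 0 2; k w, b w 1 1, 0; b w 0 2, 0, 0], ?_, ?_, ?_⟩
  · intro i j
    fin_cases i <;> fin_cases j <;> simp
    all_goals first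
      | exact analyticAt_const
      | exact hg
      | exact hk
      | exact an _ _
  · filter_upwards [self_mem_nhdsWithin, h.symm.filter_mono nhdsWithin_le_nhds,
      h.b12.filter_mono nhdsWithin_le_nhds, h.b22.filter_mono nhdsWithin_le_nhds] with w hw hs e1 e2
    have s (i j : Fin 3) : b w j i = b w i j := congrFun (congrFun hs i) j
    have hw0 : w - c ≠ 0 := sub_ne_zero.mpr hw
    have eg' := eg w
    have ek' := ek w
    rw [smul_eq_mul] at ek'
    ext i j
    fin_cases i <;> fin_cases j <;>
      simp [modif, Matrix.mul_apply, Fin.sum_univ_three, s 0 1, s 0 2, s 1 2, e1, e2, ek'] <;>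
      field_simp
    all_goals first
      | ring1
      | linear_combination -eg'
  · simp [Matrix.det_fin_three, n02, n11]

/-- Solving `G C = G' + A G / m` entry by entry, the shifts of the diagonal by 0, 1, 2 cancel the
residue, and the double zeros of `A₁₀` and `A₂₁` handle the subdiagonal. Only the entry (2, 0) still
needs one more order of vanishing, which comes from orthogonality. -/
lemma LocalPair.exists_conn (h : LocalPair c A b) (hR : A c = resDiag)
    (hφ : derivM A c 2 1 = 0) :
    ∃ C : ℂ → Mat3, AnalyticM C c ∧ ∀ᶠ w in 𝓝[≠] c, modif (derivM A c 2 0) (w - c) * C w =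
      derivM (fun t => modif (derivM A c 2 0) (t - c)) w +
        (w - c)⁻¹ • (A w * modif (derivM A c 2 0) (w - c)) := by
  obtain ⟨h00, h01, h10, h12, h21, h22, h20, n02, n11⟩ := h.b_zero hR
  have hβ : derivM A c 1 0 = 0 := (h.symm_of_phi hR).mpr hφ
  set a := derivM A c 2 0 with ha
  have an := h.anA
  have hid : AnalyticAt ℂ (fun w : ℂ => w - c) c := analyticAt_id.sub analyticAt_const
  have r (i j : Fin 3) : A c i j = resDiag i j := by rw [hR]
  obtain ⟨α00, an00, e00, -⟩ := exists_eq_sub_smul (an 0 0) (by simp [r, resDiag])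
  obtain ⟨γ01, an01, e01, -⟩ := exists_eq_sub_smul (an 0 1) (by simp [r, resDiag])
  obtain ⟨γ12, an12, e12, -⟩ := exists_eq_sub_smul (an 1 2) (by simp [r, resDiag])
  obtain ⟨β10, an10, e10⟩ := exists_eq_sub_sq_mul (an 1 0) (by simp [r, resDiag]) hβ
  obtain ⟨β21, an21, e21⟩ := exists_eq_sub_sq_mul (an 2 1) (by simp [r, resDiag]) hφ
  obtain ⟨α11, an11, e11, -⟩ := exists_eq_sub_smul (analyticAt_const (v := (1 : ℂ)).add (an 1 1))
    (by simp [r, resDiag])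
  obtain ⟨α22, an22, e22, -⟩ := exists_eq_sub_smul (analyticAt_const (v := (2 : ℂ)).add (an 2 2))
    (by simp [r, resDiag])
  -- Multiplied by `m³`, the entry (2, 0) of `C` is this function. Its double zero is the choice of
  -- `a`: the derivative at `c` is `a + a (1 - 2 - 0) = 0`.
  obtain ⟨g, hg, eg⟩ := exists_eq_sub_sq_mul
    (f := fun w => A w 2 0 + a * ((w - c) * (1 + A w 2 2 - A w 0 0))) (c := c)
    ((an 2 0).add (analyticAt_const.mul
      (hid.mul ((analyticAt_const.add (an 2 2)).sub (an 0 0))))) (by simp [r, resDiag]) (by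
      have h1 := (an.hasDerivM 2 0).add ((((hasDerivAt_id c).sub_const c).mul
        (((an.hasDerivM 2 2).const_add 1).sub (an.hasDerivM 0 0))).const_mul a)
      refine h1.deriv.trans ?_
      simp [r, resDiag, ← ha]
      ring)
  simp only [smul_eq_mul, Pi.add_apply] at e00 e01 e12 e11 e22
  -- `g(c)` is the residue of the connection in the new frame. Since the extended Gram matrix `H` is
  -- parallel, its entry (0, 0) gives `2 b₀₂(c) g(c) = 0`.
  have hg0 : g c = 0 := by
    obtain ⟨H, hH, eH, -⟩ := h.exists_gram hR
    have key : ∀ᶠ w in 𝓝[≠] c, (w - c) * deriv (fun t => H t 0 0) w =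
        2 * A w 0 0 * H w 0 0 + 2 * b w 0 1 * (β10 w + a * γ12 w) + 2 * b w 0 2 * g w := by
      have eH' : ∀ᶠ w in 𝓝[≠] c,
          (w - c) ^ 2 * H w 0 0 = b w 0 0 + 2 * a * (w - c) * b w 0 2 := by
        filter_upwards [eH, self_mem_nhdsWithin, h.symm.filter_mono nhdsWithin_le_nhds,
          h.b22.filter_mono nhdsWithin_le_nhds] with w hw hwc hs e2
        have s (i j : Fin 3) : b w j i = b w i j := congrFun (congrFun hs i) j
        have hw0 : w - c ≠ 0 := sub_ne_zero.mpr hwc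
        rw [hw]
        simp [modif, Matrix.mul_apply, Fin.sum_univ_three, s 0 2, e2]
        field_simp
        ring
      filter_upwards [eventually_eventually_nhdsWithin.mpr eH', self_mem_nhdsWithin,
        h.symm.filter_mono nhdsWithin_le_nhds, h.b22.filter_mono nhdsWithin_le_nhds,
        h.b12.filter_mono nhdsWithin_le_nhds,
        (h.par_full 0 0).filter_mono nhdsWithin_le_nhds,
        (h.par_full 0 2).filter_mono nhdsWithin_le_nhds,
        hH.eventually.filter_mono nhdsWithin_le_nhds,
        h.anb.eventually.filter_mono nhdsWithin_le_nhds, h.A02.filter_mono nhdsWithin_le_nhds]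
        with w hw hwc hs e2 e1 p0 p2 hHw hbw eA02
      have s (i j : Fin 3) : b w j i = b w i j := congrFun (congrFun hs i) j
      have hw0 : w - c ≠ 0 := sub_ne_zero.mpr hwc
      have hnhds : 𝓝[≠] c ≤ 𝓝[≠] c := le_rfl
      have hw' : ∀ᶠ t in 𝓝 w,
          (t - c) ^ 2 * H t 0 0 = b t 0 0 + 2 * a * (t - c) * b t 0 2 := by
        rwa [(isOpen_compl_singleton).nhdsWithin_eq hwc] at hw
      have hm := (hasDerivAt_id w).sub_const c
      have d1 : HasDerivAt (fun t => (t - c) ^ 2 * H t 0 0) _ w :=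
        (hm.pow 2).mul (hHw.hasDerivM 0 0)
      have d2 : HasDerivAt (fun t => b t 0 0 + 2 * a * (t - c) * b t 0 2) _ w :=
        (hbw.hasDerivM 0 0).add ((hm.const_mul (2 * a)).mul (hbw.hasDerivM 0 2))
      have d3 := EventuallyEq.deriv_eq hw'
      rw [d1.deriv, d2.deriv] at d3
      have v3 := hw'.self_of_nhds
      simp [Fin.sum_univ_three, s 0 1, s 0 2, e1, e2, derivM_apply, eA02] at d3 p0 p2 v3
      have eg' := eg w
      have f10 := e10 w
      have f12 := e12 w
      have : (w - c) ^ 2 * ((w - c) * deriv (fun t => H t 0 0) w -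
        (2 * A w 0 0 * H w 0 0 + 2 * b w 0 1 * (β10 w + a * γ12 w) + 2 * b w 0 2 * g w)) = 0 := by
        linear_combination (w - c) * d3 + p0 + 2 * a * (w - c) * p2 - (2 + 2 * A w 0 0) * v3
          + 2 * b w 0 1 * f10 + 2 * a * (w - c) * b w 0 1 * f12 + 2 * b w 0 2 * eg'
      rw [mul_eq_zero, sub_eq_zero] at this
      exact this.resolve_left (pow_ne_zero 2 hw0)
    -- At `c` the left side has the factor `w - c`, while on the right `A₀₀` and `b₀₁` vanish, so
    -- only the term in `g` remains.
    have h3 := eq_of_eventuallyEq_punctured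
      (hid.mul (hH 0 0).deriv).continuousAt
      (((((analyticAt_const.mul (an 0 0)).mul (hH 0 0)).add ((analyticAt_const.mul (h.anb 0 1)).mul
        (an10.add (analyticAt_const.mul an12)))).add
        ((analyticAt_const.mul (h.anb 0 2)).mul hg)).continuousAt) key
    simp [r, resDiag, h01] at h3
    exact h3.resolve_left n02
  obtain ⟨k, hk, ek, -⟩ := exists_eq_sub_smul hg hg0
  simp only [smul_eq_mul] at ek
  -- The Greek functions are the entries of `A` (with the diagonal shifted by 0, 1, 2) divided by
  -- `m`, or by `m²` below the diagonal; `k = g / m`.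
  refine ⟨fun w => !![α00 w, A w 0 1, 0; β10 w + a * γ12 w, α11 w, A w 1 2;
    k w, β21 w - a * γ01 w, α22 w], ?_, ?_⟩
  · intro i j
    fin_cases i <;> fin_cases j <;> simp
    all_goals first
      | exact analyticAt_const
      | assumption
      | exact an _ _
      | exact an10.add (analyticAt_const.mul an12)
      | exact an21.sub (analyticAt_const.mul an01)
  · filter_upwards [self_mem_nhdsWithin, h.A02.filter_mono nhdsWithin_le_nhds] with w hwc hA02
    have hw0 : w - c ≠ 0 := sub_ne_zero.mpr hwc
    have hd := hasDerivM_modif a ((hasDerivAt_id w).sub_const c)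
    have hd' : derivM (fun t => modif a (t - c)) w = _ := hd.derivM_eq
    rw [hd']
    have f00 := e00 w
    have f01 := e01 w
    have f12 := e12 w
    have f10 := e10 w
    have f21 := e21 w
    have f11 := e11 w
    have f22 := e22 w
    have fg := eg w
    have fk := ek w
    ext i j
    fin_cases i <;> fin_cases j <;>
      simp [modif, Matrix.mul_apply, Fin.sum_univ_three, hA02] <;> field_simp
    all_goals first
      | ring1
      | linear_combination -f00
      | linear_combination -f10 - a * (w - c) * f12
      | linear_combination -f11
      | linear_combination -f21 + a * (w - c) * f01
      | linear_combination -f22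
      | linear_combination -(w-c) * f22
      | linear_combination -fg - a * (w - c) * f00 - (w - c) ^ 2 * fk

end LocalModel

/-! ### Sections of `𝓔` and the map `φ_i` in a frame of eigenvectors. -/

section LocalSections

variable {c : ℂ} {A b : ℂ → Mat3}

lemma analyticAt_apply {u : ℂ → Fin 3 → ℂ} (hu : AnalyticAt ℂ u c) (i : Fin 3) :
    AnalyticAt ℂ (fun w => u w i) c := analyticAt_pi_iff.mp hu i

lemma deriv_apply_eq {u : ℂ → Fin 3 → ℂ} (hu : AnalyticAt ℂ u c) (i : Fin 3) :
    deriv u c i = deriv (fun w => u w i) c :=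
  ((hasDerivAt_pi.mp hu.differentiableAt.hasDerivAt i).deriv).symm

lemma deriv_mulVec_const {u : ℂ → Fin 3 → ℂ} (M : Mat3) (hu : DifferentiableAt ℂ u c) :
    deriv (fun w => M.mulVec (u w)) c = M.mulVec (deriv u c) := by
  have := (hasDerivM_const (w := c) M).mulVec hu.hasDerivAt
  simpa using this.deriv

lemma deriv_mulVec_apply {u : ℂ → Fin 3 → ℂ} (hA : AnalyticM A c) (hu : AnalyticAt ℂ u c)
    (i : Fin 3) : deriv (fun w => (A w).mulVec (u w) i) c =
      ∑ l, (derivM A c i l * u c l + A c i l * deriv u c l) := by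
  have := hasDerivAt_pi.mp (hA.hasDerivM.mulVec hu.differentiableAt.hasDerivAt) i
  rw [this.deriv]
  simp [Matrix.mulVec, dotProduct, Finset.sum_add_distrib]

/-- The value at `c` of a quotient by `w - c`. -/
lemma value_of_sub_mul_eq {τ σ : ℂ → ℂ} (hτ : AnalyticAt ℂ τ c) (hσ : AnalyticAt ℂ σ c)
    (h : ∀ᶠ w in 𝓝[≠] c, (w - c) * τ w = σ w) : τ c = deriv σ c := by
  have hid : AnalyticAt ℂ (fun w : ℂ => w - c) c := analyticAt_id.sub analyticAt_const
  rw [← (eventuallyEq_of_punctured (hid.mul hτ).continuousAt hσ.continuousAt h).deriv_eq]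
  exact (deriv_sub_mul hτ.differentiableAt).symm

/-- The value of `τ` at `c` is `u' + A' u + A u'`. In component 1 the eigenvalue `-1` cancels `u₁'`
and leaves `A'₁₀ u₀`; in component 2 the eigenvalue `-2` leaves `A'₂₀ u₀ - u₂'`. Membership of
`τ(c)` in the kernel of the residue annihilates both. -/
lemma section_conditions {u τ : ℂ → Fin 3 → ℂ} (hA : AnalyticM A c) (hR : A c = resDiag)
    (hu : AnalyticAt ℂ u c) (hτ : AnalyticAt ℂ τ c)
    (h : ∀ᶠ w in 𝓝[≠] c, (w - c) • τ w = (w - c) • deriv u w + (A w).mulVec (u w))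
    (hu0 : (A c).mulVec (u c) = 0) (hτ0 : (A c).mulVec (τ c) = 0) :
    u c 1 = 0 ∧ u c 2 = 0 ∧ derivM A c 1 0 * u c 0 = 0 ∧
      deriv u c 2 = derivM A c 2 0 * u c 0 := by
  have e (v : Fin 3 → ℂ) (hv : (A c).mulVec v = 0) : v 1 = 0 ∧ v 2 = 0 := by
    rw [hR] at hv
    have h1 := congrFun hv 1
    have h2 := congrFun hv 2
    simp [resDiag, Matrix.mulVec_diagonal] at h1 h2
    exact ⟨h1, h2⟩
  obtain ⟨u1, u2⟩ := e _ hu0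
  obtain ⟨t1, t2⟩ := e _ hτ0
  have hid : AnalyticAt ℂ (fun w : ℂ => w - c) c := analyticAt_id.sub analyticAt_const
  have key (i : Fin 3) : τ c i =
      deriv u c i + ∑ l, (derivM A c i l * u c l + A c i l * deriv u c l) := by
    have hd : AnalyticAt ℂ (fun w => deriv u w i) c := analyticAt_apply hu.deriv i
    have hm : AnalyticAt ℂ (fun w => (A w).mulVec (u w) i) c := analyticAt_apply (hA.mulVec hu) i
    have hv := value_of_sub_mul_eq (analyticAt_apply hτ i) ((hid.mul hd).add hm) (by
      filter_upwards [h] with w hw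
      simpa using congrFun hw i)
    have hs : deriv ((fun w => (w - c) * deriv u w i) + fun w => (A w).mulVec (u w) i) c =
        _ := deriv_add (hid.mul hd).differentiableAt hm.differentiableAt
    refine hv.trans (hs.trans ?_)
    rw [deriv_sub_mul hd.differentiableAt, deriv_mulVec_apply hA hu]
  have k1 := key 1
  have k2 := key 2
  rw [hR] at k1 k2
  simp [Fin.sum_univ_three, resDiag, u1, u2, t1, t2] at k1 k2
  refine ⟨u1, u2, by rcases k1 with k | k <;> simp [k], ?_⟩
  linear_combination k2

/-- These vanishing conditions say precisely that `u` is a holomorphic combination of the columns of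
`modif a (w - c)`. -/
lemma exists_modif_mulVec {u : ℂ → Fin 3 → ℂ} {a : ℂ} (hu : AnalyticAt ℂ u c)
    (h1 : u c 1 = 0) (h2 : u c 2 = 0) (h3 : deriv u c 2 = a * u c 0) :
    ∃ v : ℂ → Fin 3 → ℂ, AnalyticAt ℂ v c ∧ ∀ w, u w = (modif a (w - c)).mulVec (v w) := by
  have hid : AnalyticAt ℂ (fun w : ℂ => w - c) c := analyticAt_id.sub analyticAt_const
  have hi := analyticAt_apply hu
  obtain ⟨g, hg, eg, -⟩ := exists_eq_sub_smul (hi 1) h1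
  obtain ⟨k, hk, ek⟩ := exists_eq_sub_sq_mul (f := fun w => u w 2 - a * ((w - c) * u w 0))
    (c := c) ((hi 2).sub (analyticAt_const.mul (hid.mul (hi 0)))) (by simp [h2]) (by
      have hd := (hi 2).differentiableAt.hasDerivAt.sub ((((hasDerivAt_id c).sub_const c).mul
        (hi 0).differentiableAt.hasDerivAt).const_mul a)
      refine hd.deriv.trans ?_
      rw [← deriv_apply_eq hu, h3]
      simp)
  refine ⟨fun w => ![u w 0, g w, k w], ?_, fun w => ?_⟩
  · rw [analyticAt_pi_iff]
    intro i
    fin_cases i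
    · exact hi 0
    · exact hg
    · exact hk
  · have eg' := eg w
    have ek' := ek w
    rw [smul_eq_mul] at eg'
    ext i
    fin_cases i
    · simp [modif, Matrix.mulVec, dotProduct, Fin.sum_univ_three]
    · simpa [modif, Matrix.mulVec, dotProduct, Fin.sum_univ_three] using eg'
    · simp [modif, Matrix.mulVec, dotProduct, Fin.sum_univ_three]
      linear_combination ek'

/-- In the derivative of `s₂ + (w - c) s₂' + (A s)₂` at `c`, the terms in `s₂'` have total
coefficient `1 + 1 - 2 = 0`; hence the value depends on `s(c)` only. -/
lemma phi_value {s τ : ℂ → Fin 3 → ℂ} (hA : AnalyticM A c) (hR : A c = resDiag)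
    (hs : AnalyticAt ℂ s c) (hτ : AnalyticAt ℂ τ c)
    (h : ∀ᶠ w in 𝓝[≠] c,
      (w - c) • τ w = s w + (w - c) • deriv s w + (A w).mulVec (s w))
    (h0 : s c 0 = 0) (h2 : s c 2 = 0) : τ c 2 = derivM A c 2 1 * s c 1 := by
  have hid : AnalyticAt ℂ (fun w : ℂ => w - c) c := analyticAt_id.sub analyticAt_const
  have hd : AnalyticAt ℂ (fun w => deriv s w 2) c := analyticAt_apply hs.deriv 2
  have hm : AnalyticAt ℂ (fun w => (A w).mulVec (s w) 2) c := analyticAt_apply (hA.mulVec hs) 2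
  have hi := analyticAt_apply hs 2
  have hv := value_of_sub_mul_eq (analyticAt_apply hτ 2) ((hi.add (hid.mul hd)).add hm) (by
    filter_upwards [h] with w hw
    simpa using congrFun hw 2)
  have e1 : deriv (((fun w => s w 2) + fun w => (w - c) * deriv s w 2) +
      fun w => (A w).mulVec (s w) 2) c = _ :=
    deriv_add (hi.add (hid.mul hd)).differentiableAt hm.differentiableAt
  have e2 : deriv ((fun w => s w 2) + fun w => (w - c) * deriv s w 2) c = _ :=
    deriv_add hi.differentiableAt (hid.mul hd).differentiableAt
  refine hv.trans (e1.trans ?_)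
  rw [e2, deriv_sub_mul hd.differentiableAt, deriv_mulVec_apply hA hs, hR, ← deriv_apply_eq hs]
  simp [Fin.sum_univ_three, resDiag, h0, h2]
  ring

/-- If `A'₁₀(c) ≠ 0`, the form degenerates at `c` on the sections of `𝓔`. -/
lemma LocalPair.gram_rank_one (h : LocalPair c A b) (hR : A c = resDiag)
    (hne : derivM A c 1 0 ≠ 0) {u τ : Fin 3 → ℂ → Fin 3 → ℂ} {f : Fin 3 → Fin 3 → ℂ → ℂ}
    (hu : ∀ k, AnalyticAt ℂ (u k) c) (hτ : ∀ k, AnalyticAt ℂ (τ k) c)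
    (hD : ∀ k, ∀ᶠ w in 𝓝[≠] c,
      (w - c) • τ k w = (w - c) • deriv (u k) w + (A w).mulVec (u k w))
    (hu0 : ∀ k, (A c).mulVec (u k c) = 0) (hτ0 : ∀ k, (A c).mulVec (τ k c) = 0)
    (hf : ∀ j k, ContinuousAt (f j k) c)
    (hfb : ∀ j k, ∀ᶠ w in 𝓝[≠] c,
      (w - c) ^ 2 * f j k w = u j w ⬝ᵥ (b w).mulVec (u k w)) :
    ∃ (β : ℂ) (t : Fin 3 → ℂ), ∀ j k, f j k c = β * t j * t k := by
  obtain ⟨h00, h01, h10, h12, h21, h22, h20, -, -⟩ := h.b_zero hR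
  -- `A'₁₀(c) u₀(c) = 0` now kills `u₀(c)`, and with it `u₂'(c) = a u₀(c)`.
  have hc (k : Fin 3) : u k c = 0 ∧ deriv (u k) c 2 = 0 := by
    obtain ⟨u1, u2, u3, u4⟩ := section_conditions h.anA hR (hu k) (hτ k) (hD k) (hu0 k) (hτ0 k)
    have u0 : u k c 0 = 0 := by simpa [hne] using u3
    refine ⟨?_, by rw [u4, u0, mul_zero]⟩
    ext i
    fin_cases i <;> assumption
  choose v hv ev edv using fun k => exists_eq_sub_smul (hu k) (hc k).1
  -- With `u = (w - c) v` the factor `(w - c)²` cancels. As `v₂(c) = 0` and `b₀₀(c) = b₀₁(c) = 0`,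
  -- only `b₁₁ v₁ v₁` remains.
  refine ⟨b c 1 1, fun k => v k c 1, fun j k => ?_⟩
  have hbv : AnalyticAt ℂ (fun w => v j w ⬝ᵥ (b w).mulVec (v k w)) c := by
    simp only [dotProduct]
    exact Finset.analyticAt_fun_sum _ fun i _ =>
      (analyticAt_apply (hv j) i).mul (analyticAt_apply (h.anb.mulVec (hv k)) i)
  have e := eq_of_eventuallyEq_punctured (hf j k) hbv.continuousAt (by
    filter_upwards [hfb j k, self_mem_nhdsWithin] with w hw hwc
    have hw0 : w - c ≠ 0 := sub_ne_zero.mpr hwc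
    rw [ev j w, ev k w, Matrix.mulVec_smul, smul_dotProduct, dotProduct_smul, smul_smul,
      ← pow_two, smul_eq_mul] at hw
    exact mul_left_cancel₀ (pow_ne_zero 2 hw0) hw)
  have z (k : Fin 3) : v k c 2 = 0 := by rw [edv k, (hc k).2]
  rw [e]
  simp [dotProduct, Matrix.mulVec, Fin.sum_univ_three, z, h00, h01, h10]
  ring

end LocalSections

/-! ### Transport of the local results to an arbitrary jet frame. -/

section Gauge

variable {c p q r : ℂ} {A b : ℂ → Mat3}

/-- The matrix of the connection in a basis of eigenvectors of the residue. -/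
def gaugeA (p q r : ℂ) (A : ℂ → Mat3) (w : ℂ) : Mat3 := unipInv p q r * A w * unip p q r

lemma AnalyticM.gaugeA (h : AnalyticM A c) : AnalyticM (gaugeA p q r A) c :=
  ((analyticM_const _).mul h).mul (analyticM_const _)

lemma gaugeA_eq_resDiag (hP : A c * unip p q r = unip p q r * resDiag) :
    gaugeA p q r A c = resDiag := by
  rw [gaugeA, Matrix.mul_assoc, hP, ← Matrix.mul_assoc, unipInv_mul_unip, Matrix.one_mul]

lemma gaugeA_mulVec (w : ℂ) (u : Fin 3 → ℂ) :
    (gaugeA p q r A w).mulVec ((unipInv p q r).mulVec u) =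
      (unipInv p q r).mulVec ((A w).mulVec u) := by
  rw [gaugeA, Matrix.mulVec_mulVec, Matrix.mulVec_mulVec, Matrix.mul_assoc, Matrix.mul_assoc,
    unip_mul_unipInv, Matrix.mul_one]

lemma unip_mulVec_unipInv (u : Fin 3 → ℂ) :
    (unip p q r).mulVec ((unipInv p q r).mulVec u) = u := by
  rw [Matrix.mulVec_mulVec, unip_mul_unipInv, Matrix.one_mulVec]

lemma unipInv_mulVec_unip (u : Fin 3 → ℂ) :
    (unipInv p q r).mulVec ((unip p q r).mulVec u) = u := by
  rw [Matrix.mulVec_mulVec, unipInv_mul_unip, Matrix.one_mulVec]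

lemma mulVec_analyticAt (M : Mat3) {u : ℂ → Fin 3 → ℂ} (hu : AnalyticAt ℂ u c) :
    AnalyticAt ℂ (fun w => M.mulVec (u w)) c := (analyticM_const M).mulVec hu

/-- The frame of `𝓔`. -/
def frameMat (p q r a m : ℂ) : Mat3 := unip p q r * modif a m

lemma frameMat_eq (p q r a m : ℂ) :
    frameMat p q r a m = !![1, 0, 0; q, m, 0; r + a * m, p * m, m ^ 2] := by
  ext i j
  fin_cases i <;> fin_cases j <;>
    simp [frameMat, unip, modif, Matrix.mul_apply, Fin.sum_univ_three]

lemma det_frameMat (p q r a m : ℂ) : (frameMat p q r a m).det = m ^ 3 := by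
  rw [frameMat_eq]
  simp [Matrix.det_fin_three]
  ring

lemma AnalyticM.frameMat (p q r a : ℂ) {m : ℂ → ℂ} (hm : AnalyticAt ℂ m c) :
    AnalyticM (fun w => frameMat p q r a (m w)) c := by
  intro i j
  simp only [frameMat_eq]
  fin_cases i <;> fin_cases j <;> simp
  all_goals first
    | exact analyticAt_const
    | exact hm
    | exact analyticAt_const.add (analyticAt_const.mul hm)
    | exact analyticAt_const.mul hm
    | exact hm.pow 2

lemma conj_gaugeA (h : LocalPair c A b) : LocalPair c (gaugeA p q r A)
    (fun w => (unip p q r).transpose * b w * unip p q r) := h.conj p q r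

lemma section_conditions_gauge {u τ : ℂ → Fin 3 → ℂ} (hA : AnalyticM A c)
    (hP : A c * unip p q r = unip p q r * resDiag)
    (hu : AnalyticAt ℂ u c) (hτ : AnalyticAt ℂ τ c)
    (h : ∀ᶠ w in 𝓝[≠] c, (w - c) • τ w = (w - c) • deriv u w + (A w).mulVec (u w))
    (hu0 : (A c).mulVec (u c) = 0) (hτ0 : (A c).mulVec (τ c) = 0) :
    ∃ v : ℂ → Fin 3 → ℂ, AnalyticAt ℂ v c ∧ ∀ w,
      u w = (frameMat p q r (derivM (gaugeA p q r A) c 2 0) (w - c)).mulVec (v w) := by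
  obtain ⟨h1, h2, -, h3⟩ := section_conditions (u := fun w => (unipInv p q r).mulVec (u w))
    (τ := fun w => (unipInv p q r).mulVec (τ w)) hA.gaugeA (gaugeA_eq_resDiag hP)
    (mulVec_analyticAt _ hu) (mulVec_analyticAt _ hτ) (by
      filter_upwards [h, hu.eventually_analyticAt.filter_mono nhdsWithin_le_nhds] with w hw huw
      rw [deriv_mulVec_const _ huw.differentiableAt, gaugeA_mulVec, ← Matrix.mulVec_smul,
        ← Matrix.mulVec_smul, ← Matrix.mulVec_add, hw])
    (by rw [gaugeA_mulVec, hu0, Matrix.mulVec_zero])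
    (by rw [gaugeA_mulVec, hτ0, Matrix.mulVec_zero])
  obtain ⟨v, hv, ev⟩ := exists_modif_mulVec (mulVec_analyticAt _ hu) h1 h2 h3
  refine ⟨v, hv, fun w => ?_⟩
  rw [frameMat, ← Matrix.mulVec_mulVec, ← ev, unip_mulVec_unipInv]

lemma phi_value_gauge {s τ : ℂ → Fin 3 → ℂ} (hA : AnalyticM A c)
    (hP : A c * unip p q r = unip p q r * resDiag)
    (hs : AnalyticAt ℂ s c) (hτ : AnalyticAt ℂ τ c)
    (h : ∀ᶠ w in 𝓝[≠] c,
      (w - c) • τ w = s w + (w - c) • deriv s w + (A w).mulVec (s w))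
    (h0 : (unipInv p q r).mulVec (s c) 0 = 0) (h2 : (unipInv p q r).mulVec (s c) 2 = 0) :
    (unipInv p q r).mulVec (τ c) 2 =
      derivM (gaugeA p q r A) c 2 1 * (unipInv p q r).mulVec (s c) 1 := by
  refine phi_value (s := fun w => (unipInv p q r).mulVec (s w))
    (τ := fun w => (unipInv p q r).mulVec (τ w)) hA.gaugeA (gaugeA_eq_resDiag hP)
    (mulVec_analyticAt _ hs) (mulVec_analyticAt _ hτ) ?_ h0 h2
  filter_upwards [h, hs.eventually_analyticAt.filter_mono nhdsWithin_le_nhds] with w hw hsw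
  rw [deriv_mulVec_const _ hsw.differentiableAt, gaugeA_mulVec, ← Matrix.mulVec_smul,
    ← Matrix.mulVec_smul, ← Matrix.mulVec_add, ← Matrix.mulVec_add, hw]

lemma dotProduct_unip (M : Mat3) (u v : Fin 3 → ℂ) :
    (unipInv p q r).mulVec u ⬝ᵥ
      ((unip p q r).transpose * M * unip p q r).mulVec ((unipInv p q r).mulVec v) =
      u ⬝ᵥ M.mulVec v := by
  rw [Matrix.mulVec_mulVec, Matrix.mul_assoc, unip_mul_unipInv, Matrix.mul_one,
    ← Matrix.mulVec_mulVec, Matrix.dotProduct_mulVec, Matrix.vecMul_transpose,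
    unip_mulVec_unipInv]

lemma LocalPair.gram_rank_one_gauge (h : LocalPair c A b)
    (hP : A c * unip p q r = unip p q r * resDiag)
    (hne : derivM (gaugeA p q r A) c 2 1 ≠ 0) {u τ : Fin 3 → ℂ → Fin 3 → ℂ}
    {f : Fin 3 → Fin 3 → ℂ → ℂ}
    (hu : ∀ k, AnalyticAt ℂ (u k) c) (hτ : ∀ k, AnalyticAt ℂ (τ k) c)
    (hD : ∀ k, ∀ᶠ w in 𝓝[≠] c,
      (w - c) • τ k w = (w - c) • deriv (u k) w + (A w).mulVec (u k w))
    (hu0 : ∀ k, (A c).mulVec (u k c) = 0) (hτ0 : ∀ k, (A c).mulVec (τ k c) = 0)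
    (hf : ∀ j k, ContinuousAt (f j k) c)
    (hfb : ∀ j k, ∀ᶠ w in 𝓝[≠] c,
      (w - c) ^ 2 * f j k w = u j w ⬝ᵥ (b w).mulVec (u k w)) :
    ∃ (β : ℂ) (t : Fin 3 → ℂ), ∀ j k, f j k c = β * t j * t k := by
  have hc : LocalPair c (gaugeA p q r A) _ := conj_gaugeA h
  have hR := gaugeA_eq_resDiag hP
  -- Here the nonvanishing of `φ_i`, the entry (2, 1), becomes that of the entry (1, 0).
  refine hc.gram_rank_one hR (fun h0 => hne ((hc.symm_of_phi hR).mp h0))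
    (u := fun k w => (unipInv p q r).mulVec (u k w))
    (τ := fun k w => (unipInv p q r).mulVec (τ k w))
    (fun k => mulVec_analyticAt _ (hu k)) (fun k => mulVec_analyticAt _ (hτ k)) (fun k => ?_)
    (fun k => by rw [gaugeA_mulVec, hu0, Matrix.mulVec_zero])
    (fun k => by rw [gaugeA_mulVec, hτ0, Matrix.mulVec_zero]) hf fun j k => ?_
  · filter_upwards [hD k, (hu k).eventually_analyticAt.filter_mono nhdsWithin_le_nhds]
      with w hw huw
    rw [deriv_mulVec_const _ huw.differentiableAt, gaugeA_mulVec, ← Matrix.mulVec_smul,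
      ← Matrix.mulVec_smul, ← Matrix.mulVec_add, hw]
  · filter_upwards [hfb j k] with w hw
    rw [dotProduct_unip, hw]

lemma LocalPair.exists_frame (h : LocalPair c A b)
    (hP : A c * unip p q r = unip p q r * resDiag)
    (hφ : derivM (gaugeA p q r A) c 2 1 = 0) :
    ∃ (a : ℂ) (C H : ℂ → Mat3), a = derivM (gaugeA p q r A) c 2 0 ∧
      AnalyticM C c ∧ AnalyticM H c ∧ (H c).det ≠ 0 ∧
      (∀ᶠ w in 𝓝[≠] c, frameMat p q r a (w - c) * C w =
        derivM (fun t => frameMat p q r a (t - c)) w +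
          (w - c)⁻¹ • (A w * frameMat p q r a (w - c))) ∧
      ∀ᶠ w in 𝓝[≠] c, H w = ((w - c) ^ 2)⁻¹ •
        ((frameMat p q r a (w - c)).transpose * b w * frameMat p q r a (w - c)) := by
  have hc : LocalPair c (gaugeA p q r A) _ := conj_gaugeA h
  have hR := gaugeA_eq_resDiag hP
  obtain ⟨C, hC, eC⟩ := hc.exists_conn hR hφ
  obtain ⟨H, hH, eH, hdet⟩ := hc.exists_gram hR
  refine ⟨_, C, H, rfl, hC, hH, hdet, ?_, ?_⟩
  · filter_upwards [eC] with w hw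
    set a := derivM (gaugeA p q r A) c 2 0
    have hd := hasDerivM_modif a ((hasDerivAt_id w).sub_const c)
    have hd' : derivM (fun t => modif a (t - c)) w = _ := hd.derivM_eq
    have hd2 : HasDerivM (fun t => frameMat p q r a (t - c)) _ w := (hasDerivM_const _).mul hd
    rw [hd2.derivM_eq]
    rw [hd'] at hw
    simp only [frameMat]
    rw [Matrix.mul_assoc, hw, gaugeA, Matrix.mul_add, Matrix.mul_smul, Matrix.zero_mul, zero_add]
    congr 2
    simp only [← Matrix.mul_assoc]
    rw [unip_mul_unipInv, Matrix.one_mul]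
  · filter_upwards [eH] with w hw
    rw [hw]
    simp only [frameMat, Matrix.transpose_mul, Matrix.mul_assoc]

end Gauge

/-! ### The filtration, the equation of `S` and `O_X(b S)` in jet frames. -/

section JetFrames

variable {X : Type u} [TopologicalSpace X] [ChartedSpace ℂ X] [T2Space X] [IsManifold 𝓘(ℂ) ω X]
  {S : Finset X}

lemma ofFrame_jet (φ : AdaptedChart S) (x : X) (u : Fin 3 → ℂ) :
    ofFrame (jetBundle S) φ x u = (jetChange φ (adaptedChartAt S x) x).mulVec u := rfl

lemma jetChange_mulVec_zero (φ ψ : AdaptedChart S) (x : X) {u : Fin 3 → ℂ} (h : u 0 = 0) :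
    (jetChange φ ψ x).mulVec u 0 = 0 := by
  simp [jetChange, Matrix.mulVec, dotProduct, Fin.sum_univ_three, h]

lemma jetChange_mulVec_one (φ ψ : AdaptedChart S) (x : X) {u : Fin 3 → ℂ} (h : u 0 = 0)
    (h1 : u 1 = 0) : (jetChange φ ψ x).mulVec u 1 = 0 := by
  simp [jetChange, Matrix.mulVec, dotProduct, Fin.sum_univ_three, h, h1]

/-- The transition matrices of jets are lower triangular, so the description of the filtration by
vanishing coordinates is the same in every frame. -/
lemma mem_jetF2_iff {φ : AdaptedChart S} {x : X} (hx : x ∈ φ.chart.source)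
    (u : (jetBundle S).Fiber x) : u ∈ jetF2 S x ↔ toFrame (jetBundle S) φ x u 0 = 0 := by
  have h0 : u ∈ jetF2 S x ↔ (show Fin 3 → ℂ from u) 0 = 0 := Iff.rfl
  rw [h0]
  constructor
  · exact fun h => jetChange_mulVec_zero _ _ _ h
  · intro h
    have := jetChange_mulVec_zero φ (adaptedChartAt S x) x h
    rwa [← ofFrame_jet, ofFrame_toFrame (Z := jetBundle S) hx] at this

lemma mem_jetF1_iff {φ : AdaptedChart S} {x : X} (hx : x ∈ φ.chart.source)
    (u : (jetBundle S).Fiber x) : u ∈ jetF1 S x ↔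
      toFrame (jetBundle S) φ x u 0 = 0 ∧ toFrame (jetBundle S) φ x u 1 = 0 := by
  have h0 : u ∈ jetF1 S x ↔
    (show Fin 3 → ℂ from u) 0 = 0 ∧ (show Fin 3 → ℂ from u) 1 = 0 := Iff.rfl
  rw [h0]
  constructor
  · exact fun h => ⟨jetChange_mulVec_zero _ _ _ h.1, jetChange_mulVec_one _ _ _ h.1 h.2⟩
  · intro h
    have h1 := jetChange_mulVec_zero φ (adaptedChartAt S x) x h.1
    have h2 := jetChange_mulVec_one φ (adaptedChartAt S x) x h.1 h.2
    rw [← ofFrame_jet, ofFrame_toFrame (Z := jetBundle S) hx] at h1 h2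
    exact ⟨h1, h2⟩

/-- The local equation of `S` as a function of the coordinate. -/
def eqnC (φ : AdaptedChart S) (w : ℂ) : ℂ := φ.eqn (φ.chart.symm w)

lemma eqnC_analyticAt (φ : AdaptedChart S) {x : X} (hx : x ∈ φ.chart.source) :
    AnalyticAt ℂ (eqnC φ) (φ.chart x) := eqn_analyticAt φ φ hx hx

lemma eqnC_chart (φ : AdaptedChart S) {x : X} (hx : x ∈ φ.chart.source) :
    eqnC φ (φ.chart x) = φ.eqn x := by rw [eqnC, φ.chart.left_inv hx]

lemma eqnC_eventuallyEq (φ : AdaptedChart S) {y : X} (hy : y ∈ φ.chart.source) (hyS : y ∈ S) :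
    eqnC φ =ᶠ[𝓝 (φ.chart y)] fun w => w - φ.chart y := by
  filter_upwards [eventually_right_inv φ hy] with w hw
  rw [eqnC, φ.eqn_of_mem hyS hy, hw]

lemma eventually_notMem (φ : AdaptedChart S) {y : X} (hy : y ∈ φ.chart.source) :
    ∀ᶠ w in 𝓝[≠] (φ.chart y), φ.chart.symm w ∉ S := by
  have h1 : ∀ᶠ x in 𝓝 y, x ∈ S → x = y := by
    have : IsOpen (((S : Set X) \ {y})ᶜ) :=
      ((Finset.finite_toSet S).subset sdiff_subset).isClosed.isOpen_compl
    filter_upwards [this.mem_nhds (fun h => h.2 rfl)] with x hx hxS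
    by_contra hne
    exact hx ⟨hxS, hne⟩
  filter_upwards [(eventually_symm φ hy h1).filter_mono nhdsWithin_le_nhds,
    (eventually_mem φ φ hy hy).filter_mono nhdsWithin_le_nhds, self_mem_nhdsWithin]
    with w hw hm hne hS
  apply hne
  rw [mem_singleton_iff, ← hw hS, φ.chart.right_inv hm.1]

lemma eventually_punctured (φ : AdaptedChart S) {y : X} (hy : y ∈ φ.chart.source) {p : X → Prop}
    (h : ∀ x ∈ φ.chart.source, x ∉ S → p x) :
    ∀ᶠ w in 𝓝[≠] (φ.chart y), p (φ.chart.symm w) := by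
  filter_upwards [eventually_notMem φ hy,
    (eventually_mem φ φ hy hy).filter_mono nhdsWithin_le_nhds] with w h1 h2
  exact h _ h2.2.1 h1

/-- Off `S` the transition function of `O_X(b S)` is a power of the ratio of the local equations, so
the associated meromorphic function does not depend on the frame. -/
lemma toMero_eq {φ : AdaptedChart S} {x : X} (hx : x ∈ φ.chart.source) (hxS : x ∉ S) (b : ℤ)
    (c : (lineBundle S 0 b).Fiber x) :
    toMero S b x c = toFrame (lineBundle S 0 b) φ x c * φ.eqn x ^ (-b) := by
  have h1 : toFrame (lineBundle S 0 b) φ x c =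
      unitRatio (adaptedChartAt S x) φ x ^ b * (show ℂ from c) := by
    change (lineCoeff 0 b (adaptedChartAt S x) φ x • ContinuousLinearMap.id ℂ ℂ) c = _
    simp [lineCoeff]
    rfl
  have n1 := φ.eqn_ne_zero hx hxS
  have n2 := (adaptedChartAt S x).eqn_ne_zero (mem_adaptedChartAt S x) hxS
  rw [h1, toMero, unitRatio, if_neg hxS, div_zpow, zpow_neg, zpow_neg]
  field_simp

end JetFrames

/-! ### The matrix of the logarithmic connection. -/

section Connection

variable {X : Type u} [TopologicalSpace X] [ChartedSpace ℂ X] [T2Space X] [IsManifold 𝓘(ℂ) ω X]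
  {S : Finset X} (D : LogConnection S (jetBundle S)) (φ : AdaptedChart S)

/-- The constant sections of the frame of `φ`. -/
def basisSec (φ : AdaptedChart S) (k : Fin 3) (x : X) : (jetBundle S).Fiber x :=
  ofFrame (jetBundle S) φ x (Pi.single k 1)

lemma holOn_basisSec (k : Fin 3) : HolOn (jetBundle S) φ.chart.source (basisSec φ k) :=
  holOn_ofFrame (Z := jetBundle S) φ.chart.open_source (Subset.refl _)
    (fun _ _ => mdifferentiableAt_const.mdifferentiableWithinAt)

lemma toFrame_basisSec {φ : AdaptedChart S} {x : X} (hx : x ∈ φ.chart.source) (k : Fin 3) :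
    toFrame (jetBundle S) φ x (basisSec φ k x) = Pi.single k 1 :=
  toFrame_ofFrame (Z := jetBundle S) hx _

/-- The matrix `A` of the logarithmic connection, `D = d + A dz / m` in the frame of `φ`. -/
def connMat (x : X) : Mat3 := Matrix.of fun i k => toFrame (jetBundle S) φ x
  ((D.isLog φ φ.chart.source φ.chart.open_source Subset.rfl _ (holOn_basisSec φ k)).choose x) i

lemma connMat_col (x : X) (k : Fin 3) : (fun i => connMat D φ x i k) =
    toFrame (jetBundle S) φ x ((D.isLog φ φ.chart.source φ.chart.open_source Subset.rfl _
      (holOn_basisSec φ k)).choose x) := rfl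

lemma connMat_analytic {x : X} (hx : x ∈ φ.chart.source) :
    AnalyticM (fun w => connMat D φ (φ.chart.symm w)) (φ.chart x) := fun i k =>
  analyticAt_apply ((D.isLog φ φ.chart.source φ.chart.open_source Subset.rfl _
    (holOn_basisSec φ k)).choose_spec.1.analyticAt φ.chart.open_source hx (i := φ) hx φ hx) i

lemma mulVec_eq_sum_col (M : Mat3) (v : Fin 3 → ℂ) :
    M.mulVec v = v 0 • (fun i => M i 0) + v 1 • (fun i => M i 1) + v 2 • fun i => M i 2 := by
  ext i
  simp [Matrix.mulVec, dotProduct, Fin.sum_univ_three]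
  ring

variable {φ}

lemma cov_basisSec {x : X} (hx : x ∈ φ.chart.source) (hxS : x ∉ S) (k : Fin 3)
    (v : TangentSpace 𝓘(ℂ) x) :
    φ.eqn x • toFrame (jetBundle S) φ x (D.cov (basisSec φ k) x v) =
      mvfderiv 𝓘(ℂ) φ.chart x v • fun i => connMat D φ x i k := by
  have h := (D.isLog φ φ.chart.source φ.chart.open_source Subset.rfl _
    (holOn_basisSec φ k)).choose_spec.2.1 x hx hxS v
  rw [← map_smul, h, map_smul, connMat_col]

lemma eq_sum_basisSec {x : X} (hx : x ∈ φ.chart.source) (u : (jetBundle S).Fiber x) :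
    u = toFrame (jetBundle S) φ x u 0 • basisSec φ 0 x + toFrame (jetBundle S) φ x u 1 •
      basisSec φ 1 x + toFrame (jetBundle S) φ x u 2 • basisSec φ 2 x := by
  apply toFrame_injective (Z := jetBundle S) (i := φ) hx
  simp only [map_add, map_smul, toFrame_basisSec hx]
  ext i
  fin_cases i <;> simp

lemma res_eq_connMat {y : X} (hy : y ∈ φ.chart.source) (hyS : y ∈ S)
    (u : (jetBundle S).Fiber y) :
    toFrame (jetBundle S) φ y (D.res y u) =
      (connMat D φ y).mulVec (toFrame (jetBundle S) φ y u) := by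
  have h (k : Fin 3) : toFrame (jetBundle S) φ y (D.res y (basisSec φ k y)) =
      fun i => connMat D φ y i k := by
    rw [connMat_col, (D.isLog φ φ.chart.source φ.chart.open_source Subset.rfl _
      (holOn_basisSec φ k)).choose_spec.2.2 y hy hyS]
  conv_lhs => rw [eq_sum_basisSec hy u]
  simp only [map_add, map_smul, h, mulVec_eq_sum_col]

lemma mdifferentiableAt_smul_sec {f : X → ℂ} {σ : ∀ x, (jetBundle S).Fiber x} {x : X}
    (hf : MDifferentiableAt 𝓘(ℂ) 𝓘(ℂ) f x)
    (hσ : MDifferentiableAt 𝓘(ℂ) (𝓘(ℂ).prod 𝓘(ℂ, Fin 3 → ℂ))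
      (fun x => TotalSpace.mk' (Fin 3 → ℂ) x (σ x)) x) :
    MDifferentiableAt 𝓘(ℂ) (𝓘(ℂ).prod 𝓘(ℂ, Fin 3 → ℂ))
      (fun x => TotalSpace.mk' (Fin 3 → ℂ) x ((f • σ) x)) x := by
  have hi := (jetBundle S).mem_baseSet_at x
  rw [mdifferentiableAt_section_iff_frame hi] at hσ ⊢
  simp only [Pi.smul_apply', map_smul]
  exact hf.smul hσ

/-- The Leibniz rule applied to the expansion in the constant frame; the local equation `m`
multiplies both sides in place of a pole. -/
lemma cov_eq_connMat {x : X} (hx : x ∈ φ.chart.source) (hxS : x ∉ S)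
    {σ : ∀ x, (jetBundle S).Fiber x}
    (hσ : MDifferentiableAt 𝓘(ℂ) (𝓘(ℂ).prod 𝓘(ℂ, Fin 3 → ℂ))
      (fun x => TotalSpace.mk' (Fin 3 → ℂ) x (σ x)) x) (v : TangentSpace 𝓘(ℂ) x) :
    φ.eqn x • toFrame (jetBundle S) φ x (D.cov σ x v) =
      mvfderiv 𝓘(ℂ) φ.chart x v •
        (φ.eqn x • cderiv φ (fun y => toFrame (jetBundle S) φ y (σ y)) x +
          (connMat D φ x).mulVec (toFrame (jetBundle S) φ x (σ x))) := by
  set f : Fin 3 → X → ℂ := fun k y => toFrame (jetBundle S) φ y (σ y) k with hfdef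
  have hfr := (mdifferentiableAt_section_iff_frame (Z := jetBundle S) (i := φ) hx).mp hσ
  have hf (k : Fin 3) : MDifferentiableAt 𝓘(ℂ) 𝓘(ℂ) (f k) x := by
    have h1 := (mdifferentiableAt_iff_coord φ hx).mp hfr
    exact (mdifferentiableAt_iff_coord φ hx).mpr (differentiableAt_pi.mp h1 k)
  have hb (k : Fin 3) := (holOn_basisSec φ k).mdifferentiableAt φ.chart.open_source hx
  have hfb (k : Fin 3) := mdifferentiableAt_smul_sec (hf k) (hb k)
  have h01 := mdifferentiableAt_add_section (hfb 0) (hfb 1)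
  have h012 := mdifferentiableAt_add_section h01 (hfb 2)
  have hSo : IsOpen ((S : Set X)ᶜ) := (Finset.finite_toSet S).isClosed.isOpen_compl
  -- The expansion of `σ` holds only over the chart; locality of the covariant derivative off `S`
  -- makes that enough.
  have e1 : D.cov σ x = D.cov (f 0 • basisSec φ 0 + f 1 • basisSec φ 1 + f 2 • basisSec φ 2) x := by
    refine D.isCov.congr_of_eventuallyEq hσ h012 (hSo.mem_nhds hxS) ?_
    filter_upwards [φ.chart.open_source.mem_nhds hx] with y hy
    exact eq_sum_basisSec hy (σ y)
  have hxS' : x ∈ (S : Set X)ᶜ := hxS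
  rw [e1, D.isCov.add h01 (hfb 2) hxS', D.isCov.add (hfb 0) (hfb 1) hxS',
    D.isCov.leibniz (hb 0) (hf 0) hxS', D.isCov.leibniz (hb 1) (hf 1) hxS',
    D.isCov.leibniz (hb 2) (hf 2) hxS']
  simp only [_root_.add_apply, _root_.smul_apply,
    ContinuousLinearMap.smulRight_apply, map_add, map_smul, smul_add, toFrame_basisSec hx,
    mvfderiv_eq_cderiv φ hx (hf _)]
  rw [smul_comm (φ.eqn x) (f 0 x), smul_comm (φ.eqn x) (f 1 x), smul_comm (φ.eqn x) (f 2 x),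
    cov_basisSec D hx hxS, cov_basisSec D hx hxS, cov_basisSec D hx hxS, mulVec_eq_sum_col]
  have hd (k : Fin 3) : cderiv φ (fun y => toFrame (jetBundle S) φ y (σ y)) x k =
      cderiv φ (f k) x := by
    have h1 := (mdifferentiableAt_iff_coord φ hx).mp hfr
    exact ((hasDerivAt_pi.mp h1.hasDerivAt k).deriv).symm
  ext i
  simp only [Pi.add_apply, Pi.smul_apply, hd, smul_eq_mul]
  fin_cases i <;> simp [f] <;> ring

end Connection

/-! ### The Gram matrix and the constraints on an admissible pair. -/

section Form

variable {X : Type u} [TopologicalSpace X] [ChartedSpace ℂ X] [T2Space X] [IsManifold 𝓘(ℂ) ω X]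
  {S : Finset X} (𝔹 : TwistedForm S (jetBundle S)) (φ : AdaptedChart S)

/-- The Gram matrix of the form in the frame of `φ`. -/
def formMat (x : X) : Mat3 := Matrix.of fun j k =>
  (show ℂ from toFrame (lineBundle S 0 2) φ x (𝔹.form x (basisSec φ j x) (basisSec φ k x)))

lemma formMat_analytic {x : X} (hx : x ∈ φ.chart.source) :
    AnalyticM (fun w => formMat 𝔹 φ (φ.chart.symm w)) (φ.chart x) := fun j k =>
  (𝔹.hol φ.chart.source φ.chart.open_source _ _ (holOn_basisSec φ j)
    (holOn_basisSec φ k)).analyticAt φ.chart.open_source hx (i := φ) hx φ hx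

variable {φ}

lemma form_eq_formMat {x : X} (hx : x ∈ φ.chart.source) (u w : (jetBundle S).Fiber x) :
    toFrame (lineBundle S 0 2) φ x (𝔹.form x u w) =
      toFrame (jetBundle S) φ x u ⬝ᵥ (formMat 𝔹 φ x).mulVec (toFrame (jetBundle S) φ x w) := by
  conv_lhs => rw [eq_sum_basisSec hx u, eq_sum_basisSec hx w]
  simp only [map_add, map_smul, LinearMap.add_apply, LinearMap.smul_apply, dotProduct,
    Matrix.mulVec, Fin.sum_univ_three, formMat, Matrix.of_apply, smul_eq_mul]
  ring

lemma toMero_form {x : X} (hx : x ∈ φ.chart.source) (hxS : x ∉ S)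
    (u w : (jetBundle S).Fiber x) :
    toMero S 2 x (𝔹.form x u w) = (φ.eqn x ^ 2)⁻¹ *
      (toFrame (jetBundle S) φ x u ⬝ᵥ
        (formMat 𝔹 φ x).mulVec (toFrame (jetBundle S) φ x w)) := by
  rw [toMero_eq hx hxS, form_eq_formMat 𝔹 hx, zpow_neg, mul_comm]
  rfl

lemma formMat_transpose (x : X) : (formMat 𝔹 φ x).transpose = formMat 𝔹 φ x := by
  ext j k
  simp only [formMat, Matrix.transpose_apply, Matrix.of_apply]
  rw [𝔹.symm]

lemma formMat_det_ne_zero {x : X} (hx : x ∈ φ.chart.source) : (formMat 𝔹 φ x).det ≠ 0 := by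
  intro h
  obtain ⟨v, hv, e⟩ := Matrix.exists_mulVec_eq_zero_iff.mpr h
  apply hv
  have h0 : ofFrame (jetBundle S) φ x v = 0 := by
    apply 𝔹.nondeg x
    intro w
    rw [𝔹.symm]
    apply toFrame_injective (Z := lineBundle S 0 2) (i := φ) hx
    rw [form_eq_formMat 𝔹 hx, toFrame_ofFrame (Z := jetBundle S) hx, e, dotProduct_zero, map_zero]
  rw [← toFrame_ofFrame (Z := jetBundle S) (i := φ) hx v, h0, map_zero]

variable {𝔹} {D : LogConnection S (jetBundle S)} (h : AdmissiblePair 𝔹 D)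
include h

lemma connMat_zero_two {x : X} (hx : x ∈ φ.chart.source) (hxS : x ∉ S) :
    connMat D φ x 0 2 = 0 := by
  obtain ⟨v, hv⟩ := exists_mvfderiv_chart_eq_one φ hx
  have h1 := h.griffiths φ.chart.source φ.chart.open_source _ (holOn_basisSec φ 2) (fun y hy => by
    rw [mem_jetF1_iff hy, toFrame_basisSec hy]; simp) x hx hxS v
  rw [mem_jetF2_iff hx] at h1
  have h2 := congrFun (cov_basisSec D hx hxS 2 v) 0
  rw [hv, one_smul, Pi.smul_apply, h1, smul_zero] at h2
  exact h2.symm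

lemma formMat_two_two {x : X} (hx : x ∈ φ.chart.source) : formMat 𝔹 φ x 2 2 = 0 := by
  have h2 : basisSec φ 2 x ∈ jetF1 S x := by
    rw [mem_jetF1_iff hx, toFrame_basisSec hx]; simp
  have := h.isotropic x _ h2 _ h2
  simp only [formMat, Matrix.of_apply]
  rw [this, map_zero]

lemma formMat_one_two {x : X} (hx : x ∈ φ.chart.source) : formMat 𝔹 φ x 1 2 = 0 := by
  have h2 : basisSec φ 2 x ∈ jetF1 S x := by
    rw [mem_jetF1_iff hx, toFrame_basisSec hx]; simp
  have h1 : basisSec φ 1 x ∈ jetF2 S x := by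
    rw [mem_jetF2_iff hx, toFrame_basisSec hx]; simp
  have := (h.orthogonal x _).mpr h1 _ h2
  simp only [formMat, Matrix.of_apply]
  rw [𝔹.symm, this, map_zero]

/-- As a meromorphic function the value of the form is `m⁻² b`. The term `-2 m' b` is the
contribution of `m⁻²` to the de Rham derivative. -/
lemma formMat_parallel {x : X} (hx : x ∈ φ.chart.source) (hxS : x ∉ S) :
    φ.eqn x • derivM (fun w => formMat 𝔹 φ (φ.chart.symm w)) (φ.chart x) -
      (2 * deriv (eqnC φ) (φ.chart x)) • formMat 𝔹 φ x =
      (connMat D φ x).transpose * formMat 𝔹 φ x + formMat 𝔹 φ x * connMat D φ x := by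
  obtain ⟨v, hv⟩ := exists_mvfderiv_chart_eq_one φ hx
  have hm0 : φ.eqn x ≠ 0 := φ.eqn_ne_zero hx hxS
  ext j k
  have h1 := h.parallel φ.chart.source φ.chart.open_source _ _ (holOn_basisSec φ j)
    (holOn_basisSec φ k) x hx hxS v
  have hSo : IsOpen ((S : Set X)ᶜ) := (Finset.finite_toSet S).isClosed.isOpen_compl
  have e : (fun y => toMero S 2 y (𝔹.form y (basisSec φ j y) (basisSec φ k y))) =ᶠ[𝓝 x]
      fun y => (φ.eqn y ^ 2)⁻¹ * formMat 𝔹 φ y j k := by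
    filter_upwards [φ.chart.open_source.mem_nhds hx, hSo.mem_nhds hxS] with y hy hyS
    rw [toMero_form 𝔹 hy hyS, toFrame_basisSec hy, toFrame_basisSec hy]
    simp
  have hd : HasDerivAt (fun w => (φ.eqn (φ.chart.symm w) ^ 2)⁻¹ *
      formMat 𝔹 φ (φ.chart.symm w) j k) _ (φ.chart x) :=
    (((eqnC_analyticAt φ hx).differentiableAt.hasDerivAt.pow 2).fun_inv (by
      simpa [eqnC_chart φ hx] using hm0)).mul ((formMat_analytic 𝔹 φ hx).hasDerivM j k)
  have hmd : MDifferentiableAt 𝓘(ℂ) 𝓘(ℂ)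
      (fun y => toMero S 2 y (𝔹.form y (basisSec φ j y) (basisSec φ k y))) x := by
    refine MDifferentiableAt.congr_of_eventuallyEq ?_ e
    exact (mdifferentiableAt_iff_coord φ hx).mpr hd.differentiableAt
  rw [mvfderiv_eq_cderiv φ hx hmd, hv, one_smul, cderiv_congr φ hx e, cderiv, hd.deriv,
    toMero_form 𝔹 hx hxS, toMero_form 𝔹 hx hxS] at h1
  have hc (l : Fin 3) : toFrame (jetBundle S) φ x (D.cov (basisSec φ l) x v) =
      (φ.eqn x)⁻¹ • fun i => connMat D φ x i l := by
    have := cov_basisSec D hx hxS l v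
    rw [hv, one_smul] at this
    rw [← this, smul_smul, inv_mul_cancel₀ hm0, one_smul]
  rw [hc, hc, toFrame_basisSec hx, toFrame_basisSec hx] at h1
  simp only [Pi.pow_apply, eqnC_chart φ hx, φ.chart.left_inv hx] at h1
  have key : (derivM (fun w => formMat 𝔹 φ (φ.chart.symm w)) (φ.chart x)) j k * φ.eqn x -
      2 * deriv (eqnC φ) (φ.chart x) * formMat 𝔹 φ x j k =
      ∑ l, (connMat D φ x l j * formMat 𝔹 φ x l k + formMat 𝔹 φ x j l * connMat D φ x l k) := by
    simp only [Matrix.mulVec_single_one, Matrix.mulVec_smul, single_one_dotProduct,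
      smul_dotProduct, Pi.smul_apply, smul_eq_mul] at h1
    simp only [dotProduct, Matrix.mulVec, Matrix.col_apply, Fin.sum_univ_three] at h1
    field_simp at h1
    simp only [Fin.sum_univ_three]
    apply mul_left_cancel₀ hm0
    push_cast at h1
    linear_combination h1
  simp only [Matrix.sub_apply, Matrix.smul_apply, smul_eq_mul, Matrix.add_apply, Matrix.mul_apply,
    Matrix.transpose_apply, ← Finset.sum_add_distrib]
  linear_combination key

lemma localPair {y : X} (hy : y ∈ φ.chart.source) (hyS : y ∈ S) :
    LocalPair (φ.chart y) (fun w => connMat D φ (φ.chart.symm w))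
      (fun w => formMat 𝔹 φ (φ.chart.symm w)) where
  anA := connMat_analytic D φ hy
  anb := formMat_analytic 𝔹 φ hy
  symm := Eventually.of_forall fun w => formMat_transpose 𝔹 _
  b12 := by
    filter_upwards [eventually_mem φ φ hy hy] with w hw
    exact formMat_one_two h hw.2.1
  b22 := by
    filter_upwards [eventually_mem φ φ hy hy] with w hw
    exact formMat_two_two h hw.2.1
  A02 := eventuallyEq_of_punctured (connMat_analytic D φ hy 0 2).continuousAt
    continuousAt_const (eventually_punctured φ hy (p := fun x => connMat D φ x 0 2 = 0)
      fun x hx hxS => connMat_zero_two h hx hxS)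
  det_ne := by
    rw [φ.chart.left_inv hy]
    exact formMat_det_ne_zero 𝔹 hy
  par := by
    filter_upwards [eventually_notMem φ hy,
      (eventually_mem φ φ hy hy).filter_mono nhdsWithin_le_nhds,
      (eqnC_eventuallyEq φ hy hyS).eventuallyEq_nhds.filter_mono nhdsWithin_le_nhds]
      with w hwS hw he
    have hp := formMat_parallel h hw.2.1 hwS
    have e1 : deriv (eqnC φ) w = 1 := by
      rw [he.deriv_eq]
      simp
    have e2 : φ.eqn (φ.chart.symm w) = w - φ.chart y := he.eq_of_nhds
    rw [φ.chart.right_inv hw.1, e1, e2, mul_one] at hp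
    exact hp

/-- A basis of eigenvectors of the residue, adapted to the filtration. -/
lemma exists_unip {y : X} (hy : y ∈ φ.chart.source) (hyS : y ∈ S) :
    ∃ p q r : ℂ, connMat D φ y * unip p q r = unip p q r * resDiag := by
  have inj {u v : (jetBundle S).Fiber y} :=
    toFrame_injective (Z := jetBundle S) (i := φ) hy (u := u) (v := v)
  have hres := res_eq_connMat D hy hyS
  have e2 : (connMat D φ y).mulVec ![0, 0, 1] = (-2 : ℂ) • ![0, 0, 1] := by
    have h1 : basisSec φ 2 y ∈ jetF1 S y := by
      rw [mem_jetF1_iff hy, toFrame_basisSec hy]; simp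
    rw [← h.eigenspace_neg_two y hyS, Module.End.mem_eigenspace_iff] at h1
    have h2 := hres (basisSec φ 2 y)
    rw [h1, map_smul, toFrame_basisSec hy] at h2
    have e : (Pi.single 2 1 : Fin 3 → ℂ) = ![0, 0, 1] := by
      ext i; fin_cases i <;> simp
    rw [← e]
    exact h2.symm
  obtain ⟨u, hu, hu0⟩ := ((h.eigenvalues y hyS (-1)).mpr (by simp)).exists_hasEigenvector
  obtain ⟨w, hw, hw0⟩ := ((h.eigenvalues y hyS 0).mpr (by simp)).exists_hasEigenvector
  have huF := (mem_jetF2_iff hy u).mp (h.eigenspace_neg_one y hyS hu)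
  rw [Module.End.mem_eigenspace_iff] at hu hw
  have hu' := hres u
  have hw' := hres w
  rw [hu, map_smul] at hu'
  rw [hw, zero_smul, map_zero] at hw'
  set U := toFrame (jetBundle S) φ y u with hUdef
  set W := toFrame (jetBundle S) φ y w with hWdef
  have hU0 : U ≠ 0 := fun e => hu0 (inj (by rw [map_zero]; exact e))
  have hW0 : W ≠ 0 := fun e => hw0 (inj (by rw [map_zero]; exact e))
  -- Otherwise `U` would lie in `F¹`, the eigenspace for `-2`, although its eigenvalue is `-1`.
  have hU1 : U 1 ≠ 0 := by
    intro e
    have eU : U = U 2 • ![0, 0, 1] := by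
      ext i; fin_cases i <;> simp [huF, e]
    rw [eU, Matrix.mulVec_smul, e2] at hu'
    have := congrFun hu' 2
    simp at this
    have hU2 : U 2 = 0 := by linear_combination -this
    rw [hU2, zero_smul] at eU
    exact hU0 eU
  -- Otherwise `W` would lie in `F²`, spanned by `U` and the generator of `F¹`, on which the residue
  -- is injective.
  have hW1 : W 0 ≠ 0 := by
    intro e
    have eW : W = (W 1 / U 1) • U + (W 2 - W 1 / U 1 * U 2) • ![0, 0, 1] := by
      ext i; fin_cases i <;> simp [huF, e, hU1]
    have h1 := hw'
    rw [eW, Matrix.mulVec_add, Matrix.mulVec_smul, Matrix.mulVec_smul, e2, ← hu'] at h1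
    have h11 := congrFun h1 1
    have h12 := congrFun h1 2
    simp [hU1] at h11
    simp [h11] at h12
    apply hW0
    ext i; fin_cases i
    · exact e
    · exact h11
    · exact h12
  -- The eigenvectors are scaled to leading coordinate 1, which makes the matrix of the basis
  -- unitriangular.
  refine ⟨U 2 / U 1, W 1 / W 0, W 2 / W 0, ?_⟩
  have c0 : (connMat D φ y).mulVec ![1, W 1 / W 0, W 2 / W 0] = 0 := by
    have : ![1, W 1 / W 0, W 2 / W 0] = (W 0)⁻¹ • W := by
      ext i; fin_cases i <;> simp [hW1] <;> field_simp
    rw [this, Matrix.mulVec_smul, ← hw', smul_zero]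
  have c1 : (connMat D φ y).mulVec ![0, 1, U 2 / U 1] = (-1 : ℂ) • ![0, 1, U 2 / U 1] := by
    have : ![0, 1, U 2 / U 1] = (U 1)⁻¹ • U := by
      ext i; fin_cases i <;> simp [hU1, huF] ; field_simp
    rw [this, Matrix.mulVec_smul, ← hu', smul_comm]
  ext i j
  have d0 := congrFun c0 i
  have d1 := congrFun c1 i
  have d2 := congrFun e2 i
  simp only [Matrix.mulVec, dotProduct, Fin.sum_univ_three] at d0 d1 d2
  fin_cases j
  · simp [Matrix.mul_apply, Fin.sum_univ_three, unip, resDiag] at d0 ⊢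
    exact d0
  · simp [Matrix.mul_apply, Fin.sum_univ_three, unip, resDiag] at d1 ⊢
    fin_cases i <;> simpa using d1
  · simp [Matrix.mul_apply, Fin.sum_univ_three, unip, resDiag] at d2 ⊢
    fin_cases i <;> simpa using d2

/-- The second fundamental form of `F¹` is a generator of `K_X`. -/
lemma exists_connMat_one_two {x : X} (hx : x ∈ φ.chart.source) :
    ∃ α : ℂ → ℂ, AnalyticAt ℂ α (φ.chart x) ∧ α (φ.chart x) ≠ 0 ∧
      ∀ᶠ w in 𝓝 (φ.chart x), connMat D φ (φ.chart.symm w) 1 2 = eqnC φ w * α w := by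
  obtain ⟨V, hVo, hxV, hVU, τ, κ, hτ, hκ, hmem, hτx, he⟩ := h.transversal₁ φ φ.chart.source
    φ.chart.open_source Subset.rfl _ (holOn_basisSec φ 2) (fun y hy => by
      rw [mem_jetF1_iff hy, toFrame_basisSec hy]; simp) x hx (by
      intro h0
      have h1 : basisSec φ 2 x = 0 := h0
      have := toFrame_basisSec hx 2
      rw [h1, map_zero] at this
      simpa using congrFun this 2)
  have han := analyticAt_apply (hτ.analyticAt hVo hxV (i := φ) hx φ hx) 1
  refine ⟨_, han, ?_, ?_⟩
  · rw [φ.chart.left_inv hx]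
    intro h0
    apply hτx
    rw [mem_jetF1_iff hx]
    exact ⟨(mem_jetF2_iff hx _).mp (hmem x hxV).1, h0⟩
  · refine eventuallyEq_of_punctured (connMat_analytic D φ hx 1 2).continuousAt
      ((eqnC_analyticAt φ hx).mul han).continuousAt ?_
    filter_upwards [eventually_notMem φ hx,
      (eventually_mem φ φ hx hx).filter_mono nhdsWithin_le_nhds,
      (eventually_symm φ hx (hVo.mem_nhds hxV)).filter_mono nhdsWithin_le_nhds] with w hwS hw hwV
    obtain ⟨v, hv⟩ := exists_mvfderiv_chart_eq_one φ hw.2.1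
    have e := congrArg (fun u => toFrame (jetBundle S) φ _ u 1) (he _ hwV hwS v)
    simp only [map_smul] at e
    rw [cov_basisSec D hw.2.1 hwS, hv] at e
    -- The polar part `κ` lies in `F¹`, so component 1 of `D e₂` comes from `m τ` alone.
    have hκ1 := ((mem_jetF1_iff hw.2.1 _).mp (hmem _ hwV).2).2
    simpa [hκ1, eqnC] using e

end Form

/-! ### The homomorphism `φ_i` as a Taylor coefficient. -/

section Phi

variable {X : Type u} [TopologicalSpace X] [ChartedSpace ℂ X] [T2Space X] [IsManifold 𝓘(ℂ) ω X]
  {S : Finset X} {D : LogConnection S (jetBundle S)} {φ : AdaptedChart S} {p q r : ℂ} {y : X}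

/-- The coordinates of a vector in the basis of eigenvectors of the residue. -/
def eigenCoord (φ : AdaptedChart S) (p q r : ℂ) (y : X) (u : (jetBundle S).Fiber y) :
    Fin 3 → ℂ := (unipInv p q r).mulVec (toFrame (jetBundle S) φ y u)

lemma eigenCoord_injective (hy : y ∈ φ.chart.source) {u v : (jetBundle S).Fiber y}
    (h : eigenCoord φ p q r y u = eigenCoord φ p q r y v) : u = v := by
  apply toFrame_injective (Z := jetBundle S) (i := φ) hy
  rw [← unip_mulVec_unipInv (p := p) (q := q) (r := r) (toFrame (jetBundle S) φ y u),
    ← unip_mulVec_unipInv (p := p) (q := q) (r := r) (toFrame (jetBundle S) φ y v)]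
  exact congrArg _ h

lemma eigenCoord_ofFrame (hy : y ∈ φ.chart.source) (v : Fin 3 → ℂ) :
    eigenCoord φ p q r y (ofFrame (jetBundle S) φ y ((unip p q r).mulVec v)) = v := by
  rw [eigenCoord, toFrame_ofFrame (Z := jetBundle S) hy, unipInv_mulVec_unip]

lemma eigenCoord_add (u v : (jetBundle S).Fiber y) :
    eigenCoord φ p q r y (u + v) = eigenCoord φ p q r y u + eigenCoord φ p q r y v := by
  simp [eigenCoord, Matrix.mulVec_add]

lemma eigenCoord_smul (a : ℂ) (u : (jetBundle S).Fiber y) :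
    eigenCoord φ p q r y (a • u) = a • eigenCoord φ p q r y u := by
  simp [eigenCoord, Matrix.mulVec_smul]

/-- Division of a section by `z - z(y)`. -/
lemma exists_div_section (hy : y ∈ φ.chart.source) {U : Set X} (hU : IsOpen U) (hyU : y ∈ U) (hUφ : U ⊆ φ.chart.source)
    {ρ : ∀ x, (jetBundle S).Fiber x} (hρ : HolOn (jetBundle S) U ρ) (h0 : ρ y = 0) :
    ∃ τ, HolOn (jetBundle S) U τ ∧ ∀ x ∈ U, (φ.chart x - φ.chart y) • τ x = ρ x := by
  classical
  obtain ⟨g, hg, eg, -⟩ := exists_eq_sub_smul (hρ.analyticAt hU hyU (i := φ) hy φ hy) (by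
    rw [φ.chart.left_inv hy, h0, map_zero])
  have hne {x : X} (hx : x ∈ U) (hxy : x ≠ y) : φ.chart x - φ.chart y ≠ 0 := fun h =>
    hxy (φ.chart.injOn (hUφ hx) hy (sub_eq_zero.mp h))
  let τ : ∀ x, (jetBundle S).Fiber x := fun x => ofFrame (jetBundle S) φ x
    (if x = y then g (φ.chart y) else (φ.chart x - φ.chart y)⁻¹ • toFrame (jetBundle S) φ x (ρ x))
  have hτ {x : X} (hx : x ∈ U) : toFrame (jetBundle S) φ x (τ x) = g (φ.chart x) := by
    simp only [τ]
    rw [toFrame_ofFrame (Z := jetBundle S) (hUφ hx)]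
    split_ifs with h
    · rw [h]
    · have := eg (φ.chart x)
      rw [φ.chart.left_inv (hUφ hx)] at this
      rw [this, smul_smul, inv_mul_cancel₀ (hne hx h), one_smul]
  refine ⟨τ, holOn_of_analyticAt fun x hx => ⟨φ, hUφ hx, S, φ, hUφ hx, ?_⟩, fun x hx => ?_⟩
  · by_cases hxy : x = y
    · subst hxy
      refine hg.congr ?_
      filter_upwards [eventually_symm φ hy (hU.mem_nhds hyU), eventually_right_inv φ hy] with w hw e
      rw [hτ hw, e]
    · have h1 : AnalyticAt ℂ (fun w => (w - φ.chart y)⁻¹ • toFrame (jetBundle S) φ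
          (φ.chart.symm w) (ρ (φ.chart.symm w))) (φ.chart x) :=
        ((analyticAt_id.sub analyticAt_const).inv (hne hx hxy)).smul
          (hρ.analyticAt hU hx (i := φ) (hUφ hx) φ (hUφ hx))
      refine h1.congr ?_
      filter_upwards [eventually_symm φ (hUφ hx) ((hU.inter isOpen_ne).mem_nhds ⟨hx, hxy⟩),
        eventually_right_inv φ (hUφ hx)] with w hw e
      have := eg w
      rw [hτ hw.1, e, this, smul_smul, inv_mul_cancel₀, one_smul]
      rw [← e]
      exact hne hw.1 hw.2
  · apply toFrame_injective (Z := jetBundle S) (i := φ) (hUφ hx)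
    have := eg (φ.chart x)
    rw [φ.chart.left_inv (hUφ hx)] at this
    rw [map_smul, hτ hx, this]

variable (hy : y ∈ φ.chart.source) (hyS : y ∈ S)
  (hP : connMat D φ y * unip p q r = unip p q r * resDiag)
include hy hyS hP

lemma eigenCoord_res (u : (jetBundle S).Fiber y) :
    eigenCoord φ p q r y (D.res y u) = resDiag.mulVec (eigenCoord φ p q r y u) := by
  have h := gaugeA_eq_resDiag (A := fun _ => connMat D φ y) (c := 0) hP
  rw [eigenCoord, res_eq_connMat D hy hyS, ← h, eigenCoord]
  exact (gaugeA_mulVec (A := fun _ => connMat D φ y) 0 _).symm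

lemma mem_eigenspace_iff_coord (μ : ℂ) (u : (jetBundle S).Fiber y) :
    u ∈ Module.End.eigenspace (D.res y) μ ↔
      resDiag.mulVec (eigenCoord φ p q r y u) = μ • eigenCoord φ p q r y u := by
  rw [Module.End.mem_eigenspace_iff, ← eigenCoord_res hy hyS hP, ← eigenCoord_smul]
  exact ⟨fun h => by rw [h], fun h => eigenCoord_injective hy h⟩

lemma mem_eigenspace_neg_one_iff (u : (jetBundle S).Fiber y) :
    u ∈ Module.End.eigenspace (D.res y) (-1) ↔
      eigenCoord φ p q r y u 0 = 0 ∧ eigenCoord φ p q r y u 2 = 0 := by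
  rw [mem_eigenspace_iff_coord hy hyS hP]
  generalize eigenCoord φ p q r y u = g
  constructor
  · intro h
    have h0 := congrFun h 0
    have h2 := congrFun h 2
    simp [resDiag, Matrix.mulVec_diagonal] at h0 h2
    exact ⟨h0, by linear_combination h2⟩
  · rintro ⟨h0, h2⟩
    ext i
    fin_cases i <;> simp [resDiag, Matrix.mulVec_diagonal, h0, h2]

lemma mem_eigenspace_zero_iff (u : (jetBundle S).Fiber y) :
    u ∈ Module.End.eigenspace (D.res y) 0 ↔
      eigenCoord φ p q r y u 1 = 0 ∧ eigenCoord φ p q r y u 2 = 0 := by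
  rw [mem_eigenspace_iff_coord hy hyS hP]
  generalize eigenCoord φ p q r y u = g
  constructor
  · intro h
    have h0 := congrFun h 1
    have h2 := congrFun h 2
    simp [resDiag, Matrix.mulVec_diagonal] at h0 h2
    exact ⟨h0, h2⟩
  · rintro ⟨h0, h2⟩
    ext i
    fin_cases i <;> simp [resDiag, Matrix.mulVec_diagonal, h0, h2]

lemma mem_sup_eigenspace_iff (u : (jetBundle S).Fiber y) :
    u ∈ Module.End.eigenspace (D.res y) (-1) ⊔ Module.End.eigenspace (D.res y) 0 ↔
      eigenCoord φ p q r y u 2 = 0 := by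
  rw [Submodule.mem_sup]
  constructor
  · rintro ⟨a, ha, b, hb, rfl⟩
    rw [mem_eigenspace_neg_one_iff hy hyS hP] at ha
    rw [mem_eigenspace_zero_iff hy hyS hP] at hb
    rw [eigenCoord_add, Pi.add_apply, ha.2, hb.2, add_zero]
  · intro h
    refine ⟨ofFrame (jetBundle S) φ y
      ((unip p q r).mulVec ![0, eigenCoord φ p q r y u 1, 0]), ?_,
      ofFrame (jetBundle S) φ y ((unip p q r).mulVec ![eigenCoord φ p q r y u 0, 0, 0]), ?_, ?_⟩
    · rw [mem_eigenspace_neg_one_iff hy hyS hP, eigenCoord_ofFrame hy]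
      simp
    · rw [mem_eigenspace_zero_iff hy hyS hP, eigenCoord_ofFrame hy]
      simp
    · apply eigenCoord_injective (p := p) (q := q) (r := r) hy
      rw [eigenCoord_add, eigenCoord_ofFrame hy, eigenCoord_ofFrame hy]
      ext i
      fin_cases i <;> simp [h]

/-- The derivative of `(z - z(y)) s`. -/
lemma eigenCoord_phi {U : Set X} (hU : IsOpen U) (hyU : y ∈ U)
    {s τ : ∀ x, (jetBundle S).Fiber x} (hs : HolOn (jetBundle S) U s)
    (hτ : HolOn (jetBundle S) U τ)
    (hD : ∀ x ∈ U, x ∉ S → ∀ t : TangentSpace 𝓘(ℂ) x,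
      D.cov (fun p => (φ.chart p - φ.chart y) • s p) x t =
        mvfderiv 𝓘(ℂ) φ.chart x t • (φ.chart x - φ.chart y) • τ x)
    (hsy : s y ∈ Module.End.eigenspace (D.res y) (-1)) :
    eigenCoord φ p q r y (τ y) 2 =
      derivM (gaugeA p q r fun w => connMat D φ (φ.chart.symm w)) (φ.chart y) 2 1 *
        eigenCoord φ p q r y (s y) 1 := by
  have has := hs.analyticAt hU hyU (i := φ) hy φ hy
  have haτ := hτ.analyticAt hU hyU (i := φ) hy φ hy
  have hmem := (mem_eigenspace_neg_one_iff hy hyS hP _).mp hsy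
  have key := phi_value_gauge (p := p) (q := q) (r := r) (connMat_analytic D φ hy)
    (by rwa [φ.chart.left_inv hy]) has haτ (by
    filter_upwards [eventually_notMem φ hy,
      (eventually_mem φ φ hy hy).filter_mono nhdsWithin_le_nhds, self_mem_nhdsWithin,
      (eventually_symm φ hy (hU.mem_nhds hyU)).filter_mono nhdsWithin_le_nhds,
      has.eventually_analyticAt.filter_mono nhdsWithin_le_nhds] with w hwS hw hwc hwU hsw
    set x := φ.chart.symm w
    have hxw : φ.chart x = w := φ.chart.right_inv hw.1
    obtain ⟨t, ht⟩ := exists_mvfderiv_chart_eq_one φ hw.2.1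
    have hsx : MDifferentiableAt 𝓘(ℂ) 𝓘(ℂ) (fun p => φ.chart p - φ.chart y) x :=
      (mdifferentiableAt_iff_coord φ hw.2.1).mpr (by
        have : (fun w => φ.chart (φ.chart.symm w) - φ.chart y) =ᶠ[𝓝 (φ.chart x)]
            fun w => w - φ.chart y := by
          filter_upwards [eventually_right_inv φ hw.2.1] with t ht
          rw [ht]
        exact (by fun_prop : DifferentiableAt ℂ (fun w => w - φ.chart y) (φ.chart x)).congr_of_eventuallyEq
          this)
    have h1 := cov_eq_connMat D hw.2.1 hwS (mdifferentiableAt_smul_sec hsx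
      (hs.mdifferentiableAt hU hwU)) t
    have h2 := hD x hwU hwS t
    have e : ((fun p => φ.chart p - φ.chart y) • s) =
      fun p => (φ.chart p - φ.chart y) • s p := rfl
    rw [e, h2, ht, φ.eqn_of_mem hyS hy] at h1
    have hd : cderiv φ (fun z => toFrame (jetBundle S) φ z ((φ.chart z - φ.chart y) • s z)) x =
        toFrame (jetBundle S) φ x (s x) + (w - φ.chart y) •
          deriv (fun w => toFrame (jetBundle S) φ (φ.chart.symm w) (s (φ.chart.symm w))) w := by
      have h3 := ((hasDerivAt_id w).sub_const (φ.chart y)).smul hsw.differentiableAt.hasDerivAt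
      rw [cderiv, hxw]
      have h4 : (fun w => toFrame (jetBundle S) φ (φ.chart.symm w)
          ((φ.chart (φ.chart.symm w) - φ.chart y) • s (φ.chart.symm w))) =ᶠ[𝓝 w]
          fun w => (w - φ.chart y) •
            toFrame (jetBundle S) φ (φ.chart.symm w) (s (φ.chart.symm w)) := by
        rw [← hxw]
        filter_upwards [eventually_right_inv φ hw.2.1] with t ht
        rw [map_smul, ht]
      rw [h4.deriv_eq]
      refine h3.deriv.trans ?_
      simp [add_comm, x]
    rw [hd, hxw] at h1
    simp only [map_smul, one_smul, Matrix.mulVec_smul] at h1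
    rw [hxw, ← smul_add] at h1
    have hw0 : w - φ.chart y ≠ 0 := sub_ne_zero.mpr hwc
    exact smul_right_injective _ hw0 h1)
    (by
      rw [φ.chart.left_inv hy]
      exact hmem.1) (by
      rw [φ.chart.left_inv hy]
      exact hmem.2)
  rw [φ.chart.left_inv hy] at key
  exact key

/-- By `eigenCoord_phi` the component of `τ(y)` in `L₂` is this coefficient times the coordinate of
`s(y)` along `L₁`. -/
lemma isPhi_zero_iff : IsPhi D φ y 0 ↔
    derivM (gaugeA p q r fun w => connMat D φ (φ.chart.symm w)) (φ.chart y) 2 1 = 0 := by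
  constructor
  · intro h
    -- The test section is constant in the frame, with value the eigenvector for `-1` at `y`.
    let s : ∀ x, (jetBundle S).Fiber x :=
      fun x => ofFrame (jetBundle S) φ x ((unip p q r).mulVec (Pi.single 1 1))
    have hs : HolOn (jetBundle S) φ.chart.source s :=
      holOn_ofFrame (Z := jetBundle S) φ.chart.open_source Subset.rfl
        (fun _ _ => mdifferentiableAt_const.mdifferentiableWithinAt)
    have hsy : eigenCoord φ p q r y (s y) = Pi.single 1 1 := eigenCoord_ofFrame hy _
    have hmem : s y ∈ Module.End.eigenspace (D.res y) (-1) := by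
      rw [mem_eigenspace_neg_one_iff hy hyS hP, hsy]
      simp
    obtain ⟨τ, hτ, hD, h0⟩ := h ⟨s y, hmem⟩ φ.chart.source φ.chart.open_source hy Subset.rfl s hs rfl
    have h1 := eigenCoord_phi hy hyS hP φ.chart.open_source hy hs hτ hD hmem
    rw [LinearMap.zero_apply, ZeroMemClass.coe_zero, sub_zero,
      mem_sup_eigenspace_iff hy hyS hP] at h0
    rw [h0, hsy] at h1
    simpa using h1.symm
  · intro h v U hU hyU hUφ s hs hsv
    obtain ⟨τ', hτ', hD, hres⟩ := D.isLog φ U hU hUφ s hs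
    have hv := v.2
    rw [Module.End.mem_eigenspace_iff] at hv
    have hρ : HolOn (jetBundle S) U (s + τ') := fun x hx =>
      (mdifferentiableAt_add_section (hs.mdifferentiableAt hU hx)
        (hτ'.mdifferentiableAt hU hx)).mdifferentiableWithinAt
    -- With `D s = τ' dz / (z - z(y))`, the derivative of `(z - z(y)) s` is `(s + τ') dz`. It
    -- vanishes at `y` because the residue acts on `s(y)` as `-1`, so it is divisible by `z - z(y)`.
    obtain ⟨τ, hτ, e⟩ := exists_div_section hy hU hyU hUφ hρ (by
      rw [Pi.add_apply, hres y hyU hyS, hsv, hv, neg_one_smul, add_neg_cancel])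
    have hcov : ∀ x ∈ U, x ∉ S → ∀ t : TangentSpace 𝓘(ℂ) x,
        D.cov (fun p => (φ.chart p - φ.chart y) • s p) x t =
          mvfderiv 𝓘(ℂ) φ.chart x t • (φ.chart x - φ.chart y) • τ x := by
      intro x hx hxS t
      have hm : MDifferentiableAt 𝓘(ℂ) 𝓘(ℂ) (fun p => φ.chart p - φ.chart y) x :=
        (mdifferentiableAt_chart φ (hUφ hx)).sub mdifferentiableAt_const
      have h1 := D.isCov.leibniz (hs.mdifferentiableAt hU hx) hm (show x ∈ (S : Set X)ᶜ from hxS)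
      have h2 : mvfderiv 𝓘(ℂ) (fun p => φ.chart p - φ.chart y) x = mvfderiv 𝓘(ℂ) φ.chart x := by
        rw [mvfderiv_fun_sub (mdifferentiableAt_chart φ (hUφ hx)) mdifferentiableAt_const,
          mvfderiv_const, sub_zero]
      have h3 := hD x hx hxS t
      rw [φ.eqn_of_mem hyS hy] at h3
      refine (congrArg (fun L => L t) h1).trans ?_
      rw [e x hx, _root_.add_apply, _root_.smul_apply, ContinuousLinearMap.smulRight_apply,
        h2, h3, Pi.add_apply, smul_add, add_comm]
    refine ⟨τ, hτ, hcov, ?_⟩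
    rw [LinearMap.zero_apply, ZeroMemClass.coe_zero, sub_zero, mem_sup_eigenspace_iff hy hyS hP,
      eigenCoord_phi hy hyS hP hU hyU hs hτ hcov (by rw [hsv]; exact v.2), h, zero_mul]

end Phi

/-! ### Nonzero `φ_i` makes the form on `𝓔` degenerate. -/

section Necessity

variable {X : Type u} [TopologicalSpace X] [ChartedSpace ℂ X] [T2Space X] [IsManifold 𝓘(ℂ) ω X]
  {S : Finset X} {D : LogConnection S (jetBundle S)} {φ : AdaptedChart S} {y : X}

lemma mem_ker_res_iff (hy : y ∈ φ.chart.source) (hyS : y ∈ S) (u : (jetBundle S).Fiber y) :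
    u ∈ Module.End.eigenspace (D.res y) 0 ↔
      (connMat D φ y).mulVec (toFrame (jetBundle S) φ y u) = 0 := by
  rw [Module.End.mem_eigenspace_iff, zero_smul, ← res_eq_connMat D hy hyS]
  exact ⟨fun h => by rw [h, map_zero],
    fun h => toFrame_injective (Z := jetBundle S) (i := φ) hy (by rw [h, map_zero])⟩

/-- The sections of `𝓔` near `y`, in the frame of a coordinate. -/
lemma IsSecE.exists_frame {U : Set X} (hU : IsOpen U) (hyU : y ∈ U) (hy : y ∈ φ.chart.source)
    (hyS : y ∈ S) {σ : ∀ x, (jetBundle S).Fiber x} (hσ : IsSecE D U σ) :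
    ∃ τ : ℂ → Fin 3 → ℂ, AnalyticAt ℂ τ (φ.chart y) ∧
      (∀ᶠ w in 𝓝[≠] (φ.chart y), (w - φ.chart y) • τ w = (w - φ.chart y) •
        deriv (fun w => toFrame (jetBundle S) φ (φ.chart.symm w) (σ (φ.chart.symm w))) w +
        (connMat D φ (φ.chart.symm w)).mulVec
          (toFrame (jetBundle S) φ (φ.chart.symm w) (σ (φ.chart.symm w)))) ∧
      (connMat D φ y).mulVec (toFrame (jetBundle S) φ y (σ y)) = 0 ∧
      (connMat D φ y).mulVec (τ (φ.chart y)) = 0 := by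
  obtain ⟨⟨hhol, hker⟩, hE⟩ := hσ
  obtain ⟨χ, V, hVo, hyV, hVU, ρ, ⟨hρ, hρker⟩, hD⟩ := hE y hyU hyS
  have hyχ : y ∈ χ.chart.source := (hVU hyV).2
  have hχ : AnalyticAt ℂ (trans χ φ) (φ.chart y) := trans_analyticAt χ φ hyχ hy
  have hk : ∀ {v : (jetBundle S).Fiber y}, v ∈ Module.End.eigenspace (D.res y) 0 →
      (connMat D φ y).mulVec (toFrame (jetBundle S) φ y v) = 0 :=
    fun hv => (mem_ker_res_iff hy hyS _).mp hv
  refine ⟨fun w => deriv (trans χ φ) w • toFrame (jetBundle S) φ (φ.chart.symm w)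
    (ρ (φ.chart.symm w)), hχ.deriv.smul (hρ.analyticAt hVo hyV (i := φ) hy φ hy), ?_,
    hk (hker y hyU hyS), ?_⟩
  · filter_upwards [eventually_notMem φ hy,
      (eventually_mem φ φ hy hy).filter_mono nhdsWithin_le_nhds,
      (eqnC_eventuallyEq φ hy hyS).filter_mono nhdsWithin_le_nhds,
      (eventually_symm φ hy (hVo.mem_nhds hyV)).filter_mono nhdsWithin_le_nhds]
      with w hwS hw he hwV
    obtain ⟨t, ht⟩ := exists_mvfderiv_chart_eq_one φ hw.2.1
    have hwU := hVU hwV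
    have h1 := cov_eq_connMat D hw.2.1 hwS (hhol.mdifferentiableAt hU hwU.1) t
    rw [hD _ hwV hwS t, ht, mvfderiv_eq_cderiv φ hw.2.1 (mdifferentiableAt_chart χ hwU.2), ht,
      one_smul, one_smul, map_smul, show φ.eqn (φ.chart.symm w) = w - φ.chart y from he] at h1
    simp only [cderiv, φ.chart.right_inv hw.1] at h1
    exact h1
  · beta_reduce
    rw [φ.chart.left_inv hy, Matrix.mulVec_smul, hk (hρker y hyV hyS), smul_zero]

/-- Such a `v` lies in the kernel of the rank one Gram matrix `β t tᵀ`. -/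
lemma exists_ne_zero_dot_eq_zero (t : Fin 3 → ℂ) : ∃ v : Fin 3 → ℂ, v ≠ 0 ∧ ∑ i, v i * t i = 0 := by
  by_cases h : t 0 = 0
  · refine ⟨![1, 0, 0], fun e => ?_, ?_⟩
    · simpa using congrFun e 0
    · simp [Fin.sum_univ_three, h]
  · refine ⟨![t 1, -t 0, 0], fun e => ?_, ?_⟩
    · have := congrFun e 1
      simp at this
      exact h this
    · simp [Fin.sum_univ_three]
      ring

/-- Nondegeneracy of the form of the oper is already contradictory: a local frame of the bundle maps
to three sections of `𝓔`, whose Gram matrix has rank at most one at `y`. -/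
theorem isPhi_zero_of_definesBranchedOper {𝔹 : TwistedForm S (jetBundle S)}
    (h : AdmissiblePair 𝔹 D) (hdef : DefinesBranchedOper 𝔹 D) (hy : y ∈ φ.chart.source)
    (hyS : y ∈ S) : IsPhi D φ y 0 := by
  obtain ⟨p, q, r, hP⟩ := exists_unip h hy hyS
  rw [isPhi_zero_iff hy hyS hP]
  by_contra hne
  obtain ⟨J, Z, hZ, W, Ψ, hid⟩ := hdef
  set j := Z.indexAt y
  have hyj : y ∈ Z.baseSet j := Z.mem_baseSet_at y
  set U := Z.baseSet j
  have hU : IsOpen U := Z.isOpen_baseSet j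
  let s : Fin 3 → ∀ x, Z.Fiber x := fun k x => ofFrame Z j x (Pi.single k 1)
  have hs (k : Fin 3) : HolOn Z U (s k) := holOn_ofFrame hU Subset.rfl
    (fun _ _ => mdifferentiableAt_const.mdifferentiableWithinAt)
  have hE (k : Fin 3) := hid.maps_to U hU _ (hs k)
  choose τ hτ hD hu0 hτ0 using fun k => (hE k).exists_frame hU hyj hy hyS
  have hfan (i k : Fin 3) := analyticAt_coord_of_forall φ hy hU hyj
    (W.form_hol U hU _ _ (hs i) (hs k))
  obtain ⟨β, t, hβ⟩ := (localPair h hy hyS).gram_rank_one_gauge (p := p) (q := q) (r := r)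
    (by rwa [φ.chart.left_inv hy]) hne
    (u := fun k w => toFrame (jetBundle S) φ (φ.chart.symm w) (Ψ _ (s k (φ.chart.symm w))))
    (τ := τ)
    (f := fun i k w => W.form (φ.chart.symm w) (s i (φ.chart.symm w)) (s k (φ.chart.symm w)))
    (fun k => (hE k).1.1.analyticAt hU hyj (i := φ) hy φ hy) hτ hD
    (fun k => by rw [φ.chart.left_inv hy]; exact hu0 k)
    (fun k => by rw [φ.chart.left_inv hy]; exact hτ0 k)
    -- Away from `S` the form of the oper is `m⁻²` times the Gram matrix of `𝔹`; being holomorphic,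
    -- it determines its own value at `y`.
    (fun i k => (hfan i k).continuousAt) (fun i k => by
      filter_upwards [eventually_notMem φ hy,
        (eventually_mem φ φ hy hy).filter_mono nhdsWithin_le_nhds,
        (eqnC_eventuallyEq φ hy hyS).filter_mono nhdsWithin_le_nhds, self_mem_nhdsWithin]
        with w hwS hw he hwc
      have hw0 : w - φ.chart y ≠ 0 := sub_ne_zero.mpr hwc
      rw [← hid.form_eq _ hwS, toMero_form 𝔹 hw.2.1 hwS,
        show φ.eqn (φ.chart.symm w) = w - φ.chart y from he, ← mul_assoc,
        mul_inv_cancel₀ (pow_ne_zero 2 hw0), one_mul])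
  replace hβ : ∀ i k, W.form y (s i y) (s k y) = β * t i * t k := fun i k => by
    have := hβ i k
    beta_reduce at this
    rwa [φ.chart.left_inv hy] at this
  obtain ⟨v, hv, hvt⟩ := exists_ne_zero_dot_eq_zero t
  have e (a : Z.Fiber y) : a = ∑ k, toFrame Z j y a k • s k y := by
    apply toFrame_injective hyj
    simp only [map_sum, map_smul, s, toFrame_ofFrame hyj]
    ext i
    simp [Finset.sum_apply, Pi.single_apply]
  have h0 : ofFrame Z j y v = 0 := by
    apply W.form_nondeg y
    intro b
    rw [e (ofFrame Z j y v), e b, toFrame_ofFrame hyj]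
    simp only [map_sum, map_smul, LinearMap.sum_apply, LinearMap.smul_apply, hβ, smul_eq_mul]
    have : ∀ k, ∑ i, v i * (β * t i * t k) = 0 := fun k => by
      rw [← mul_zero (β * t k), ← hvt, Finset.mul_sum]
      exact Finset.sum_congr rfl fun i _ => by ring
    simp only [this, mul_zero, Finset.sum_const_zero]
  apply hv
  rw [← toFrame_ofFrame hyj v, h0, map_zero]

end Necessity

/-! ### Local frames of `𝓔` around every point. -/

section LocalFrames

variable {X : Type u} [TopologicalSpace X] [ChartedSpace ℂ X] [T2Space X] [IsManifold 𝓘(ℂ) ω X]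
  {S : Finset X}

/-- A frame of `𝓔` near `x`, given by the matrix `frameMat p q r a m` in the frame of `J²(𝕋)`, with the
matrix `C` of the connection and the Gram matrix `H` of the form. -/
structure LocalFrame (𝔹 : TwistedForm S (jetBundle S)) (D : LogConnection S (jetBundle S))
    (x : X) where
  p : ℂ
  q : ℂ
  r : ℂ
  a : ℂ
  C : ℂ → Mat3
  H : ℂ → Mat3
  anC : AnalyticM C ((adaptedChartAt S x).chart x)
  anH : AnalyticM H ((adaptedChartAt S x).chart x)
  det_H : (H ((adaptedChartAt S x).chart x)).det ≠ 0
  C_eq : ∀ᶠ w in 𝓝[≠] ((adaptedChartAt S x).chart x),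
    frameMat p q r a (eqnC (adaptedChartAt S x) w) * C w =
      derivM (fun t => frameMat p q r a (eqnC (adaptedChartAt S x) t)) w +
        (eqnC (adaptedChartAt S x) w)⁻¹ •
          (connMat D (adaptedChartAt S x) ((adaptedChartAt S x).chart.symm w) *
            frameMat p q r a (eqnC (adaptedChartAt S x) w))
  H_eq : ∀ᶠ w in 𝓝[≠] ((adaptedChartAt S x).chart x),
    H w = ((eqnC (adaptedChartAt S x) w) ^ 2)⁻¹ •
      ((frameMat p q r a (eqnC (adaptedChartAt S x) w)).transpose *
        formMat 𝔹 (adaptedChartAt S x) ((adaptedChartAt S x).chart.symm w) *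
        frameMat p q r a (eqnC (adaptedChartAt S x) w))
  ker : x ∈ S → connMat D (adaptedChartAt S x) x * frameMat p q r a 0 = 0
  lift : ∀ U, IsOpen U → x ∈ U → ∀ σ, IsSecE D U σ → ∃ v : ℂ → Fin 3 → ℂ,
    AnalyticAt ℂ v ((adaptedChartAt S x).chart x) ∧
    ∀ᶠ w in 𝓝 ((adaptedChartAt S x).chart x),
      toFrame (jetBundle S) (adaptedChartAt S x) ((adaptedChartAt S x).chart.symm w)
        (σ ((adaptedChartAt S x).chart.symm w)) =
      (frameMat p q r a (eqnC (adaptedChartAt S x) w)).mulVec (v w)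

/-- At a point of `S` this is the local model. Elsewhere `𝓔` is `J²(𝕋)`, but the frame `diag(1, m,
m²)` is still used, so that all frames have determinant `m³` and the same diagonal. -/
lemma exists_localFrame {𝔹 : TwistedForm S (jetBundle S)} {D : LogConnection S (jetBundle S)}
    (h : AdmissiblePair 𝔹 D) (hφ : ∀ y ∈ S, IsPhi D (adaptedChartAt S y) y 0) (x : X) :
    Nonempty (LocalFrame 𝔹 D x) := by
  set φ := adaptedChartAt S x with hφdef
  have hx : x ∈ φ.chart.source := mem_adaptedChartAt S x
  have hm := eqnC_analyticAt φ hx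
  by_cases hxS : x ∈ S
  · obtain ⟨p, q, r, hP⟩ := exists_unip h hx hxS
    have hP' : connMat D φ (φ.chart.symm (φ.chart x)) * unip p q r = unip p q r * resDiag := by
      rwa [φ.chart.left_inv hx]
    have h0 := (isPhi_zero_iff hx hxS hP).mp (hφ x hxS)
    obtain ⟨a, C, H, ha, hC, hH, hdet, eC, eH⟩ := (localPair h hx hxS).exists_frame hP' h0
    have he := eqnC_eventuallyEq φ hx hxS
    refine ⟨p, q, r, a, C, H, hC, hH, hdet, ?_, ?_, fun _ => ?_, ?_⟩
    · filter_upwards [eC, he.eventuallyEq_nhds.filter_mono nhdsWithin_le_nhds] with w hw hew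
      have e1 : derivM (fun t => frameMat p q r a (eqnC φ t)) w =
          derivM (fun t => frameMat p q r a (t - φ.chart x)) w := by
        ext i j
        refine EventuallyEq.deriv_eq (hew.mono fun t ht => ?_)
        simp only [ht]
      rw [e1, hew.eq_of_nhds, hw]
    · filter_upwards [eH, he.filter_mono nhdsWithin_le_nhds] with w hw hew
      rw [hew, hw]
    -- At the point itself only the first column of the frame survives, and it spans the kernel `L₀`
    -- of the residue.
    · have : resDiag * modif a 0 = 0 := by
        ext i j
        fin_cases i <;> fin_cases j <;> simp [resDiag, modif, Matrix.mul_apply, Fin.sum_univ_three]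
      rw [frameMat, ← Matrix.mul_assoc, hP, Matrix.mul_assoc, this, Matrix.mul_zero]
    · intro U hU hxU σ hσ
      obtain ⟨τ, hτ, hD, hu0, hτ0⟩ := hσ.exists_frame hU hxU hx hxS
      obtain ⟨v, hv, ev⟩ := section_conditions_gauge (p := p) (q := q) (r := r)
        (connMat_analytic D φ hx) hP' (hσ.1.1.analyticAt hU hxU (i := φ) hx φ hx) hτ hD
        (by rw [φ.chart.left_inv hx]; exact hu0) (by rw [φ.chart.left_inv hx]; exact hτ0)
      refine ⟨v, hv, ?_⟩
      filter_upwards [he] with w hw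
      rw [hw, ha]
      exact ev w
  -- The chart may still contain a point of `S` other than `x`, so `m` need not be 1; it is only
  -- nonzero at `x`.
  · have hm0 : eqnC φ (φ.chart x) ≠ 0 := by
      rw [eqnC_chart φ hx]
      exact φ.eqn_ne_zero hx hxS
    have hG : AnalyticM (fun w => frameMat 0 0 0 0 (eqnC φ w)) (φ.chart x) :=
      AnalyticM.frameMat 0 0 0 0 hm
    have hdet : (frameMat 0 0 0 0 (eqnC φ (φ.chart x))).det ≠ 0 := by
      rw [det_frameMat]
      exact pow_ne_zero 3 hm0
    have hGi := AnalyticM.inv hG hdet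
    have hA := connMat_analytic D φ hx
    have hb := formMat_analytic 𝔹 φ hx
    have hev : ∀ᶠ w in 𝓝 (φ.chart x), (frameMat 0 0 0 0 (eqnC φ w)).det ≠ 0 :=
      hG.det.continuousAt.eventually_ne hdet
    refine ⟨0, 0, 0, 0, fun w => (frameMat 0 0 0 0 (eqnC φ w))⁻¹ *
        (derivM (fun t => frameMat 0 0 0 0 (eqnC φ t)) w + (eqnC φ w)⁻¹ •
          (connMat D φ (φ.chart.symm w) * frameMat 0 0 0 0 (eqnC φ w))),
      fun w => ((eqnC φ w) ^ 2)⁻¹ • ((frameMat 0 0 0 0 (eqnC φ w)).transpose *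
        formMat 𝔹 φ (φ.chart.symm w) * frameMat 0 0 0 0 (eqnC φ w)),
      hGi.mul (hG.derivM.add (AnalyticM.smul (hm.inv hm0) (hA.mul hG))),
      AnalyticM.smul ((hm.pow 2).inv (pow_ne_zero 2 hm0)) ((hG.transpose.mul hb).mul hG),
      ?_, ?_, ?_, fun h => absurd h hxS, ?_⟩
    · simp only [Matrix.det_smul, Matrix.det_mul, Matrix.det_transpose]
      rw [← hφdef, φ.chart.left_inv hx]
      have := formMat_det_ne_zero 𝔹 hx
      simp [hdet, this, hm0]
    · filter_upwards [hev.filter_mono nhdsWithin_le_nhds] with w hw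
      rw [← Matrix.mul_assoc, Matrix.mul_nonsing_inv _ hw.isUnit, Matrix.one_mul]
    · exact Eventually.of_forall fun w => rfl
    · intro U hU hxU σ hσ
      refine ⟨_, hGi.mulVec (hσ.1.1.analyticAt hU hxU (i := φ) hx φ hx), ?_⟩
      filter_upwards [hev] with w hw
      rw [Matrix.mulVec_mulVec, Matrix.mul_nonsing_inv _ hw.isUnit, Matrix.one_mulVec]

namespace LocalFrame

variable {𝔹 : TwistedForm S (jetBundle S)} {D : LogConnection S (jetBundle S)} {x : X}
  (L : LocalFrame 𝔹 D x)

/-- The frame matrix, as a function on `X`. -/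
def G (y : X) : Mat3 := frameMat L.p L.q L.r L.a ((adaptedChartAt S x).eqn y)

/-- The frame matrix, as a function of the coordinate. -/
def GC (w : ℂ) : Mat3 := frameMat L.p L.q L.r L.a (eqnC (adaptedChartAt S x) w)

lemma GC_chart {y : X} (hy : y ∈ (adaptedChartAt S x).chart.source) :
    L.GC ((adaptedChartAt S x).chart y) = L.G y := by
  rw [GC, G, eqnC_chart _ hy]

lemma anGC {y : X} (hy : y ∈ (adaptedChartAt S x).chart.source) :
    AnalyticM L.GC ((adaptedChartAt S x).chart y) :=
  AnalyticM.frameMat _ _ _ _ (eqnC_analyticAt _ hy)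

lemma det_G (y : X) : (L.G y).det = (adaptedChartAt S x).eqn y ^ 3 := det_frameMat _ _ _ _ _

lemma det_G_ne_zero {y : X} (hy : y ∈ (adaptedChartAt S x).chart.source) (hyS : y ∉ S) :
    (L.G y).det ≠ 0 := by
  rw [det_G]
  exact pow_ne_zero 3 ((adaptedChartAt S x).eqn_ne_zero hy hyS)

lemma C_eq_center (hxS : x ∉ S) : L.G x * L.C ((adaptedChartAt S x).chart x) =
    derivM L.GC ((adaptedChartAt S x).chart x) + ((adaptedChartAt S x).eqn x)⁻¹ •
      (connMat D (adaptedChartAt S x) x * L.G x) := by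
  have hx := mem_adaptedChartAt S x
  have hm := eqnC_analyticAt _ hx
  have hm0 : eqnC (adaptedChartAt S x) ((adaptedChartAt S x).chart x) ≠ 0 := by
    rw [eqnC_chart _ hx]
    exact (adaptedChartAt S x).eqn_ne_zero hx hxS
  have hG := L.anGC hx
  have h1 := hG.mul L.anC
  have h2 := hG.derivM.add (AnalyticM.smul (hm.inv hm0) ((connMat_analytic D _ hx).mul hG))
  ext i j
  have := eq_of_eventuallyEq_punctured (h1 i j).continuousAt (h2 i j).continuousAt
    (L.C_eq.mono fun w hw => congrFun (congrFun hw i) j)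
  simp only [Pi.inv_apply] at this
  rwa [L.GC_chart hx, eqnC_chart _ hx, (adaptedChartAt S x).chart.left_inv hx] at this

lemma H_eq_center (hxS : x ∉ S) : L.H ((adaptedChartAt S x).chart x) =
    (((adaptedChartAt S x).eqn x) ^ 2)⁻¹ • ((L.G x).transpose *
      formMat 𝔹 (adaptedChartAt S x) x * L.G x) := by
  have hx := mem_adaptedChartAt S x
  have hm := eqnC_analyticAt _ hx
  have hm0 : eqnC (adaptedChartAt S x) ((adaptedChartAt S x).chart x) ≠ 0 := by
    rw [eqnC_chart _ hx]
    exact (adaptedChartAt S x).eqn_ne_zero hx hxS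
  have hG := L.anGC hx
  have h2 := AnalyticM.smul ((hm.pow 2).inv (pow_ne_zero 2 hm0))
    ((hG.transpose.mul (formMat_analytic 𝔹 _ hx)).mul hG)
  ext i j
  have := eq_of_eventuallyEq_punctured (L.anH i j).continuousAt (h2 i j).continuousAt
    (L.H_eq.mono fun w hw => congrFun (congrFun hw i) j)
  simp only [Pi.inv_apply, Pi.pow_apply] at this
  rwa [L.GC_chart hx, eqnC_chart _ hx, (adaptedChartAt S x).chart.left_inv hx] at this

lemma H_symm : (L.H ((adaptedChartAt S x).chart x)).transpose =
    L.H ((adaptedChartAt S x).chart x) := by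
  ext i j
  refine eq_of_eventuallyEq_punctured (f := fun w => L.H w j i) (g := fun w => L.H w i j)
    (L.anH j i).continuousAt (L.anH i j).continuousAt ?_
  filter_upwards [L.H_eq] with w hw
  have : (L.H w).transpose = L.H w := by
    rw [hw]
    simp [Matrix.transpose_mul, formMat_transpose, Matrix.mul_assoc]
  exact congrFun (congrFun this i) j

/-- The factor `(m⁻²)³` cancels `(det G)² = m⁶`. The equality passes to points of `S` by continuity.
-/
lemma det_H_eq : (L.H ((adaptedChartAt S x).chart x)).det =
    (formMat 𝔹 (adaptedChartAt S x) x).det := by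
  have hx := mem_adaptedChartAt S x
  have := eq_of_eventuallyEq_punctured L.anH.det.continuousAt
    (formMat_analytic 𝔹 _ hx).det.continuousAt (by
      filter_upwards [L.H_eq, eventually_punctured _ hx
        (p := fun y => (adaptedChartAt S x).eqn y ≠ 0)
        fun y hy hyS => (adaptedChartAt S x).eqn_ne_zero hy hyS] with w hw h0
      have h0' : eqnC (adaptedChartAt S x) w ≠ 0 := h0
      rw [hw, Matrix.det_smul, Matrix.det_mul, Matrix.det_mul, Matrix.det_transpose, det_frameMat]
      simp
      field_simp)
  rwa [(adaptedChartAt S x).chart.left_inv hx] at this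

/-- The Gram matrix is parallel. -/
lemma H_parallel (h : AdmissiblePair 𝔹 D) :
    HasDerivM L.H ((L.C ((adaptedChartAt S x).chart x)).transpose *
      L.H ((adaptedChartAt S x).chart x) + L.H ((adaptedChartAt S x).chart x) *
      L.C ((adaptedChartAt S x).chart x)) ((adaptedChartAt S x).chart x) := by
  have hx := mem_adaptedChartAt S x
  have h1 := (L.anC.transpose.mul L.anH).add (L.anH.mul L.anC)
  have key : ∀ᶠ w in 𝓝[≠] ((adaptedChartAt S x).chart x), derivM L.H w =
      (L.C w).transpose * L.H w + L.H w * L.C w := by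
    filter_upwards [L.C_eq, eventually_eventually_nhdsWithin.mpr L.H_eq, self_mem_nhdsWithin,
      eventually_notMem (adaptedChartAt S x) hx,
      (eventually_mem (adaptedChartAt S x) (adaptedChartAt S x) hx hx).filter_mono
        nhdsWithin_le_nhds]
      with w hC hH hwc hwS hw
    rw [(isOpen_compl_singleton).nhdsWithin_eq hwc] at hH
    have e : (adaptedChartAt S x).chart ((adaptedChartAt S x).chart.symm w) = w :=
      (adaptedChartAt S x).chart.right_inv hw.1
    have hG := L.anGC hw.2.1
    have hm := eqnC_analyticAt (adaptedChartAt S x) hw.2.1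
    have hb := formMat_analytic 𝔹 (adaptedChartAt S x) hw.2.1
    have hp := formMat_parallel h hw.2.1 hwS
    rw [e] at hG hm hb hp
    have hm0 : eqnC (adaptedChartAt S x) w ≠ 0 := (adaptedChartAt S x).eqn_ne_zero hw.2.1 hwS
    have key := @gram_parallel w (eqnC (adaptedChartAt S x)) _
      (fun t => connMat D (adaptedChartAt S x) ((adaptedChartAt S x).chart.symm t))
      (fun t => formMat 𝔹 (adaptedChartAt S x) ((adaptedChartAt S x).chart.symm t))
      L.GC L.C L.H _ _ hm.differentiableAt.hasDerivAt hm0 hb.hasDerivM hG.hasDerivM hp hC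
    -- `gram_parallel` divides by `m`, so it applies only off `S`; the identity at the centre is its
    -- limit.
    exact (key hH).derivM_eq
  have e : derivM L.H ((adaptedChartAt S x).chart x) =
      (L.C ((adaptedChartAt S x).chart x)).transpose * L.H ((adaptedChartAt S x).chart x) +
        L.H ((adaptedChartAt S x).chart x) * L.C ((adaptedChartAt S x).chart x) := by
    ext i j
    exact eq_of_eventuallyEq_punctured (L.anH.derivM i j).continuousAt (h1 i j).continuousAt
      (key.mono fun w hw => congrFun (congrFun hw i) j)
  rw [← e]
  exact L.anH.hasDerivM

/-- The last column of the frame is `m² e₂` and `A₀₂ = 0`, so row 0 of the frame equation gives the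
first claim, and row 1 then reads `m C₁₂ = m A₁₂`. -/
lemma eventually_C_zero_two (h : AdmissiblePair 𝔹 D) :
    ∀ᶠ w in 𝓝[≠] ((adaptedChartAt S x).chart x), L.C w 0 2 = 0 ∧
      L.C w 1 2 = connMat D (adaptedChartAt S x) ((adaptedChartAt S x).chart.symm w) 1 2 := by
  have hx := mem_adaptedChartAt S x
  filter_upwards [L.C_eq, eventually_notMem (adaptedChartAt S x) hx,
    (eventually_mem (adaptedChartAt S x) (adaptedChartAt S x) hx hx).filter_mono
      nhdsWithin_le_nhds] with w hC hwS hw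
  have e : (adaptedChartAt S x).chart ((adaptedChartAt S x).chart.symm w) = w :=
    (adaptedChartAt S x).chart.right_inv hw.1
  have hm := eqnC_analyticAt (adaptedChartAt S x) hw.2.1
  rw [e] at hm
  have hm0 : eqnC (adaptedChartAt S x) w ≠ 0 := (adaptedChartAt S x).eqn_ne_zero hw.2.1 hwS
  have hA := connMat_zero_two h hw.2.1 hwS
  have d02 : derivM (fun t => frameMat L.p L.q L.r L.a (eqnC (adaptedChartAt S x) t)) w 0 2
      = 0 := by
    simp [derivM, frameMat_eq]
  have d12 : derivM (fun t => frameMat L.p L.q L.r L.a (eqnC (adaptedChartAt S x) t)) w 1 2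
      = 0 := by
    simp [derivM, frameMat_eq]
  have c0 := congrFun (congrFun hC 0) 2
  have c1 := congrFun (congrFun hC 1) 2
  rw [Matrix.add_apply, d02] at c0
  rw [Matrix.add_apply, d12] at c1
  simp only [Matrix.smul_apply, Matrix.mul_apply, Fin.sum_univ_three, frameMat_eq] at c0 c1
  simp [hA] at c0 c1
  rw [c0] at c1
  refine ⟨c0, ?_⟩
  field_simp at c1
  simpa [hm0] using c1

lemma C_zero_two (h : AdmissiblePair 𝔹 D) : L.C ((adaptedChartAt S x).chart x) 0 2 = 0 ∧
    L.C ((adaptedChartAt S x).chart x) 1 2 = connMat D (adaptedChartAt S x) x 1 2 := by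
  have hx := mem_adaptedChartAt S x
  have key := L.eventually_C_zero_two h
  refine ⟨eq_of_eventuallyEq_punctured (L.anC 0 2).continuousAt continuousAt_const
    (key.mono fun w hw => hw.1), ?_⟩
  have := eq_of_eventuallyEq_punctured (L.anC 1 2).continuousAt
    (connMat_analytic D (adaptedChartAt S x) hx 1 2).continuousAt (key.mono fun w hw => hw.2)
  beta_reduce at this
  rwa [(adaptedChartAt S x).chart.left_inv hx] at this

end LocalFrame

end LocalFrames

/-! ### Gluing the local frames to the bundle `𝓔`. -/

section OperBundle

variable {X : Type u} [TopologicalSpace X] [ChartedSpace ℂ X] [T2Space X] [IsManifold 𝓘(ℂ) ω X]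
  {S : Finset X}

lemma jetChange_mul (φ ψ χ : AdaptedChart S) {x : X} (hφ : x ∈ φ.chart.source)
    (hψ : x ∈ ψ.chart.source) (hχ : x ∈ χ.chart.source) :
    jetChange ψ χ x * jetChange φ ψ x = jetChange φ χ x := by
  refine Matrix.ext_of_mulVec_single fun i => ?_
  rw [← Matrix.mulVec_mulVec, jetChange_mulVec_mulVec φ ψ χ hφ hψ hχ]

lemma jetChange_eq_one (φ : AdaptedChart S) {x : X} (hφ : x ∈ φ.chart.source) :
    jetChange φ φ x = 1 := by
  refine Matrix.ext_of_mulVec_single fun i => ?_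
  rw [jetChange_self φ hφ, Matrix.one_mulVec]

lemma analyticM_of_mulVec {A : ℂ → Mat3} {c : ℂ}
    (h : ∀ u, AnalyticAt ℂ (fun w => (A w).mulVec u) c) : AnalyticM A c := fun i j => by
  simpa using analyticAt_apply (h (Pi.single j 1)) i

lemma jetChange_analyticM (φ ψ : AdaptedChart S) {x : X} (hφ : x ∈ φ.chart.source)
    (hψ : x ∈ ψ.chart.source) :
    AnalyticM (fun w => jetChange φ ψ (ψ.chart.symm w)) (ψ.chart x) :=
  analyticM_of_mulVec fun u => jetChange_analyticAt φ ψ hφ hψ u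

/-- The domain of the frame at the point `i`: it contains no point of `S`, except possibly `i`. -/
def operBase (S : Finset X) (i : X) : Set X :=
  (adaptedChartAt S i).chart.source ∩ ((S : Set X) \ {i})ᶜ

lemma isOpen_operBase (i : X) : IsOpen (operBase S i) :=
  (adaptedChartAt S i).chart.open_source.inter
    ((Finset.finite_toSet S).subset sdiff_subset).isClosed.isOpen_compl

lemma mem_operBase_self (i : X) : i ∈ operBase S i :=
  ⟨mem_adaptedChartAt S i, fun h => h.2 rfl⟩

lemma eq_of_mem_operBase {i x : X} (hx : x ∈ operBase S i) (hxS : x ∈ S) : x = i := by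
  by_contra hne
  exact hx.2 ⟨hxS, hne⟩

variable {𝔹 : TwistedForm S (jetBundle S)} {D : LogConnection S (jetBundle S)}
  (L : ∀ x, LocalFrame 𝔹 D x)

open Classical in
/-- The transition matrices of `𝓔` between the frames `L i`. -/
def operChange (i j x : X) : Mat3 :=
  if x ∈ S then 1 else
    ((L j).G x)⁻¹ * jetChange (adaptedChartAt S i) (adaptedChartAt S j) x * (L i).G x

lemma operChange_of_mem {i j x : X} (hx : x ∈ S) : operChange L i j x = 1 := if_pos hx

lemma operChange_of_notMem {i j x : X} (hx : x ∉ S) : operChange L i j x =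
    ((L j).G x)⁻¹ * jetChange (adaptedChartAt S i) (adaptedChartAt S j) x * (L i).G x := if_neg hx

lemma operChange_self {i x : X} (hx : x ∈ operBase S i) : operChange L i i x = 1 := by
  by_cases hxS : x ∈ S
  · exact operChange_of_mem L hxS
  · rw [operChange_of_notMem L hxS, jetChange_eq_one _ hx.1, Matrix.mul_one,
      Matrix.nonsing_inv_mul _ ((L i).det_G_ne_zero hx.1 hxS).isUnit]

/-- The cocycle relation with the inverse of `G` cleared, hence meaningful also at points of `S`,
where `G` is singular. -/
lemma G_mul_operChange {i j x : X} (hi : x ∈ operBase S i) (hj : x ∈ operBase S j) :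
    (L j).G x * operChange L i j x =
      jetChange (adaptedChartAt S i) (adaptedChartAt S j) x * (L i).G x := by
  by_cases hxS : x ∈ S
  · obtain rfl := eq_of_mem_operBase hi hxS
    obtain rfl := eq_of_mem_operBase hj hxS
    rw [operChange_of_mem L hxS, jetChange_eq_one _ hi.1, Matrix.mul_one, Matrix.one_mul]
  · rw [operChange_of_notMem L hxS, ← Matrix.mul_assoc, ← Matrix.mul_assoc,
      Matrix.mul_nonsing_inv _ ((L j).det_G_ne_zero hj.1 hxS).isUnit, Matrix.one_mul]

lemma operChange_mul {i j k x : X} (hi : x ∈ operBase S i) (hj : x ∈ operBase S j)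
    (hk : x ∈ operBase S k) :
    operChange L j k x * operChange L i j x = operChange L i k x := by
  by_cases hxS : x ∈ S
  · simp only [operChange_of_mem L hxS, Matrix.one_mul]
  · have e := G_mul_operChange L hi hj
    rw [operChange_of_notMem L hxS (i := j), operChange_of_notMem L hxS (i := i) (j := k),
      Matrix.mul_assoc _ ((L j).G x), e, Matrix.mul_assoc, Matrix.mul_assoc,
      ← Matrix.mul_assoc (jetChange _ _ x) (jetChange _ _ x), jetChange_mul _ _ _ hi.1 hj.1 hk.1]

/-- A point of `S` lies only in the domain of its own frame, so near it both indices agree and the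
transition is the identity. Off `S` the defining formula is analytic. -/
lemma operChange_analyticM {i j x : X} (hi : x ∈ operBase S i) (hj : x ∈ operBase S j) :
    AnalyticM (fun w => operChange L i j ((adaptedChartAt S j).chart.symm w))
      ((adaptedChartAt S j).chart x) := by
  by_cases hxS : x ∈ S
  · obtain rfl := eq_of_mem_operBase hi hxS
    obtain rfl := eq_of_mem_operBase hj hxS
    refine (analyticM_const 1).congr ?_
    filter_upwards [eventually_symm _ hi.1 ((isOpen_operBase x).mem_nhds hi)] with w hw
    exact (operChange_self L hw).symm
  · have h1 : AnalyticM (fun w => (L j).G ((adaptedChartAt S j).chart.symm w))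
        ((adaptedChartAt S j).chart x) := (L j).anGC hj.1
    have h2 : AnalyticM (fun w => (L i).G ((adaptedChartAt S j).chart.symm w))
        ((adaptedChartAt S j).chart x) := fun a b =>
      analyticAt_coord_change (adaptedChartAt S i) (adaptedChartAt S j) hi.1 hj.1
        (f := fun y => (L i).G y a b) ((L i).anGC hi.1 a b)
    have h3 := h1.inv (by
      rw [(adaptedChartAt S j).chart.left_inv hj.1]
      exact (L j).det_G_ne_zero hj.1 hxS)
    refine ((h3.mul (jetChange_analyticM _ _ hi.1 hj.1)).mul h2).congr ?_
    have hS : ∀ᶠ y in 𝓝 x, y ∉ S := (Finset.finite_toSet S).isClosed.isOpen_compl.mem_nhds hxS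
    filter_upwards [eventually_symm _ hj.1 hS] with w hw
    exact (operChange_of_notMem L hw).symm

/-- The bundle `𝓔`, glued from the local frames. -/
def operBundle : VectorBundleCore ℂ X (Fin 3 → ℂ) X where
  baseSet := operBase S
  isOpen_baseSet := isOpen_operBase
  indexAt := id
  mem_baseSet_at := mem_operBase_self
  coordChange i j x := (Matrix.mulVecLin (operChange L i j x)).toContinuousLinearMap
  coordChange_self i x hx v := by
    change (operChange L i i x).mulVec v = v
    rw [operChange_self L hx, Matrix.one_mulVec]
  continuousOn_coordChange _ j := fun _ hx =>
    (contMDiffAt_clm (adaptedChartAt S j) hx.2.1 fun _ =>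
      (operChange_analyticM L hx.1 hx.2).mulVec
        analyticAt_const).continuousAt.continuousWithinAt
  coordChange_comp i j k x hx v := by
    change (operChange L j k x).mulVec ((operChange L i j x).mulVec v) =
      (operChange L i k x).mulVec v
    rw [Matrix.mulVec_mulVec, operChange_mul L hx.1.1 hx.1.2 hx.2]

instance : (operBundle L).IsContMDiff 𝓘(ℂ) ω where
  contMDiffOn_coordChange _ j := fun _ hx =>
    (contMDiffAt_clm (adaptedChartAt S j) hx.2.1 fun _ =>
      (operChange_analyticM L hx.1 hx.2).mulVec analyticAt_const).contMDiffWithinAt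

lemma toFrame_oper_self (x : X) (u : (operBundle L).Fiber x) :
    toFrame (operBundle L) x x u = u := toFrame_indexAt (Z := operBundle L) x u

/-- The inclusion of `𝓔` in `J²(𝕋)`. -/
def operIncl (x : X) : (operBundle L).Fiber x →ₗ[ℂ] (jetBundle S).Fiber x :=
  Matrix.mulVecLin ((L x).G x)

lemma toFrame_operIncl {i x : X} (hi : x ∈ operBase S i) (u : (operBundle L).Fiber x) :
    toFrame (jetBundle S) (adaptedChartAt S i) x (operIncl L x u) =
      ((L i).G x).mulVec (toFrame (operBundle L) i x u) := by
  have key (u : Fin 3 → ℂ) : (jetChange (adaptedChartAt S x) (adaptedChartAt S i) x).mulVec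
      (((L x).G x).mulVec u) = ((L i).G x).mulVec ((operChange L x i x).mulVec u) := by
    rw [Matrix.mulVec_mulVec, Matrix.mulVec_mulVec, G_mul_operChange L (mem_operBase_self x) hi]
  exact key u

lemma holOn_operIncl {U : Set X} (hU : IsOpen U) {σ : ∀ x, (operBundle L).Fiber x}
    (hσ : HolOn (operBundle L) U σ) : HolOn (jetBundle S) U fun x => operIncl L x (σ x) := by
  refine holOn_of_analyticAt fun x hx => ⟨adaptedChartAt S x, mem_adaptedChartAt S x, S,
    adaptedChartAt S x, mem_adaptedChartAt S x, ?_⟩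
  have hx' := mem_adaptedChartAt S x
  refine (((L x).anGC hx').mulVec (hσ.analyticAt hU hx (i := x) (mem_operBase_self x)
    (adaptedChartAt S x) hx')).congr ?_
  filter_upwards [eventually_symm _ hx' ((isOpen_operBase x).mem_nhds (mem_operBase_self x))]
    with w hw
  exact (toFrame_operIncl L hw _).symm

lemma operIncl_injective {x : X} (hxS : x ∉ S) {u v : (operBundle L).Fiber x}
    (h : operIncl L x u = operIncl L x v) : u = v :=
  Matrix.mulVec_injective_of_isUnit ((Matrix.isUnit_iff_isUnit_det _).mpr
    ((L x).det_G_ne_zero (mem_adaptedChartAt S x) hxS).isUnit) h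

end OperBundle

/-! ### The connection and the form on `𝓔`. -/

section OperConnection

variable {X : Type u} [TopologicalSpace X] [ChartedSpace ℂ X] [T2Space X] [IsManifold 𝓘(ℂ) ω X]
  {S : Finset X}

lemma eventually_nhds_notMem (S : Finset X) (x : X) : ∀ᶠ y in 𝓝 x, y ≠ x → y ∉ S := by
  filter_upwards [(isOpen_operBase (S := S) x).mem_nhds (mem_operBase_self x)] with y hy hne hyS
  exact hne (eq_of_mem_operBase hy hyS)

lemma cderiv_analyticAt {T : Finset X} {E : Type*} [NormedAddCommGroup E] [NormedSpace ℂ E]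
    [CompleteSpace E] (ψ : AdaptedChart T) {x : X} (hx : x ∈ ψ.chart.source) {f : X → E}
    (hf : AnalyticAt ℂ (fun w => f (ψ.chart.symm w)) (ψ.chart x)) :
    AnalyticAt ℂ (fun w => cderiv ψ f (ψ.chart.symm w)) (ψ.chart x) := by
  refine hf.deriv.congr ?_
  filter_upwards [eventually_right_inv ψ hx] with w hw
  rw [cderiv, hw]

variable {𝔹 : TwistedForm S (jetBundle S)} {D : LogConnection S (jetBundle S)}

lemma LocalFrame.C_eq_nhds {x : X} (L : LocalFrame 𝔹 D x) : ∀ᶠ y in 𝓝 x, y ∉ S →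
    L.G y * L.C ((adaptedChartAt S x).chart y) =
      derivM L.GC ((adaptedChartAt S x).chart y) + ((adaptedChartAt S x).eqn y)⁻¹ •
        (connMat D (adaptedChartAt S x) y * L.G y) := by
  have hx := mem_adaptedChartAt S x
  have h := L.C_eq
  rw [eventually_nhdsWithin_iff] at h
  filter_upwards [eventually_chart _ hx h, (adaptedChartAt S x).chart.open_source.mem_nhds hx]
    with y hy hyx hyS
  by_cases hne : y = x
  · subst hne
    exact L.C_eq_center hyS
  · have := hy fun e => hne ((adaptedChartAt S x).chart.injOn hyx hx e)
    rw [eqnC_chart _ hyx, (adaptedChartAt S x).chart.left_inv hyx] at this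
    exact this

lemma LocalFrame.H_eq_nhds {x : X} (L : LocalFrame 𝔹 D x) : ∀ᶠ y in 𝓝 x, y ∉ S →
    L.H ((adaptedChartAt S x).chart y) = (((adaptedChartAt S x).eqn y) ^ 2)⁻¹ •
      ((L.G y).transpose * formMat 𝔹 (adaptedChartAt S x) y * L.G y) := by
  have hx := mem_adaptedChartAt S x
  have h := L.H_eq
  rw [eventually_nhdsWithin_iff] at h
  filter_upwards [eventually_chart _ hx h, (adaptedChartAt S x).chart.open_source.mem_nhds hx]
    with y hy hyx hyS
  by_cases hne : y = x
  · subst hne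
    exact L.H_eq_center hyS
  · have := hy fun e => hne ((adaptedChartAt S x).chart.injOn hyx hx e)
    rw [eqnC_chart _ hyx, (adaptedChartAt S x).chart.left_inv hyx] at this
    exact this

variable (L : ∀ x, LocalFrame 𝔹 D x)

lemma mulVec_G_injective {i x : X} (hi : x ∈ operBase S i) (hxS : x ∉ S) {u v : Fin 3 → ℂ}
    (h : ((L i).G x).mulVec u = ((L i).G x).mulVec v) : u = v :=
  Matrix.mulVec_injective_of_isUnit ((Matrix.isUnit_iff_isUnit_det _).mpr
    ((L i).det_G_ne_zero hi.1 hxS).isUnit) h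

/-- The gauge transformation rule. The matrix `C₀` is left free so that it applies both at the
centre of a frame and at nearby points. -/
lemma toFrame_cov_operIncl {i x : X} (hi : x ∈ operBase S i) (hxS : x ∉ S) {C₀ : Mat3}
    (hC : (L i).G x * C₀ = derivM (L i).GC ((adaptedChartAt S i).chart x) +
      ((adaptedChartAt S i).eqn x)⁻¹ • (connMat D (adaptedChartAt S i) x * (L i).G x))
    {U : Set X} (hU : IsOpen U) (hxU : x ∈ U) {σ : ∀ x, (operBundle L).Fiber x}
    (hσ : HolOn (operBundle L) U σ) (v : TangentSpace 𝓘(ℂ) x) :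
    toFrame (jetBundle S) (adaptedChartAt S i) x (D.cov (fun y => operIncl L y (σ y)) x v) =
      mvfderiv 𝓘(ℂ) (adaptedChartAt S i).chart x v • ((L i).G x).mulVec
        (cderiv (adaptedChartAt S i) (fun y => toFrame (operBundle L) i y (σ y)) x +
          C₀.mulVec (toFrame (operBundle L) i x (σ x))) := by
  have h1 := cov_eq_connMat D hi.1 hxS ((holOn_operIncl L hU hσ).mdifferentiableAt hU hxU) v
  have hm0 := (adaptedChartAt S i).eqn_ne_zero hi.1 hxS
  have hs := hσ.analyticAt hU hxU (i := i) hi (adaptedChartAt S i) hi.1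
  have h2 : cderiv (adaptedChartAt S i) (fun y => toFrame (jetBundle S) (adaptedChartAt S i) y
      (operIncl L y (σ y))) x =
      (derivM (L i).GC ((adaptedChartAt S i).chart x)).mulVec
        (toFrame (operBundle L) i x (σ x)) + ((L i).G x).mulVec
        (cderiv (adaptedChartAt S i) (fun y => toFrame (operBundle L) i y (σ y)) x) := by
    have e := ((L i).anGC hi.1).hasDerivM.mulVec hs.differentiableAt.hasDerivAt
    beta_reduce at e
    rw [(L i).GC_chart hi.1, (adaptedChartAt S i).chart.left_inv hi.1] at e
    refine (EventuallyEq.deriv_eq ?_).trans e.deriv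
    filter_upwards [eventually_symm _ hi.1 ((isOpen_operBase i).mem_nhds hi)] with w hw
    exact toFrame_operIncl L hw _
  rw [h2, toFrame_operIncl L hi] at h1
  have h3 := congrArg (fun u => ((adaptedChartAt S i).eqn x)⁻¹ • u) h1
  simp only [inv_smul_smul₀ hm0] at h3
  rw [h3, smul_comm, smul_add, inv_smul_smul₀ hm0, Matrix.mulVec_add, Matrix.mulVec_mulVec _ _ C₀,
    hC, Matrix.add_mulVec, Matrix.smul_mulVec, Matrix.mulVec_mulVec]
  congr 1
  abel

/-- The connection induced on `𝓔`. -/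
def operCov (σ : ∀ x, (operBundle L).Fiber x) (x : X) :
    TangentSpace 𝓘(ℂ) x →L[ℂ] (operBundle L).Fiber x :=
  (mvfderiv 𝓘(ℂ) (adaptedChartAt S x).chart x).smulRight
    (cderiv (adaptedChartAt S x) (fun y => toFrame (operBundle L) x y (σ y)) x +
      ((L x).C ((adaptedChartAt S x).chart x)).mulVec (toFrame (operBundle L) x x (σ x)))

lemma operCov_apply (σ : ∀ x, (operBundle L).Fiber x) (x : X) (v : TangentSpace 𝓘(ℂ) x) :
    toFrame (operBundle L) x x (operCov L σ x v) =
    mvfderiv 𝓘(ℂ) (adaptedChartAt S x).chart x v •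
    (cderiv (adaptedChartAt S x) (fun y => toFrame (operBundle L) x y (σ y)) x +
      ((L x).C ((adaptedChartAt S x).chart x)).mulVec (toFrame (operBundle L) x x (σ x))) :=
  toFrame_oper_self L x _

lemma cov_operIncl {U : Set X} (hU : IsOpen U) {σ : ∀ x, (operBundle L).Fiber x}
    (hσ : HolOn (operBundle L) U σ) {x : X} (hxU : x ∈ U) (hxS : x ∉ S)
    (v : TangentSpace 𝓘(ℂ) x) :
    D.cov (fun y => operIncl L y (σ y)) x v = operIncl L x (operCov L σ x v) := by
  apply toFrame_injective (Z := jetBundle S) (i := adaptedChartAt S x) (mem_adaptedChartAt S x)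
  rw [toFrame_cov_operIncl L (mem_operBase_self x) hxS ((L x).C_eq_center hxS) hU hxU hσ,
    toFrame_operIncl L (mem_operBase_self x), operCov_apply, Matrix.mulVec_smul]

/-- `operCov` uses at each point the frame centred there, whereas holomorphy requires one fixed
frame. Off `S` both expressions have the same image under the injective inclusion in `J²(𝕋)`; a
point of `S` near `i` can only be `i` itself. -/
lemma toFrame_operCov (i : X) : ∀ᶠ x in 𝓝 i, ∀ U, IsOpen U → x ∈ U → ∀ σ,
    HolOn (operBundle L) U σ → ∀ v : TangentSpace 𝓘(ℂ) x,
    toFrame (operBundle L) i x (operCov L σ x v) =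
      mvfderiv 𝓘(ℂ) (adaptedChartAt S i).chart x v •
        (cderiv (adaptedChartAt S i) (fun y => toFrame (operBundle L) i y (σ y)) x +
          ((L i).C ((adaptedChartAt S i).chart x)).mulVec
            (toFrame (operBundle L) i x (σ x))) := by
  filter_upwards [(L i).C_eq_nhds, eventually_nhds_notMem S i,
    (isOpen_operBase i).mem_nhds (mem_operBase_self i)] with x hC hxS hi U hU hxU σ hσ v
  by_cases hne : x = i
  · subst hne
    exact operCov_apply L σ x v
  · have hS := hxS hne
    apply mulVec_G_injective L hi hS
    rw [← toFrame_operIncl L hi, ← cov_operIncl L hU hσ hxU hS,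
      toFrame_cov_operIncl L hi hS (hC hS) hU hxU hσ, Matrix.mulVec_smul]

/-- The form induced on `𝓔`. -/
def operForm (x : X) : (operBundle L).Fiber x →ₗ[ℂ] (operBundle L).Fiber x →ₗ[ℂ] ℂ :=
  Matrix.toLinearMap₂' ℂ ((L x).H ((adaptedChartAt S x).chart x))

lemma operForm_apply (x : X) (u w : (operBundle L).Fiber x) : operForm L x u w =
    toFrame (operBundle L) x x u ⬝ᵥ ((L x).H ((adaptedChartAt S x).chart x)).mulVec
      (toFrame (operBundle L) x x w) := by
  rw [toFrame_oper_self, toFrame_oper_self]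
  exact Matrix.toLinearMap₂'_apply' _ _ _

lemma toMero_operIncl {i x : X} (hi : x ∈ operBase S i) (hxS : x ∉ S) {H₀ : Mat3}
    (hH : H₀ = (((adaptedChartAt S i).eqn x) ^ 2)⁻¹ •
      (((L i).G x).transpose * formMat 𝔹 (adaptedChartAt S i) x * (L i).G x))
    (u w : (operBundle L).Fiber x) :
    toMero S 2 x (𝔹.form x (operIncl L x u) (operIncl L x w)) =
      toFrame (operBundle L) i x u ⬝ᵥ H₀.mulVec (toFrame (operBundle L) i x w) := by
  rw [toMero_form 𝔹 hi.1 hxS, toFrame_operIncl L hi, toFrame_operIncl L hi, hH,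
    Matrix.smul_mulVec, dotProduct_smul, smul_eq_mul, Matrix.mul_assoc, ← Matrix.mulVec_mulVec,
    ← Matrix.mulVec_mulVec, Matrix.dotProduct_mulVec _ (Matrix.transpose _),
    Matrix.vecMul_transpose]

lemma toMero_operForm {x : X} (hxS : x ∉ S) (u w : (operBundle L).Fiber x) :
    toMero S 2 x (𝔹.form x (operIncl L x u) (operIncl L x w)) = operForm L x u w := by
  rw [operForm_apply,
    toMero_operIncl L (mem_operBase_self x) hxS ((L x).H_eq_center hxS)]

/-- Off `S` both sides compute the form `𝔹` on the included vectors, which gives the form in a fixed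
frame and thus its holomorphy. -/
lemma operForm_eq_nhds (i : X) : ∀ᶠ x in 𝓝 i, ∀ u w : (operBundle L).Fiber x,
    operForm L x u w = toFrame (operBundle L) i x u ⬝ᵥ
      ((L i).H ((adaptedChartAt S i).chart x)).mulVec (toFrame (operBundle L) i x w) := by
  filter_upwards [(L i).H_eq_nhds, eventually_nhds_notMem S i,
    (isOpen_operBase i).mem_nhds (mem_operBase_self i)] with x hH hxS hi u w
  by_cases hne : x = i
  · subst hne
    exact operForm_apply L x u w
  · have hS := hxS hne
    rw [← toMero_operForm L hS, toMero_operIncl L hi hS (hH hS)]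

lemma isCovariantDerivativeOn_operCov :
    IsCovariantDerivativeOn (Fin 3 → ℂ) (operCov L) ((∅ : Finset X) : Set X)ᶜ where
  add {σ τ x} hσ hτ _ := by
    have h1 := (mdifferentiableAt_iff_coord _ (mem_adaptedChartAt S x)).mp
      ((mdifferentiableAt_section_iff_frame (Z := operBundle L) (mem_operBase_self x)).mp hσ)
    have h2 := (mdifferentiableAt_iff_coord _ (mem_adaptedChartAt S x)).mp
      ((mdifferentiableAt_section_iff_frame (Z := operBundle L) (mem_operBase_self x)).mp hτ)
    refine ContinuousLinearMap.ext fun v => ?_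
    apply toFrame_injective (Z := operBundle L) (i := x) (mem_operBase_self x)
    rw [_root_.add_apply, map_add, operCov_apply, operCov_apply, operCov_apply]
    have e : cderiv (adaptedChartAt S x) (fun y => toFrame (operBundle L) x y ((σ + τ) y)) x =
        cderiv (adaptedChartAt S x) (fun y => toFrame (operBundle L) x y (σ y)) x +
        cderiv (adaptedChartAt S x) (fun y => toFrame (operBundle L) x y (τ y)) x := by
      refine Eq.trans ?_ (h1.hasDerivAt.add h2.hasDerivAt).deriv
      simp only [cderiv, Pi.add_apply, map_add]
      rfl
    rw [e, Pi.add_apply, map_add, Matrix.mulVec_add, ← smul_add]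
    congr 1
    abel
  leibniz {σ g x} hσ hg _ := by
    have h1 := (mdifferentiableAt_iff_coord _ (mem_adaptedChartAt S x)).mp
      ((mdifferentiableAt_section_iff_frame (Z := operBundle L) (mem_operBase_self x)).mp hσ)
    have h2 := (mdifferentiableAt_iff_coord _ (mem_adaptedChartAt S x)).mp hg
    refine ContinuousLinearMap.ext fun v => ?_
    apply toFrame_injective (Z := operBundle L) (i := x) (mem_operBase_self x)
    simp only [_root_.add_apply, _root_.smul_apply,
      ContinuousLinearMap.smulRight_apply, map_add, map_smul]
    rw [operCov_apply, operCov_apply, mvfderiv_eq_cderiv _ (mem_adaptedChartAt S x) hg]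
    have e : cderiv (adaptedChartAt S x) (fun y => toFrame (operBundle L) x y ((g • σ) y)) x =
        g x • cderiv (adaptedChartAt S x) (fun y => toFrame (operBundle L) x y (σ y)) x +
        cderiv (adaptedChartAt S x) g x • toFrame (operBundle L) x x (σ x) := by
      have := (h2.hasDerivAt.smul h1.hasDerivAt).deriv
      beta_reduce at this
      rw [(adaptedChartAt S x).chart.left_inv (mem_adaptedChartAt S x)] at this
      refine Eq.trans ?_ this
      simp only [cderiv, Pi.smul_apply', map_smul]
      rfl
    rw [e, Pi.smul_apply', map_smul, Matrix.mulVec_smul]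
    module

lemma exists_analytic_operCov {T : Finset X} (ψ : AdaptedChart T) {U : Set X} (hU : IsOpen U)
    (hUψ : U ⊆ ψ.chart.source) {σ : ∀ x, (operBundle L).Fiber x}
    (hσ : HolOn (operBundle L) U σ) : ∃ τ, HolOn (operBundle L) U τ ∧
      ∀ x ∈ U, ∀ v, operCov L σ x v = mvfderiv 𝓘(ℂ) ψ.chart x v • τ x := by
  classical
  choose t ht using fun (x : X) (hx : x ∈ ψ.chart.source) => exists_mvfderiv_chart_eq_one ψ hx
  -- The coefficient of `dz` is the covariant derivative along a vector with `dz = 1`; it does not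
  -- depend on the vector chosen, so the choices need not vary holomorphically.
  let τ : ∀ x, (operBundle L).Fiber x := fun x =>
    if hx : x ∈ ψ.chart.source then operCov L σ x (t x hx) else 0
  have hτ {x : X} (hx : x ∈ ψ.chart.source) : τ x = operCov L σ x (t x hx) := dif_pos hx
  refine ⟨τ, ?_, fun x hx v => ?_⟩
  · refine holOn_of_analyticAt fun x hx => ⟨x, mem_operBase_self x, S, adaptedChartAt S x,
      mem_adaptedChartAt S x, ?_⟩
    have hx' := mem_adaptedChartAt S x
    have hs := hσ.analyticAt hU hx (i := x) (mem_operBase_self x) (adaptedChartAt S x) hx'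
    have h1 : AnalyticAt ℂ (fun w => (adaptedChartAt S x).chart ((adaptedChartAt S x).chart.symm w))
        ((adaptedChartAt S x).chart x) := by
      refine analyticAt_id.congr ?_
      filter_upwards [eventually_right_inv _ hx'] with w hw
      exact hw.symm
    have h2 := analyticAt_coord_change ψ (adaptedChartAt S x) (hUψ hx) hx'
      (cderiv_analyticAt ψ (hUψ hx) (analyticAt_coord_change (adaptedChartAt S x) ψ hx'
        (hUψ hx) h1))
    have h3 := cderiv_analyticAt (adaptedChartAt S x) hx'
      (f := fun y => toFrame (operBundle L) x y (σ y)) hs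
    refine (h2.smul (h3.add ((L x).anC.mulVec hs))).congr ?_
    filter_upwards [eventually_symm _ hx' (toFrame_operCov L x), eventually_mem _ _ hx' hx',
      eventually_symm _ hx' (hU.mem_nhds hx)] with w hw hw' hwU
    rw [hτ (hUψ hwU), hw U hU hwU σ hσ, mvfderiv_eq_cderiv ψ (hUψ hwU)
      (mdifferentiableAt_chart _ hw'.2.1), ht _ (hUψ hwU), one_smul]
    simp only [Pi.smul_apply', Pi.add_apply, (adaptedChartAt S x).chart.right_inv hw'.1]
  · rw [hτ (hUψ hx)]
    apply toFrame_injective (Z := operBundle L) (i := x) (mem_operBase_self x)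
    rw [map_smul, operCov_apply, operCov_apply, mvfderiv_eq_cderiv ψ (hUψ hx)
      (mdifferentiableAt_chart _ (mem_adaptedChartAt S x)), mvfderiv_eq_cderiv ψ (hUψ hx)
      (mdifferentiableAt_chart _ (mem_adaptedChartAt S x)), ht x (hUψ hx), one_smul, smul_smul]
    rfl

/-- The holomorphic connection on `𝓔`. -/
def operConn : HolConnection (operBundle L) where
  cov := operCov L
  isCov := isCovariantDerivativeOn_operCov L
  res _ := 0
  isLog ψ U hU hUψ σ hσ := by
    obtain ⟨τ, hτ, e⟩ := exists_analytic_operCov L ψ hU hUψ hσ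
    refine ⟨τ, hτ, fun x hx _ v => ?_, fun x _ hxS => absurd hxS (Finset.notMem_empty x)⟩
    rw [← e x hx, AdaptedChart.eqn]
    simp

end OperConnection

/-! ### Derivatives of determinants and of dot products. -/

section Determinants

/-- A linear map acts on `⋀³` as a derivation, by its trace. -/
lemma sum_det_updateRow (M C : Mat3) :
    ∑ k, (M.updateRow k (C.mulVec (M k))).det = C.trace * M.det := by
  simp [Fin.sum_univ_three, Matrix.det_fin_three, Matrix.updateRow_apply, Matrix.mulVec, dotProduct,
    Matrix.trace, Matrix.diag]
  ring

lemma HasDerivM.det_updateRow {M : ℂ → Mat3} {M' : Mat3} {w : ℂ} (h : HasDerivM M M' w) :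
    HasDerivAt (fun t => (M t).det) (∑ k, ((M w).updateRow k (M' k)).det) w := by
  have h1 := ((((((h 0 0).mul (h 1 1)).mul (h 2 2)).sub (((h 0 0).mul (h 1 2)).mul (h 2 1))).sub
    (((h 0 1).mul (h 1 0)).mul (h 2 2))).add (((h 0 1).mul (h 1 2)).mul (h 2 0))).add
    (((h 0 2).mul (h 1 0)).mul (h 2 1)) |>.sub (((h 0 2).mul (h 1 1)).mul (h 2 0))
  refine (h1.congr_deriv ?_).congr_of_eventuallyEq (Eventually.of_forall fun t => ?_)
  · simp [Fin.sum_univ_three, Matrix.det_fin_three, Matrix.updateRow_apply]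
    ring
  · simp [Matrix.det_fin_three]

lemma hasDerivAt_dotProduct {u v : ℂ → Fin 3 → ℂ} {u' v' : Fin 3 → ℂ} {w : ℂ}
    (hu : HasDerivAt u u' w) (hv : HasDerivAt v v' w) :
    HasDerivAt (fun t => u t ⬝ᵥ v t) (u' ⬝ᵥ v w + u w ⬝ᵥ v') w := by
  rw [hasDerivAt_pi] at hu hv
  simp only [dotProduct, ← Finset.sum_add_distrib]
  exact HasDerivAt.fun_sum fun k _ => (hu k).mul (hv k)

lemma analyticAt_dotProduct {u v : ℂ → Fin 3 → ℂ} {w : ℂ}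
    (hu : AnalyticAt ℂ u w) (hv : AnalyticAt ℂ v w) :
    AnalyticAt ℂ (fun t => u t ⬝ᵥ v t) w := by
  simp only [dotProduct]
  exact Finset.analyticAt_fun_sum _ fun k _ => (analyticAt_pi_iff.mp hu k).mul
    (analyticAt_pi_iff.mp hv k)

end Determinants

/-! ### The transition matrices of `𝓔` and its filtration. -/

section Triangular

variable {X : Type u} [TopologicalSpace X] [ChartedSpace ℂ X] [T2Space X] [IsManifold 𝓘(ℂ) ω X]
  {S : Finset X} {𝔹 : TwistedForm S (jetBundle S)} {D : LogConnection S (jetBundle S)}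

lemma LocalFrame.G_eq {x : X} (L : LocalFrame 𝔹 D x) (y : X) : L.G y =
    !![1, 0, 0; L.q, (adaptedChartAt S x).eqn y, 0;
      L.r + L.a * (adaptedChartAt S x).eqn y, L.p * (adaptedChartAt S x).eqn y,
      (adaptedChartAt S x).eqn y ^ 2] := frameMat_eq _ _ _ _ _

lemma jetCoeff_chart (φ ψ : AdaptedChart S) {x : X} (hψ : x ∈ ψ.chart.source) :
    jetCoeff φ ψ (ψ.chart x) = (deriv (trans φ ψ) (ψ.chart x))⁻¹ * unitRatio φ ψ x := by
  rw [jetCoeff, ψ.chart.left_inv hψ, lineCoeff, zpow_neg_one, zpow_one]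

variable (L : ∀ x, LocalFrame 𝔹 D x)

/-- Frames and jet transitions are lower triangular, with diagonals `(1, m, m²)` and `(r, r h', r
h'²)`, where `r = m_j / (h' m_i)`. Hence the transition has diagonal `(r, 1, h' m_i / m_j)`, of
product 1. At points of `S` it is the identity. -/
lemma operChange_entries {i j x : X} (hi : x ∈ operBase S i) (hj : x ∈ operBase S j) :
    operChange L i j x 0 1 = 0 ∧ operChange L i j x 0 2 = 0 ∧ operChange L i j x 1 2 = 0 ∧
    operChange L i j x 1 1 = 1 ∧
    operChange L i j x 2 2 = lineCoeff 1 (-1) (adaptedChartAt S i) (adaptedChartAt S j) x ∧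
    (operChange L i j x).det = 1 := by
  by_cases hxS : x ∈ S
  · obtain rfl := eq_of_mem_operBase hi hxS
    obtain rfl := eq_of_mem_operBase hj hxS
    simp [operChange_of_mem L hxS, lineCoeff_self _ _ _ hi.1]
  · have e := G_mul_operChange L hi hj
    have hmi := (adaptedChartAt S i).eqn_ne_zero hi.1 hxS
    have hmj := (adaptedChartAt S j).eqn_ne_zero hj.1 hxS
    have hh := deriv_trans_ne_zero (adaptedChartAt S i) (adaptedChartAt S j) hi.1 hj.1
    have hr := jetCoeff_chart (adaptedChartAt S i) (adaptedChartAt S j) hj.1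
    rw [unitRatio, if_neg hxS] at hr
    rw [(L i).G_eq, (L j).G_eq] at e
    have ent (a b : Fin 3) := congrFun (congrFun e a) b
    simp only [Matrix.mul_apply, Fin.sum_univ_three, jetChange, hr] at ent
    have e00 := ent 0 0
    have e01 := ent 0 1
    have e02 := ent 0 2
    have e11 := ent 1 1
    have e12 := ent 1 2
    have e22 := ent 2 2
    simp at e00 e01 e02 e11 e12 e22
    rw [e01, mul_zero, zero_add] at e11
    rw [e02] at e12
    simp [hmj] at e12
    rw [e02, e12] at e22
    have k11 : operChange L i j x 1 1 = 1 := by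
      have : (adaptedChartAt S j).eqn x * operChange L i j x 1 1 = (adaptedChartAt S j).eqn x := by
        rw [e11]; field_simp
      exact (mul_eq_left₀ hmj).mp this
    have k22 : operChange L i j x 2 2 =
        lineCoeff 1 (-1) (adaptedChartAt S i) (adaptedChartAt S j) x := by
      rw [lineCoeff, unitRatio, if_neg hxS, zpow_one, zpow_neg_one]
      have : (adaptedChartAt S j).eqn x ^ 2 * operChange L i j x 2 2 =
        (adaptedChartAt S j).eqn x ^ 2 * (deriv (trans (adaptedChartAt S i) (adaptedChartAt S j))
          ((adaptedChartAt S j).chart x) * ((adaptedChartAt S j).eqn x /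
            (adaptedChartAt S i).eqn x)⁻¹) := by
        simp only [mul_zero, zero_add] at e22
        rw [e22]; field_simp
      exact mul_left_cancel₀ (pow_ne_zero 2 hmj) this
    refine ⟨e01, e02, e12, k11, k22, ?_⟩
    rw [Matrix.det_fin_three, e01, e02, e12, k11, k22, e00, lineCoeff, unitRatio, if_neg hxS,
      zpow_one, zpow_neg_one]
    field_simp
    ring

/-- The subbundle of `𝓔` corresponding to `F¹`. -/
def operF1 (x : X) : Submodule ℂ ((operBundle L).Fiber x) :=
  (LinearMap.ker (LinearMap.proj 0 : (Fin 3 → ℂ) →ₗ[ℂ] ℂ) ⊓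
    LinearMap.ker (LinearMap.proj 1 : (Fin 3 → ℂ) →ₗ[ℂ] ℂ) : Submodule ℂ (Fin 3 → ℂ))

/-- The subbundle of `𝓔` corresponding to `F²`. -/
def operF2 (x : X) : Submodule ℂ ((operBundle L).Fiber x) :=
  (LinearMap.ker (LinearMap.proj 0 : (Fin 3 → ℂ) →ₗ[ℂ] ℂ) : Submodule ℂ (Fin 3 → ℂ))

lemma mem_operF2_self {x : X} (u : (operBundle L).Fiber x) :
    u ∈ operF2 L x ↔ (show Fin 3 → ℂ from u) 0 = 0 := Iff.rfl

lemma mem_operF1_self {x : X} (u : (operBundle L).Fiber x) : u ∈ operF1 L x ↔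
    (show Fin 3 → ℂ from u) 0 = 0 ∧ (show Fin 3 → ℂ from u) 1 = 0 := Iff.rfl

lemma operChange_mulVec_zero {i j x : X} (hi : x ∈ operBase S i) (hj : x ∈ operBase S j)
    (u : Fin 3 → ℂ) : (operChange L i j x).mulVec u 0 = operChange L i j x 0 0 * u 0 := by
  obtain ⟨h1, h2, -⟩ := operChange_entries L hi hj
  simp [Matrix.mulVec, dotProduct, Fin.sum_univ_three, h1, h2]

lemma operChange_mulVec_one {i j x : X} (hi : x ∈ operBase S i) (hj : x ∈ operBase S j)
    {u : Fin 3 → ℂ} (hu : u 0 = 0) : (operChange L i j x).mulVec u 1 = u 1 := by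
  obtain ⟨-, -, h1, h2, -⟩ := operChange_entries L hi hj
  simp [Matrix.mulVec, dotProduct, Fin.sum_univ_three, h1, h2, hu]

lemma operChange_mulVec_two {i j x : X} (hi : x ∈ operBase S i) (hj : x ∈ operBase S j)
    {u : Fin 3 → ℂ} (hu : u 0 = 0) (hu1 : u 1 = 0) : (operChange L i j x).mulVec u 2 =
      lineCoeff 1 (-1) (adaptedChartAt S i) (adaptedChartAt S j) x * u 2 := by
  obtain ⟨-, -, -, -, h1, -⟩ := operChange_entries L hi hj
  simp [Matrix.mulVec, dotProduct, Fin.sum_univ_three, h1, hu, hu1]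

lemma operChange_zero_zero_ne_zero {i j x : X} (hi : x ∈ operBase S i) (hj : x ∈ operBase S j) :
    operChange L i j x 0 0 ≠ 0 := by
  obtain ⟨h1, h2, h3, h4, -, h5⟩ := operChange_entries L hi hj
  intro h
  rw [Matrix.det_fin_three, h1, h2, h3, h] at h5
  simp at h5

lemma mem_operF2_iff {i x : X} (hi : x ∈ operBase S i) (u : (operBundle L).Fiber x) :
    u ∈ operF2 L x ↔ toFrame (operBundle L) i x u 0 = 0 := by
  have key (u : Fin 3 → ℂ) : u 0 = 0 ↔ (operChange L x i x).mulVec u 0 = 0 := by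
    rw [operChange_mulVec_zero L (mem_operBase_self x) hi]
    simp [operChange_zero_zero_ne_zero L (mem_operBase_self x) hi]
  exact key u

lemma mem_operF1_iff {i x : X} (hi : x ∈ operBase S i) (u : (operBundle L).Fiber x) :
    u ∈ operF1 L x ↔ toFrame (operBundle L) i x u 0 = 0 ∧ toFrame (operBundle L) i x u 1 = 0 := by
  have key (u : Fin 3 → ℂ) (hu : u 0 = 0) : u 1 = 0 ↔ (operChange L x i x).mulVec u 1 = 0 := by
    rw [operChange_mulVec_one L (mem_operBase_self x) hi hu]
  rw [← mem_operF2_iff L hi, mem_operF1_self, mem_operF2_self]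
  exact and_congr_right fun h0 => key u h0

lemma toFrame_one_of_mem_operF2 {i x : X} (hi : x ∈ operBase S i) {u : (operBundle L).Fiber x}
    (hu : u ∈ operF2 L x) :
    toFrame (operBundle L) i x u 1 = (show Fin 3 → ℂ from u) 1 :=
  operChange_mulVec_one L (mem_operBase_self x) hi hu

lemma isHolSubbundle_of_frame {r : ℕ} {A : ∀ x, Submodule ℂ ((operBundle L).Fiber x)}
    (idx : Fin r → Fin 3) (hidx : Function.Injective idx)
    (hA : ∀ {i x : X}, x ∈ operBase S i → ∀ u, u ∈ A x ↔
      ∀ k, k ∉ Set.range idx → toFrame (operBundle L) i x u k = 0) :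
    IsHolSubbundle (operBundle L) r A := by
  intro i
  refine ⟨operBase S i, isOpen_operBase i, mem_operBase_self i,
    fun k y => ofFrame (operBundle L) i y (Pi.single (idx k) 1), fun k => ?_, fun y hy => ⟨?_, ?_⟩⟩
  · exact holOn_ofFrame (Z := operBundle L) (isOpen_operBase i) Subset.rfl
      fun _ _ => mdifferentiableAt_const.mdifferentiableWithinAt
  · have h1 : LinearIndependent ℂ (fun k : Fin r => (Pi.single (idx k) 1 : Fin 3 → ℂ)) := by
      have := (Pi.basisFun ℂ (Fin 3)).linearIndependent.comp idx hidx
      simpa [Function.comp_def] using this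
    refine LinearIndependent.of_comp (toFrame (operBundle L) i y).toLinearMap ?_
    have e : (toFrame (operBundle L) i y).toLinearMap ∘
        (fun k => ofFrame (operBundle L) i y (Pi.single (idx k) 1)) =
        fun k : Fin r => (Pi.single (idx k) 1 : Fin 3 → ℂ) :=
      funext fun k => toFrame_ofFrame (Z := operBundle L) hy _
    rwa [e]
  · apply le_antisymm
    · rw [Submodule.span_le]
      rintro - ⟨k, rfl⟩
      rw [SetLike.mem_coe, hA hy]
      intro l hl
      rw [toFrame_ofFrame (Z := operBundle L) hy]
      exact Pi.single_eq_of_ne (fun e => hl ⟨k, e.symm⟩) _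
    · intro u hu
      rw [hA hy] at hu
      have e : u = ∑ l, toFrame (operBundle L) i y u l •
          ofFrame (operBundle L) i y (Pi.single l 1) := by
        conv_lhs => rw [← ofFrame_toFrame (Z := operBundle L) hy u,
          pi_eq_sum_univ' (toFrame (operBundle L) i y u), map_sum]
        refine Finset.sum_congr rfl fun l _ => ?_
        rw [map_smul]
      rw [e]
      refine Submodule.sum_mem _ fun l _ => ?_
      by_cases hl : l ∈ Set.range idx
      · obtain ⟨k, rfl⟩ := hl
        exact Submodule.smul_mem _ _ (Submodule.subset_span ⟨k, rfl⟩)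
      · rw [hu l hl, zero_smul]
        exact Submodule.zero_mem _

end Triangular

/-! ### The Gram matrix and the discriminant. -/

section Gram

variable {X : Type u} [TopologicalSpace X] [ChartedSpace ℂ X] [T2Space X] [IsManifold 𝓘(ℂ) ω X]
  {S : Finset X} {𝔹 : TwistedForm S (jetBundle S)} {D : LogConnection S (jetBundle S)}

lemma LocalFrame.H_entries {x : X} (L : LocalFrame 𝔹 D x) (h : AdmissiblePair 𝔹 D) :
    L.H ((adaptedChartAt S x).chart x) 1 2 = 0 ∧ L.H ((adaptedChartAt S x).chart x) 2 2 = 0 := by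
  have hx := mem_adaptedChartAt S x
  have key : ∀ᶠ w in 𝓝[≠] ((adaptedChartAt S x).chart x), L.H w 1 2 = 0 ∧ L.H w 2 2 = 0 := by
    filter_upwards [L.H_eq, (eventually_mem _ _ hx hx).filter_mono nhdsWithin_le_nhds] with w hH hw
    have h1 := formMat_one_two h hw.2.1
    have h2 := formMat_two_two h hw.2.1
    have h3 : formMat 𝔹 (adaptedChartAt S x) ((adaptedChartAt S x).chart.symm w) 2 1 = 0 := by
      rw [← formMat_transpose]; exact h1
    constructor <;>
    · rw [hH]
      simp [frameMat_eq, Matrix.mul_apply, Fin.sum_univ_three, h1, h2, h3]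
  exact ⟨eq_of_eventuallyEq_punctured (L.anH 1 2).continuousAt continuousAt_const
    (key.mono fun w hw => hw.1), eq_of_eventuallyEq_punctured (L.anH 2 2).continuousAt
      continuousAt_const (key.mono fun w hw => hw.2)⟩

lemma LocalFrame.H_zero_two_ne_zero {x : X} (L : LocalFrame 𝔹 D x) (h : AdmissiblePair 𝔹 D) :
    L.H ((adaptedChartAt S x).chart x) 0 2 ≠ 0 := by
  obtain ⟨h1, h2⟩ := L.H_entries h
  intro h0
  apply L.det_H
  apply Matrix.det_eq_zero_of_column_eq_zero 2
  intro i
  fin_cases i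
  · exact h0
  · exact h1
  · exact h2

lemma discr_eq_det (x : X) : discr 𝔹 x = (formMat 𝔹 (adaptedChartAt S x) x).det := by
  rw [discr]
  congr 1
  ext a b
  simp only [formMat, Matrix.of_apply, basisSec]
  have e (k : Fin 3) : ofFrame (jetBundle S) (adaptedChartAt S x) x (Pi.single k 1) =
      (Pi.single k 1 : Fin 3 → ℂ) := ofFrame_indexAt (Z := jetBundle S) x _
  rw [e, e]
  exact (toFrame_indexAt (Z := lineBundle S 0 2) x _).symm

lemma discr_ne_zero (x : X) : discr 𝔹 x ≠ 0 := by
  rw [discr_eq_det]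
  exact formMat_det_ne_zero 𝔹 (mem_adaptedChartAt S x)

variable (L : ∀ x, LocalFrame 𝔹 D x)

lemma discr_eq_det_H (x : X) :
    discr 𝔹 x = ((L x).H ((adaptedChartAt S x).chart x)).det := by
  rw [discr_eq_det, (L x).det_H_eq]

/-- The Gram matrices in the frames at `x` and at `i` are congruent by a transition matrix of
determinant 1. -/
lemma discr_eq_nhds (i : X) : ∀ᶠ x in 𝓝 i,
    discr 𝔹 x = ((L i).H ((adaptedChartAt S i).chart x)).det := by
  filter_upwards [operForm_eq_nhds L i, (isOpen_operBase i).mem_nhds (mem_operBase_self i)]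
    with x hx (hi : x ∈ operBase S i)
  have e : (L x).H ((adaptedChartAt S x).chart x) = (operChange L x i x).transpose *
      (L i).H ((adaptedChartAt S i).chart x) * operChange L x i x := by
    ext a b
    have h1 : (Pi.single a 1 : Fin 3 → ℂ) ⬝ᵥ
        ((L x).H ((adaptedChartAt S x).chart x)).mulVec (Pi.single b 1) =
        (operChange L x i x).mulVec (Pi.single a 1) ⬝ᵥ
          ((L i).H ((adaptedChartAt S i).chart x)).mulVec
            ((operChange L x i x).mulVec (Pi.single b 1)) :=
      (Matrix.toLinearMap₂'_apply' _ _ _).symm.trans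
        (hx (Pi.single a 1 : Fin 3 → ℂ) (Pi.single b 1 : Fin 3 → ℂ))
    rw [Matrix.mulVec_mulVec, ← Matrix.vecMul_transpose (operChange L x i x), ← Matrix.dotProduct_mulVec,
      Matrix.mulVec_mulVec, ← Matrix.mul_assoc] at h1
    simpa using h1
  rw [discr_eq_det_H L, e, Matrix.det_mul, Matrix.det_mul, Matrix.det_transpose,
    (operChange_entries L (mem_operBase_self x) hi).2.2.2.2.2]
  ring

lemma discr_hasDerivAt (h : AdmissiblePair 𝔹 D) (x : X) :
    HasDerivAt (fun w => discr 𝔹 ((adaptedChartAt S x).chart.symm w))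
      (2 * ((L x).C ((adaptedChartAt S x).chart x)).trace * discr 𝔹 x)
      ((adaptedChartAt S x).chart x) := by
  have h1 := det_hasDerivAt ((L x).H_parallel h)
  rw [← discr_eq_det_H L] at h1
  refine h1.congr_of_eventuallyEq ?_
  filter_upwards [eventually_symm _ (mem_adaptedChartAt S x) (discr_eq_nhds L x),
    eventually_right_inv _ (mem_adaptedChartAt S x)] with w hw hw'
  rw [hw, hw']

lemma mdifferentiable_discr (L : ∀ x, LocalFrame 𝔹 D x) (h : AdmissiblePair 𝔹 D) :
    MDifferentiable 𝓘(ℂ) 𝓘(ℂ) (discr 𝔹) := fun x =>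
  (mdifferentiableAt_iff_coord _ (mem_adaptedChartAt S x)).mpr
    (discr_hasDerivAt L h x).differentiableAt

/-- The derivative of a square root of the discriminant. -/
lemma sqrt_discr_hasDerivAt (h : AdmissiblePair 𝔹 D) {g : X → ℂ}
    (hg : MDifferentiable 𝓘(ℂ) 𝓘(ℂ) g) (hg2 : ∀ x, g x ^ 2 = discr 𝔹 x) (x : X) :
    HasDerivAt (fun w => g ((adaptedChartAt S x).chart.symm w))
      (((L x).C ((adaptedChartAt S x).chart x)).trace * g x) ((adaptedChartAt S x).chart x) := by
  have hx := mem_adaptedChartAt S x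
  have h1 := ((mdifferentiableAt_iff_coord _ hx).mp (hg x)).hasDerivAt
  have h2 := h1.pow 2
  have e : (fun w => discr 𝔹 ((adaptedChartAt S x).chart.symm w)) =
      fun w => g ((adaptedChartAt S x).chart.symm w) ^ 2 := funext fun w => (hg2 _).symm
  have h3 := discr_hasDerivAt L h x
  rw [e] at h3
  have h4 := h2.unique h3
  have g0 : g x ≠ 0 := fun h0 => discr_ne_zero (𝔹 := 𝔹) x (by rw [← hg2, h0]; simp)
  rw [(adaptedChartAt S x).chart.left_inv hx, ← hg2] at h4
  refine h1.congr_deriv ?_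
  have : (2 * g x) * deriv (fun w => g ((adaptedChartAt S x).chart.symm w))
      ((adaptedChartAt S x).chart x) =
      (2 * g x) * (((L x).C ((adaptedChartAt S x).chart x)).trace * g x) := by
    simp at h4
    linear_combination h4
  exact mul_left_cancel₀ (mul_ne_zero two_ne_zero g0) this

end Gram

/-! ### Second fundamental form, volume form and compatibility with the connection. -/

section OperStructure

variable {X : Type u} [TopologicalSpace X] [ChartedSpace ℂ X] [T2Space X] [IsManifold 𝓘(ℂ) ω X]
  {S : Finset X} {𝔹 : TwistedForm S (jetBundle S)} {D : LogConnection S (jetBundle S)}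
  (L : ∀ x, LocalFrame 𝔹 D x)

/-- A section of `F¹` has identically zero coordinates 0 and 1, so in these rows its derivative
comes only from the last column of the connection matrix. -/
lemma cov_entries_of_mem_operF1 {i x : X} (hi : x ∈ operBase S i) {U : Set X} (hU : IsOpen U)
    (hxU : x ∈ U) {σ : ∀ x, (operBundle L).Fiber x} (hσ : HolOn (operBundle L) U σ)
    (hσF : ∀ y ∈ U, σ y ∈ operF1 L y) {C₀ : Mat3} (hC : C₀ 0 2 = 0) :
    (cderiv (adaptedChartAt S i) (fun y => toFrame (operBundle L) i y (σ y)) x +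
      C₀.mulVec (toFrame (operBundle L) i x (σ x))) 0 = 0 ∧
    (cderiv (adaptedChartAt S i) (fun y => toFrame (operBundle L) i y (σ y)) x +
      C₀.mulVec (toFrame (operBundle L) i x (σ x))) 1 =
        C₀ 1 2 * toFrame (operBundle L) i x (σ x) 2 := by
  have hs := hσ.analyticAt hU hxU (i := i) hi (adaptedChartAt S i) hi.1
  have hz : ∀ᶠ w in 𝓝 ((adaptedChartAt S i).chart x),
      toFrame (operBundle L) i ((adaptedChartAt S i).chart.symm w)
        (σ ((adaptedChartAt S i).chart.symm w)) 0 = 0 ∧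
      toFrame (operBundle L) i ((adaptedChartAt S i).chart.symm w)
        (σ ((adaptedChartAt S i).chart.symm w)) 1 = 0 := by
    filter_upwards [eventually_symm _ hi.1 ((isOpen_operBase i).mem_nhds hi),
      eventually_symm _ hi.1 (hU.mem_nhds hxU)] with w hw hwU
    exact (mem_operF1_iff L hw _).mp (hσF _ hwU)
  have hx := (mem_operF1_iff L hi _).mp (hσF x hxU)
  have d0 : cderiv (adaptedChartAt S i) (fun y => toFrame (operBundle L) i y (σ y)) x 0 = 0 := by
    rw [cderiv, deriv_apply_eq hs]
    exact (EventuallyEq.deriv_eq (f := fun _ => 0) (hz.mono fun w hw => hw.1)).trans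
      (deriv_const _ _)
  have d1 : cderiv (adaptedChartAt S i) (fun y => toFrame (operBundle L) i y (σ y)) x 1 = 0 := by
    rw [cderiv, deriv_apply_eq hs]
    exact (EventuallyEq.deriv_eq (f := fun _ => 0) (hz.mono fun w hw => hw.2)).trans
      (deriv_const _ _)
  simp [Matrix.mulVec, dotProduct, Fin.sum_univ_three, d0, d1, hx.1, hx.2, hC]

/-- The second fundamental form of `F¹` in `𝓔`, divided by the local equation of `S`. -/
lemma exists_operSecondForm (h : AdmissiblePair 𝔹 D) : ∃ s : X → ℂ, (∀ x, s x ≠ 0) ∧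
    MDifferentiable 𝓘(ℂ) 𝓘(ℂ) s ∧ ∀ x, (L x).C ((adaptedChartAt S x).chart x) 1 2 =
      (adaptedChartAt S x).eqn x * s x := by
  choose α hα hα0 hA using fun x : X => exists_connMat_one_two h (mem_adaptedChartAt S x)
  have hC (x : X) : (L x).C ((adaptedChartAt S x).chart x) 1 2 =
      (adaptedChartAt S x).eqn x * α x ((adaptedChartAt S x).chart x) := by
    have hx := mem_adaptedChartAt S x
    have := (hA x).self_of_nhds
    rw [eqnC_chart _ hx, (adaptedChartAt S x).chart.left_inv hx] at this
    rw [((L x).C_zero_two h).2, this]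
  refine ⟨fun x => α x ((adaptedChartAt S x).chart x), hα0, fun i => ?_, hC⟩
  have hi' := mem_adaptedChartAt S i
  have hC' := (L i).eventually_C_zero_two h
  rw [eventually_nhdsWithin_iff] at hC'
  -- The local factors agree: the last vector of the frame at `i` is differentiated in the frames at
  -- `i` and at `x`, and coordinate 1 on `F²` is the same in both. The change of `dz` and the
  -- cocycle of `K_X(-S)` then cancel the ratio of the local equations.
  have key : ∀ᶠ x in 𝓝 i, α x ((adaptedChartAt S x).chart x) =
      α i ((adaptedChartAt S i).chart x) := by
    filter_upwards [eventually_chart _ hi' hC', eventually_chart _ hi' (hA i),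
      toFrame_operCov L i, eventually_nhds_notMem S i,
      (isOpen_operBase i).mem_nhds (mem_operBase_self i)]
      with x h1 h2 h3 h4 (hi : x ∈ operBase S i)
    by_cases hne : x = i
    · rw [hne]
    have hxS := h4 hne
    have hx := mem_adaptedChartAt S x
    obtain ⟨c02, c12⟩ := h1 fun e => hne ((adaptedChartAt S i).chart.injOn hi.1 hi' e)
    rw [h2, eqnC_chart _ hi.1] at c12
    obtain ⟨v, hv⟩ := exists_mvfderiv_chart_eq_one (adaptedChartAt S x) hx
    have hσ : HolOn (operBundle L) (operBase S i)
        (fun y => ofFrame (operBundle L) i y (Pi.single 2 1)) :=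
      holOn_ofFrame (Z := operBundle L) (isOpen_operBase i) Subset.rfl
        fun _ _ => mdifferentiableAt_const.mdifferentiableWithinAt
    have hσF : ∀ y ∈ operBase S i, ofFrame (operBundle L) i y (Pi.single 2 1) ∈ operF1 L y := by
      intro y hy
      rw [mem_operF1_iff L hy, toFrame_ofFrame (Z := operBundle L) hy]
      simp
    have e1 := h3 _ (isOpen_operBase i) hi _ hσ v
    obtain ⟨-, f1⟩ := cov_entries_of_mem_operF1 L hi (isOpen_operBase i) hi hσ hσF c02
    have e2 := operCov_apply L (fun y => ofFrame (operBundle L) i y (Pi.single 2 1)) x v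
    obtain ⟨g0, g1⟩ := cov_entries_of_mem_operF1 L (mem_operBase_self x) (isOpen_operBase i) hi
      hσ hσF ((L x).C_zero_two h).1
    have hF2 : operCov L (fun y => ofFrame (operBundle L) i y (Pi.single 2 1)) x v ∈
        operF2 L x := by
      rw [mem_operF2_iff L (mem_operBase_self x), e2, Pi.smul_apply, g0, smul_zero]
    have e3 := congrFun e1 1
    rw [toFrame_one_of_mem_operF2 L hi hF2, ← toFrame_one_of_mem_operF2 L (mem_operBase_self x) hF2,
      e2, Pi.smul_apply, Pi.smul_apply, f1, g1, hv,
      mvfderiv_eq_cderiv _ hx (mdifferentiableAt_chart _ hi.1), hv, c12, hC,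
      toFrame_ofFrame (Z := operBundle L) hi,
      ← coordChange_toFrame (Z := operBundle L) hi (mem_operBase_self x),
      toFrame_ofFrame (Z := operBundle L) hi] at e3
    have e4 : (operBundle L).coordChange i x x (Pi.single 2 1) 2 = lineCoeff 1 (-1)
        (adaptedChartAt S i) (adaptedChartAt S x) x := by
      refine (operChange_mulVec_two L hi (mem_operBase_self x) ?_ ?_).trans ?_ <;> simp
    have e5 : cderiv (adaptedChartAt S x) (adaptedChartAt S i).chart x =
      deriv (trans (adaptedChartAt S i) (adaptedChartAt S x)) ((adaptedChartAt S x).chart x) := rfl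
    have hmi := (adaptedChartAt S i).eqn_ne_zero hi.1 hxS
    have hmx := (adaptedChartAt S x).eqn_ne_zero hx hxS
    have hh := deriv_trans_ne_zero (adaptedChartAt S i) (adaptedChartAt S x) hi.1 hx
    rw [e4, e5, lineCoeff, unitRatio, if_neg hxS, zpow_one, zpow_neg_one] at e3
    simp at e3
    field_simp at e3
    exact e3
  refine (mdifferentiableAt_iff_coord _ hi').mpr ?_
  refine (hα i).differentiableAt.congr_of_eventuallyEq ?_
  filter_upwards [eventually_symm _ hi' key, eventually_right_inv _ hi'] with w hw hw'
  rw [hw, hw']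

/-- The alternating form `g · det`. -/
def operVol (g : X → ℂ) (x : X) : (operBundle L).Fiber x [⋀^Fin 3]→ₗ[ℂ] ℂ :=
  g x • (Matrix.detRowAlternating : (Fin 3 → ℂ) [⋀^Fin 3]→ₗ[ℂ] ℂ)

variable (g : X → ℂ)

lemma operVol_apply {i x : X} (hi : x ∈ operBase S i) (u : Fin 3 → (operBundle L).Fiber x) :
    operVol L g x u = g x * (Matrix.of fun k => toFrame (operBundle L) i x (u k)).det := by
  have key (u : Fin 3 → Fin 3 → ℂ) :
      (Matrix.of fun k => (operChange L x i x).mulVec (u k)).det = (Matrix.of u).det := by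
    have e : (Matrix.of fun k => (operChange L x i x).mulVec (u k)) =
        Matrix.of u * (operChange L x i x).transpose := by
      ext a b
      simp [Matrix.mul_apply, Matrix.mulVec, dotProduct, mul_comm]
    rw [e, Matrix.det_mul, Matrix.det_transpose,
      (operChange_entries L (mem_operBase_self x) hi).2.2.2.2.2, mul_one]
  exact congrArg (g x * ·) (key u).symm

lemma analyticM_toFrame {i x : X} (hi : x ∈ operBase S i) {U : Set X} (hU : IsOpen U)
    (hxU : x ∈ U) {σ : Fin 3 → ∀ x, (operBundle L).Fiber x}
    (hσ : ∀ k, HolOn (operBundle L) U (σ k)) :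
    AnalyticM (fun w => Matrix.of fun k => toFrame (operBundle L) i
      ((adaptedChartAt S i).chart.symm w) (σ k ((adaptedChartAt S i).chart.symm w)))
      ((adaptedChartAt S i).chart x) := fun k l =>
  analyticAt_apply ((hσ k).analyticAt hU hxU (i := i) hi (adaptedChartAt S i) hi.1) l

lemma operVol_hol (hg : MDifferentiable 𝓘(ℂ) 𝓘(ℂ) g) {U : Set X} (hU : IsOpen U)
    {σ : Fin 3 → ∀ x, (operBundle L).Fiber x} (hσ : ∀ k, HolOn (operBundle L) U (σ k)) :
    MDifferentiableOn 𝓘(ℂ) 𝓘(ℂ) (fun x => operVol L g x fun k => σ k x) U := by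
  refine mdifferentiableOn_of_analyticAt fun x hx => ⟨S, adaptedChartAt S x,
    mem_adaptedChartAt S x, ?_⟩
  have hx' := mem_adaptedChartAt S x
  have h1 := analyticAt_coord_of_forall (adaptedChartAt S x) hx' hU hx hg.mdifferentiableOn
  refine (h1.mul (analyticM_toFrame L (mem_operBase_self x) hU hx hσ).det).congr ?_
  filter_upwards [eventually_symm _ hx' ((isOpen_operBase x).mem_nhds (mem_operBase_self x))]
    with w hw
  exact (operVol_apply L g hw _).symm

lemma operVol_ne_zero {x : X} (hg : g x ≠ 0) : operVol L g x ≠ 0 := by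
  intro h
  have h1 := congrArg (fun f => f (fun k => (Pi.single k 1 : Fin 3 → ℂ))) h
  have h2 : g x * (1 : Mat3).det = 0 := by
    refine Eq.trans ?_ h1
    have : (1 : Mat3) = fun k => (Pi.single k 1 : Fin 3 → ℂ) := by
      ext a b
      simp [Matrix.one_apply, Pi.single_apply, eq_comm]
    rw [this]
    rfl
  simp [hg] at h2

lemma operVol_form (hg2 : ∀ x, g x ^ 2 = discr 𝔹 x) (x : X)
    (u w : Fin 3 → (operBundle L).Fiber x) :
    (Matrix.of fun a b => operForm L x (u a) (w b)).det = operVol L g x u * operVol L g x w := by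
  rw [operVol_apply L g (mem_operBase_self x), operVol_apply L g (mem_operBase_self x)]
  have e : (Matrix.of fun a b => operForm L x (u a) (w b)) =
      (Matrix.of fun k => toFrame (operBundle L) x x (u k)) *
        (L x).H ((adaptedChartAt S x).chart x) *
        (Matrix.of fun k => toFrame (operBundle L) x x (w k)).transpose := by
    ext a b
    rw [Matrix.of_apply, operForm_apply, Matrix.mul_assoc]
    simp [Matrix.mul_apply, Matrix.mulVec, dotProduct]
  rw [e, Matrix.det_mul, Matrix.det_mul, Matrix.det_transpose, ← discr_eq_det_H, ← hg2]
  ring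

/-- The connection matrix changes the determinant by its trace, and `g' = (tr C) g` is exactly the
derivative that compensates it. -/
lemma operVol_conn (h : AdmissiblePair 𝔹 D) (hg : MDifferentiable 𝓘(ℂ) 𝓘(ℂ) g)
    (hg2 : ∀ x, g x ^ 2 = discr 𝔹 x) {U : Set X} (hU : IsOpen U)
    {σ : Fin 3 → ∀ x, (operBundle L).Fiber x} (hσ : ∀ k, HolOn (operBundle L) U (σ k))
    {x : X} (hx : x ∈ U) (v : TangentSpace 𝓘(ℂ) x) :
    mvfderiv 𝓘(ℂ) (fun y => operVol L g y fun k => σ k y) x v =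
      ∑ k, operVol L g x (Function.update (fun l => σ l x) k (operCov L (σ k) x v)) := by
  have hx' := mem_adaptedChartAt S x
  rw [mvfderiv_eq_cderiv _ hx' ((operVol_hol L g hg hU hσ x hx).mdifferentiableAt
    (hU.mem_nhds hx))]
  have hM := analyticM_toFrame L (mem_operBase_self x) hU hx hσ
  have hd := (sqrt_discr_hasDerivAt L h hg hg2 x).mul hM.hasDerivM.det_updateRow
  set M : Mat3 := Matrix.of fun k => toFrame (operBundle L) x x (σ k x) with hMdef
  have e1 : cderiv (adaptedChartAt S x) (fun y => operVol L g y fun k => σ k y) x =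
      ((L x).C ((adaptedChartAt S x).chart x)).trace * g x * M.det +
      g x * ∑ k, (M.updateRow k (cderiv (adaptedChartAt S x)
        (fun y => toFrame (operBundle L) x y (σ k y)) x)).det := by
    have e : (fun w => operVol L g ((adaptedChartAt S x).chart.symm w)
        fun k => σ k ((adaptedChartAt S x).chart.symm w)) =ᶠ[𝓝 ((adaptedChartAt S x).chart x)]
        (fun w => g ((adaptedChartAt S x).chart.symm w)) * fun w =>
          (Matrix.of fun k => toFrame (operBundle L) x ((adaptedChartAt S x).chart.symm w)
          (σ k ((adaptedChartAt S x).chart.symm w))).det := by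
      filter_upwards [eventually_symm _ hx' ((isOpen_operBase x).mem_nhds (mem_operBase_self x))]
        with w hw
      exact operVol_apply L g hw _
    rw [cderiv, e.deriv_eq, hd.deriv]
    rw [(adaptedChartAt S x).chart.left_inv hx']
    have e2 (k : Fin 3) : derivM (fun w => Matrix.of fun k => toFrame (operBundle L) x
        ((adaptedChartAt S x).chart.symm w) (σ k ((adaptedChartAt S x).chart.symm w)))
        ((adaptedChartAt S x).chart x) k = cderiv (adaptedChartAt S x)
        (fun y => toFrame (operBundle L) x y (σ k y)) x := by
      ext l
      exact (deriv_apply_eq ((hσ k).analyticAt hU hx (i := x) (mem_operBase_self x)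
        (adaptedChartAt S x) hx') l).symm
    simp only [e2]
    rfl
  have e3 (k : Fin 3) : operVol L g x (Function.update (fun l => σ l x) k (operCov L (σ k) x v)) =
      mvfderiv 𝓘(ℂ) (adaptedChartAt S x).chart x v * (g x *
        ((M.updateRow k (cderiv (adaptedChartAt S x)
          (fun y => toFrame (operBundle L) x y (σ k y)) x)).det +
        (M.updateRow k (((L x).C ((adaptedChartAt S x).chart x)).mulVec (M k))).det)) := by
    rw [operVol_apply L g (mem_operBase_self x)]
    have : (Matrix.of fun l => toFrame (operBundle L) x x
        (Function.update (fun l => σ l x) k (operCov L (σ k) x v) l)) =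
        M.updateRow k (mvfderiv 𝓘(ℂ) (adaptedChartAt S x).chart x v •
          (cderiv (adaptedChartAt S x) (fun y => toFrame (operBundle L) x y (σ k y)) x +
          ((L x).C ((adaptedChartAt S x).chart x)).mulVec (M k))) := by
      have hc : mvfderiv 𝓘(ℂ) (adaptedChartAt S x).chart x v •
          (cderiv (adaptedChartAt S x) (fun y => toFrame (operBundle L) x y (σ k y)) x +
          ((L x).C ((adaptedChartAt S x).chart x)).mulVec (M k)) =
          toFrame (operBundle L) x x (operCov L (σ k) x v) := (operCov_apply L (σ k) x v).symm
      rw [hc]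
      ext a b
      by_cases hak : a = k
      · subst hak
        simp [M]
      · simp [hak, M]
    rw [this, Matrix.det_updateRow_smul, Matrix.det_updateRow_add]
    ring
  rw [e1, Finset.sum_congr rfl fun k _ => e3 k, ← Finset.mul_sum, ← Finset.mul_sum,
    Finset.sum_add_distrib, sum_det_updateRow, smul_eq_mul]
  ring

lemma operForm_symm (x : X) (u w : (operBundle L).Fiber x) :
    operForm L x u w = operForm L x w u := by
  rw [operForm_apply, operForm_apply, dotProduct_comm, ← Matrix.vecMul_transpose, (L x).H_symm,
    ← Matrix.dotProduct_mulVec]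

lemma operForm_hol {U : Set X} (hU : IsOpen U) {σ τ : ∀ x, (operBundle L).Fiber x}
    (hσ : HolOn (operBundle L) U σ) (hτ : HolOn (operBundle L) U τ) :
    MDifferentiableOn 𝓘(ℂ) 𝓘(ℂ) (fun x => operForm L x (σ x) (τ x)) U := by
  refine mdifferentiableOn_of_analyticAt fun x hx => ⟨S, adaptedChartAt S x,
    mem_adaptedChartAt S x, ?_⟩
  have hx' := mem_adaptedChartAt S x
  have h1 := hσ.analyticAt hU hx (i := x) (mem_operBase_self x) (adaptedChartAt S x) hx'
  have h2 := hτ.analyticAt hU hx (i := x) (mem_operBase_self x) (adaptedChartAt S x) hx'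
  refine (analyticAt_dotProduct h1 ((L x).anH.mulVec h2)).congr ?_
  filter_upwards [eventually_symm _ hx' (operForm_eq_nhds L x), eventually_right_inv _ hx']
    with w hw hw'
  rw [hw, hw']

lemma operForm_nondeg (x : X) (u : (operBundle L).Fiber x) (hu : ∀ w, operForm L x u w = 0) :
    u = 0 := by
  have key (u : Fin 3 → ℂ) (hu : ∀ w : Fin 3 → ℂ,
      u ⬝ᵥ ((L x).H ((adaptedChartAt S x).chart x)).mulVec w = 0) : u = 0 := by
    refine Matrix.eq_zero_of_vecMul_eq_zero (L x).det_H ?_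
    refine dotProduct_eq_zero _ fun w => ?_
    rw [← Matrix.dotProduct_mulVec]
    exact hu w
  exact key u fun w => (Matrix.toLinearMap₂'_apply' _ _ _).symm.trans (hu w)

lemma operForm_conn (h : AdmissiblePair 𝔹 D) {U : Set X} (hU : IsOpen U)
    {σ τ : ∀ x, (operBundle L).Fiber x}
    (hσ : HolOn (operBundle L) U σ) (hτ : HolOn (operBundle L) U τ) {x : X} (hx : x ∈ U)
    (v : TangentSpace 𝓘(ℂ) x) :
    mvfderiv 𝓘(ℂ) (fun y => operForm L y (σ y) (τ y)) x v =
      operForm L x (operCov L σ x v) (τ x) + operForm L x (σ x) (operCov L τ x v) := by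
  have hx' := mem_adaptedChartAt S x
  rw [mvfderiv_eq_cderiv _ hx' ((operForm_hol L hU hσ hτ x hx).mdifferentiableAt
    (hU.mem_nhds hx))]
  have h1 := hσ.analyticAt hU hx (i := x) (mem_operBase_self x) (adaptedChartAt S x) hx'
  have h2 := hτ.analyticAt hU hx (i := x) (mem_operBase_self x) (adaptedChartAt S x) hx'
  have hd := hasDerivAt_dotProduct h1.differentiableAt.hasDerivAt
    (((L x).H_parallel h).mulVec h2.differentiableAt.hasDerivAt)
  have e : (fun w => operForm L ((adaptedChartAt S x).chart.symm w)
      (σ ((adaptedChartAt S x).chart.symm w)) (τ ((adaptedChartAt S x).chart.symm w)))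
      =ᶠ[𝓝 ((adaptedChartAt S x).chart x)] fun w =>
        toFrame (operBundle L) x ((adaptedChartAt S x).chart.symm w)
          (σ ((adaptedChartAt S x).chart.symm w)) ⬝ᵥ ((L x).H w).mulVec
          (toFrame (operBundle L) x ((adaptedChartAt S x).chart.symm w)
          (τ ((adaptedChartAt S x).chart.symm w))) := by
    filter_upwards [eventually_symm _ hx' (operForm_eq_nhds L x), eventually_right_inv _ hx']
      with w hw hw'
    rw [hw, hw']
  rw [cderiv, e.deriv_eq, hd.deriv, operForm_apply, operForm_apply, operCov_apply, operCov_apply,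
    (adaptedChartAt S x).chart.left_inv hx']
  -- The product rule with `H' = Cᵀ H + H C` regroups into the two covariant derivatives.
  have key (d : ℂ) (s s' t t' : Fin 3 → ℂ) (H C : Mat3) :
      d • (s' ⬝ᵥ H.mulVec t + s ⬝ᵥ ((C.transpose * H + H * C).mulVec t + H.mulVec t')) =
      (d • (s' + C.mulVec s)) ⬝ᵥ H.mulVec t + s ⬝ᵥ H.mulVec (d • (t' + C.mulVec t)) := by
    have : C.mulVec s ⬝ᵥ H.mulVec t = s ⬝ᵥ (C.transpose * H).mulVec t := by
      rw [← Matrix.vecMul_transpose C, ← Matrix.dotProduct_mulVec, Matrix.mulVec_mulVec]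
    rw [Matrix.mulVec_smul, dotProduct_smul, smul_dotProduct, add_dotProduct, this,
      Matrix.mulVec_add, Matrix.add_mulVec, Matrix.mulVec_mulVec, dotProduct_add, dotProduct_add,
      dotProduct_add]
    simp only [smul_eq_mul]
    ring
  exact key _ _ _ _ _ _ _

lemma operForm_of_mem_operF1 (h : AdmissiblePair 𝔹 D) {x : X} {u : (operBundle L).Fiber x}
    (hu : u ∈ operF1 L x) (w : (operBundle L).Fiber x) :
    operForm L x u w = toFrame (operBundle L) x x u 2 *
      ((L x).H ((adaptedChartAt S x).chart x) 0 2 * toFrame (operBundle L) x x w 0) := by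
  obtain ⟨h12, h22⟩ := (L x).H_entries h
  have hs (a b : Fin 3) := congrFun (congrFun (L x).H_symm a) b
  simp only [Matrix.transpose_apply] at hs
  obtain ⟨u0, u1⟩ := (mem_operF1_iff L (mem_operBase_self x) u).mp hu
  rw [operForm_apply]
  simp [Matrix.mulVec, dotProduct, Fin.sum_univ_three, u0, u1, hs 1 2, hs 0 2, h12, h22]

end OperStructure

/-! ### The branched oper on `𝓔` and its identification with the sheaf. -/

section Oper

variable {X : Type u} [TopologicalSpace X] [ChartedSpace ℂ X] [T2Space X] [IsManifold 𝓘(ℂ) ω X]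
  {S : Finset X} {𝔹 : TwistedForm S (jetBundle S)} {D : LogConnection S (jetBundle S)}
  (L : ∀ x, LocalFrame 𝔹 D x)

/-- The isomorphism of `K_X ⊗ O_X(-S)` with `F¹`. -/
def operIso₁ (x : X) : (lineBundle S 1 (-1)).Fiber x ≃ₗ[ℂ] operF1 L x where
  toFun c := ⟨ofFrame (operBundle L) x x
      (Pi.single 2 (toFrame (lineBundle S 1 (-1)) (adaptedChartAt S x) x c)), by
    rw [mem_operF1_iff L (mem_operBase_self x),
      toFrame_ofFrame (Z := operBundle L) (mem_operBase_self x)]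
    simp⟩
  invFun u := ofFrame (lineBundle S 1 (-1)) (adaptedChartAt S x) x
    (toFrame (operBundle L) x x u 2)
  map_add' c d := by
    have e : ofFrame (operBundle L) x x
        (Pi.single 2 (toFrame (lineBundle S 1 (-1)) (adaptedChartAt S x) x (c + d))) =
        ofFrame (operBundle L) x x
          (Pi.single 2 (toFrame (lineBundle S 1 (-1)) (adaptedChartAt S x) x c)) +
        ofFrame (operBundle L) x x
          (Pi.single 2 (toFrame (lineBundle S 1 (-1)) (adaptedChartAt S x) x d)) := by
      rw [map_add, Pi.single_add, map_add]
    exact Subtype.ext e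
  map_smul' a c := by
    have e : ofFrame (operBundle L) x x
        (Pi.single 2 (toFrame (lineBundle S 1 (-1)) (adaptedChartAt S x) x (a • c))) =
        a • ofFrame (operBundle L) x x
          (Pi.single 2 (toFrame (lineBundle S 1 (-1)) (adaptedChartAt S x) x c)) := by
      rw [map_smul, Pi.single_smul, map_smul]
    exact Subtype.ext e
  left_inv c := by
    simp only [toFrame_ofFrame (Z := operBundle L) (mem_operBase_self x), Pi.single_eq_same]
    exact ofFrame_toFrame (Z := lineBundle S 1 (-1)) (mem_adaptedChartAt S x) c
  right_inv u := by
    refine Subtype.ext ?_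
    obtain ⟨h0, h1⟩ := (mem_operF1_iff L (mem_operBase_self x) u.1).mp u.2
    apply toFrame_injective (Z := operBundle L) (i := x) (mem_operBase_self x)
    simp only [toFrame_ofFrame (Z := operBundle L) (mem_operBase_self x),
      toFrame_ofFrame (Z := lineBundle S 1 (-1)) (i := adaptedChartAt S x)
        (mem_adaptedChartAt S x)]
    ext k
    fin_cases k
    · exact (Pi.single_eq_of_ne (by decide) _).trans h0.symm
    · exact (Pi.single_eq_of_ne (by decide) _).trans h1.symm
    · exact Pi.single_eq_same _ _

/-- On `F¹` the transition of `𝓔` reduces to its last diagonal entry, the cocycle of `K_X(-S)`; so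
the isomorphism has coefficient 1 in all frames. -/
lemma toFrame_operIso₁ {i x : X} (hi : x ∈ operBase S i) (c : (lineBundle S 1 (-1)).Fiber x) :
    toFrame (operBundle L) i x (operIso₁ L x c) 2 =
      toFrame (lineBundle S 1 (-1)) (adaptedChartAt S i) x c := by
  have e : toFrame (operBundle L) x x (operIso₁ L x c) =
      Pi.single 2 (toFrame (lineBundle S 1 (-1)) (adaptedChartAt S x) x c) :=
    toFrame_ofFrame (Z := operBundle L) (mem_operBase_self x) _
  rw [← coordChange_toFrame (Z := operBundle L) (mem_operBase_self x) hi, e,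
    ← coordChange_toFrame (Z := lineBundle S 1 (-1)) (i := adaptedChartAt S x)
      (mem_adaptedChartAt S x) hi.1]
  refine (operChange_mulVec_two L (mem_operBase_self x) hi (by simp) (by simp)).trans ?_
  rw [Pi.single_eq_same]
  rfl

lemma operIso₁_hol {U : Set X} (hU : IsOpen U) {c : ∀ x, (lineBundle S 1 (-1)).Fiber x}
    (hc : HolOn (lineBundle S 1 (-1)) U c) :
    HolOn (operBundle L) U fun x => (operIso₁ L x (c x) : (operBundle L).Fiber x) := by
  refine holOn_of_analyticAt fun x hx => ⟨x, mem_operBase_self x, S, adaptedChartAt S x,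
    mem_adaptedChartAt S x, ?_⟩
  have hx' := mem_adaptedChartAt S x
  have h1 := hc.analyticAt hU hx (i := adaptedChartAt S x) hx' (adaptedChartAt S x) hx'
  have hev := eventually_symm _ hx' ((isOpen_operBase (S := S) x).mem_nhds (mem_operBase_self x))
  rw [analyticAt_pi_iff]
  intro k
  fin_cases k
  · exact (analyticAt_const (v := 0)).congr (hev.mono fun w hw =>
      ((mem_operF1_iff L hw _).mp (operIso₁ L _ (c _)).2).1.symm)
  · exact (analyticAt_const (v := 0)).congr (hev.mono fun w hw =>
      ((mem_operF1_iff L hw _).mp (operIso₁ L _ (c _)).2).2.symm)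
  · exact h1.congr (hev.mono fun w hw => (toFrame_operIso₁ L hw _).symm)

variable (s : X → ℂ)

/-- The isomorphism of `F² / F¹` with the trivial line bundle. -/
def operIso₂ (x : X) : operF2 L x →ₗ[ℂ] ℂ :=
  (s x)⁻¹ • ((LinearMap.proj 1 : (Fin 3 → ℂ) →ₗ[ℂ] ℂ) ∘ₗ (operF2 L x).subtype)

lemma operIso₂_apply {i x : X} (hi : x ∈ operBase S i) (u : operF2 L x) :
    operIso₂ L s x u = (s x)⁻¹ * toFrame (operBundle L) i x u 1 := by
  rw [toFrame_one_of_mem_operF2 L hi u.2]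
  rfl

lemma operIso₂_hol (hs : MDifferentiable 𝓘(ℂ) 𝓘(ℂ) s) (hs0 : ∀ x, s x ≠ 0) {U : Set X}
    (hU : IsOpen U) (σ : ∀ x, operF2 L x)
    (hσ : HolOn (operBundle L) U fun x => (σ x : (operBundle L).Fiber x)) :
    MDifferentiableOn 𝓘(ℂ) 𝓘(ℂ) (fun x => operIso₂ L s x (σ x)) U := by
  refine mdifferentiableOn_of_analyticAt fun x hx => ⟨S, adaptedChartAt S x,
    mem_adaptedChartAt S x, ?_⟩
  have hx' := mem_adaptedChartAt S x
  have h1 := hσ.analyticAt hU hx (i := x) (mem_operBase_self x) (adaptedChartAt S x) hx'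
  have h2 := analyticAt_coord_of_forall (adaptedChartAt S x) hx' hU hx hs.mdifferentiableOn
  refine ((h2.inv (hs0 _)).mul (analyticAt_apply h1 1)).congr ?_
  filter_upwards [eventually_symm _ hx' ((isOpen_operBase x).mem_nhds (mem_operBase_self x))]
    with w hw
  exact (operIso₂_apply L s hw _).symm

/-- The branched oper on `𝓔`. -/
def branchedOper (h : AdmissiblePair 𝔹 D) {g : X → ℂ} (hg : MDifferentiable 𝓘(ℂ) 𝓘(ℂ) g)
    (hg2 : ∀ x, g x ^ 2 = discr 𝔹 x) (hs0 : ∀ x, s x ≠ 0)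
    (hs : MDifferentiable 𝓘(ℂ) 𝓘(ℂ) s)
    (hsC : ∀ x, (L x).C ((adaptedChartAt S x).chart x) 1 2 = (adaptedChartAt S x).eqn x * s x) :
    BranchedSO3Oper S (operBundle L) where
  form := operForm L
  form_symm := operForm_symm L
  form_hol _ hU _ _ hσ hτ := operForm_hol L hU hσ hτ
  form_nondeg := operForm_nondeg L
  vol := operVol L g
  vol_hol _ hU _ hσ := operVol_hol L g hg hU hσ
  vol_ne_zero x := operVol_ne_zero L g fun h0 => discr_ne_zero (𝔹 := 𝔹) x (by
    rw [← hg2, h0]; simp)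
  vol_form := operVol_form L g hg2
  F1 := operF1 L
  F2 := operF2 L
  F1_le_F2 x u hu := hu.1
  F1_subbundle := isHolSubbundle_of_frame L (fun _ : Fin 1 => 2)
    (Function.injective_of_subsingleton _) fun hi u => by
      rw [mem_operF1_iff L hi, Fin.forall_fin_succ, Fin.forall_fin_two]
      simp
  F2_subbundle := isHolSubbundle_of_frame L (Fin.succ : Fin 2 → Fin 3)
    (Fin.succ_injective _) fun hi u => by
      rw [mem_operF2_iff L hi, Fin.forall_fin_succ]
      simp
  F1_isotropic x u hu w hw := by
    rw [operForm_of_mem_operF1 L h hu, ((mem_operF1_iff L (mem_operBase_self x) w).mp hw).1]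
    simp
  F1_orthogonal x w := by
    rw [mem_operF2_iff L (mem_operBase_self x)]
    constructor
    · intro hw
      have hF : ofFrame (operBundle L) x x (Pi.single 2 1) ∈ operF1 L x := by
        rw [mem_operF1_iff L (mem_operBase_self x),
          toFrame_ofFrame (Z := operBundle L) (mem_operBase_self x)]
        simp
      have h1 := hw _ hF
      rw [operForm_of_mem_operF1 L h hF,
        toFrame_ofFrame (Z := operBundle L) (mem_operBase_self x)] at h1
      simpa [(L x).H_zero_two_ne_zero h] using h1
    · intro hw u hu
      rw [operForm_of_mem_operF1 L h hu, hw]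
      simp
  iso₁ := operIso₁ L
  iso₁_hol _ hU _ hc := operIso₁_hol L hU hc
  iso₂ := operIso₂ L s
  iso₂_hol _ hU σ hσ := operIso₂_hol L s hs hs0 hU σ hσ
  iso₂_surjective x c := by
    refine ⟨⟨ofFrame (operBundle L) x x (Pi.single 1 (s x * c)), ?_⟩, ?_⟩
    · rw [mem_operF2_iff L (mem_operBase_self x),
        toFrame_ofFrame (Z := operBundle L) (mem_operBase_self x)]
      simp
    · rw [operIso₂_apply L s (mem_operBase_self x),
        toFrame_ofFrame (Z := operBundle L) (mem_operBase_self x), Pi.single_eq_same,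
        inv_mul_cancel_left₀ (hs0 x)]
  iso₂_eq_zero_iff x w := by
    rw [operIso₂_apply L s (mem_operBase_self x), mem_operF1_iff L (mem_operBase_self x),
      (mem_operF2_iff L (mem_operBase_self x) _).mp w.2]
    simp [hs0 x]
  conn := operConn L
  conn_form _ hU _ _ hσ hτ _ hx v := operForm_conn L h hU hσ hτ hx v
  conn_vol _ hU _ hσ _ hx v := operVol_conn L g h hg hg2 hU hσ hx v
  conn_F1 U hU σ hσ hF x hx v := by
    change operCov L σ x v ∈ operF2 L x
    rw [mem_operF2_iff L (mem_operBase_self x), operCov_apply, Pi.smul_apply,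
      (cov_entries_of_mem_operF1 L (mem_operBase_self x) hU hx hσ hF ((L x).C_zero_two h).1).1,
      smul_zero]
  secondForm U hU c hc x hx v hF := by
    rw [operIso₂_apply L s (mem_operBase_self x)]
    change (s x)⁻¹ * toFrame (operBundle L) x x (operCov L (fun y => (operIso₁ L y (c y) :
      (operBundle L).Fiber y)) x v) 1 = _
    rw [operCov_apply, Pi.smul_apply, (cov_entries_of_mem_operF1 L (mem_operBase_self x) hU hx
      (operIso₁_hol L hU hc) (fun y _ => (operIso₁ L y (c y)).2) ((L x).C_zero_two h).1).2,
      toFrame_operIso₁ L (mem_operBase_self x), hsC]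
    -- The scaling of `operIso₂` by `s⁻¹` cancels the factor `s` of the second fundamental form,
    -- leaving the form `c m dz`.
    have key (d s m c : ℂ) (hs : s ≠ 0) : s⁻¹ * d • (m * s * c) = (c * m) • d := by
      simp only [smul_eq_mul]
      field_simp
    refine (key _ _ _ _ (hs0 x)).trans ?_
    rw [show toFrame (lineBundle S 1 (-1)) (adaptedChartAt S x) x (c x) = c x from
      toFrame_indexAt (Z := lineBundle S 1 (-1)) x _]
    rfl

variable (h : AdmissiblePair 𝔹 D) {g : X → ℂ} (hg : MDifferentiable 𝓘(ℂ) 𝓘(ℂ) g)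
    (hg2 : ∀ x, g x ^ 2 = discr 𝔹 x) (hs0 : ∀ x, s x ≠ 0)
    (hs : MDifferentiable 𝓘(ℂ) 𝓘(ℂ) s)
    (hsC : ∀ x, (L x).C ((adaptedChartAt S x).chart x) 1 2 = (adaptedChartAt S x).eqn x * s x)

lemma isSecF_operIncl {U : Set X} (hU : IsOpen U) {σ : ∀ x, (operBundle L).Fiber x}
    (hσ : HolOn (operBundle L) U σ) : IsSecF D U fun x => operIncl L x (σ x) := by
  refine ⟨holOn_operIncl L hU hσ, fun y _ hyS => ?_⟩
  have hy := mem_adaptedChartAt S y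
  rw [mem_ker_res_iff hy hyS, toFrame_operIncl L (mem_operBase_self y), Matrix.mulVec_mulVec,
    LocalFrame.G, (adaptedChartAt S y).eqn_of_mem hyS hy, sub_self, (L y).ker hyS,
    Matrix.zero_mulVec]

lemma isSecE_operIncl {U : Set X} (hU : IsOpen U) {σ : ∀ x, (operBundle L).Fiber x}
    (hσ : HolOn (operBundle L) U σ) : IsSecE D U fun x => operIncl L x (σ x) := by
  refine ⟨isSecF_operIncl L hU hσ, fun y hy _ => ?_⟩
  have hV := hU.inter (adaptedChartAt S y).chart.open_source
  have hσ' := hσ.mono (V := U ∩ (adaptedChartAt S y).chart.source) inter_subset_left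
  obtain ⟨τ, hτ, e⟩ := exists_analytic_operCov L (adaptedChartAt S y) hV inter_subset_right hσ'
  refine ⟨adaptedChartAt S y, _, hV, ⟨hy, mem_adaptedChartAt S y⟩, Subset.rfl,
    _, isSecF_operIncl L hV hτ, fun x hx hxS v => ?_⟩
  rw [cov_operIncl L hV hσ' hx hxS, e x hx, map_smul]

lemma exists_operIncl_eq {U : Set X} (hU : IsOpen U) {σ : ∀ x, (jetBundle S).Fiber x}
    (hσ : IsSecE D U σ) : ∃ w, HolOn (operBundle L) U w ∧ ∀ x ∈ U, operIncl L x (w x) = σ x := by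
  classical
  -- The lift is assembled from the values at the centres of the local lifts; off `S` it agrees with
  -- each nearby local lift because `G` is injective there, which gives holomorphy.
  choose v hv hvσ using fun (x : X) (hx : x ∈ U) => (L x).lift U hU hx σ hσ
  let w : ∀ x, (operBundle L).Fiber x := fun x =>
    if hx : x ∈ U then (v x hx ((adaptedChartAt S x).chart x) : Fin 3 → ℂ)
    else (0 : Fin 3 → ℂ)
  have hw {x : X} (hx : x ∈ U) :
      toFrame (operBundle L) x x (w x) = v x hx ((adaptedChartAt S x).chart x) :=
    (toFrame_oper_self L x _).trans (dif_pos hx)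
  have hwσ : ∀ x ∈ U, operIncl L x (w x) = σ x := by
    intro x hx
    have hx' := mem_adaptedChartAt S x
    apply toFrame_injective (Z := jetBundle S) (i := adaptedChartAt S x) hx'
    have := (hvσ x hx).self_of_nhds
    rw [(adaptedChartAt S x).chart.left_inv hx', eqnC_chart _ hx'] at this
    rw [toFrame_operIncl L (mem_operBase_self x), hw hx, this]
    rfl
  refine ⟨w, holOn_of_analyticAt fun x hx => ⟨x, mem_operBase_self x, S, adaptedChartAt S x,
    mem_adaptedChartAt S x, ?_⟩, hwσ⟩
  have hx' := mem_adaptedChartAt S x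
  refine (hv x hx).congr ?_
  filter_upwards [hvσ x hx, eventually_symm _ hx' (eventually_nhds_notMem S x),
    eventually_symm _ hx' ((isOpen_operBase x).mem_nhds (mem_operBase_self x)),
    eventually_right_inv _ hx', eventually_symm _ hx' (hU.mem_nhds hx)] with t ht htS hi he htU
  by_cases hne : (adaptedChartAt S x).chart.symm t = x
  · rw [hne, hw hx, ← he, hne]
  · apply mulVec_G_injective L hi (htS hne)
    rw [← toFrame_operIncl L hi, hwσ _ htU, ht]
    rfl

/-- The inclusion is not injective on the fibers over `S`, but the section vanishes off `S`, hence
everywhere by continuity. -/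
lemma eq_zero_of_operIncl_eq_zero {U : Set X} (hU : IsOpen U)
    {w : ∀ x, (operBundle L).Fiber x} (hw : HolOn (operBundle L) U w)
    (h0 : ∀ x ∈ U, operIncl L x (w x) = 0) {x : X} (hx : x ∈ U) : w x = 0 := by
  have hx' := mem_adaptedChartAt S x
  have h1 := hw.analyticAt hU hx (i := x) (mem_operBase_self x) (adaptedChartAt S x) hx'
  apply toFrame_injective (Z := operBundle L) (i := x) (mem_operBase_self x)
  rw [map_zero]
  have := eq_of_eventuallyEq_punctured (g := fun _ => 0) h1.continuousAt continuousAt_const (by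
    filter_upwards [eventually_notMem (S := S) (adaptedChartAt S x) hx',
      (eventually_symm _ hx' (hU.mem_nhds hx)).filter_mono nhdsWithin_le_nhds] with t ht htU
    have e : w ((adaptedChartAt S x).chart.symm t) = 0 :=
      operIncl_injective L ht ((h0 _ htU).trans (map_zero _).symm)
    rw [e, map_zero])
  beta_reduce at this
  rwa [(adaptedChartAt S x).chart.left_inv hx'] at this

lemma identifies_branchedOper :
    Identifies 𝔹 D (branchedOper L s h hg hg2 hs0 hs hsC) (operIncl L) where
  maps_to _ hU _ hw := isSecE_operIncl L hU hw
  surjective _ hU _ hσ := exists_operIncl_eq L hU hσ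
  injective _ hU _ hw h0 _ hx := eq_zero_of_operIncl_eq_zero L hU hw h0 hx
  form_eq _ hxS u w := toMero_operForm L hxS u w
  conn_eq _ hU _ hw _ hx hxS v := cov_operIncl L hU hw hx hxS v
  F1_eq x hxS u := by
    have hm := (adaptedChartAt S x).eqn_ne_zero (mem_adaptedChartAt S x) hxS
    change u ∈ operF1 L x ↔ _
    rw [mem_jetF1_iff (mem_adaptedChartAt S x), toFrame_operIncl L (mem_operBase_self x),
      mem_operF1_iff L (mem_operBase_self x), (L x).G_eq]
    simp +contextual [Matrix.mulVec, dotProduct, Fin.sum_univ_three, hm]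
  F2_eq x hxS u := by
    change u ∈ operF2 L x ↔ _
    rw [mem_jetF2_iff (mem_adaptedChartAt S x), toFrame_operIncl L (mem_operBase_self x),
      mem_operF2_iff L (mem_operBase_self x), (L x).G_eq]
    simp [Matrix.mulVec, dotProduct, Fin.sum_univ_three]

include h in
-- On a compact connected surface the holomorphic function `discr` is constant, so a constant square
-- root exists.
lemma exists_sqrt_discr [ConnectedSpace X] (L : ∀ x, LocalFrame 𝔹 D x)
    (hdiscr : ¬ CompactSpace X →
      ∃ g : X → ℂ, MDifferentiable 𝓘(ℂ) 𝓘(ℂ) g ∧ ∀ x, g x ^ 2 = discr 𝔹 x) :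
    ∃ g : X → ℂ, MDifferentiable 𝓘(ℂ) 𝓘(ℂ) g ∧ ∀ x, g x ^ 2 = discr 𝔹 x := by
  by_cases hc : CompactSpace X
  · obtain ⟨c, hcc⟩ := (mdifferentiable_discr L h).exists_eq_const_of_compactSpace
    obtain ⟨r, hr⟩ := IsAlgClosed.exists_pow_nat_eq c two_pos
    exact ⟨fun _ => r, fun _ => mdifferentiableAt_const, fun x => by rw [hr, hcc]; rfl⟩
  · exact hdiscr hc

end Oper

end BranchedOper

end

theorem theorem7p1 {X : Type*} [TopologicalSpace X] [T2Space X] [ConnectedSpace X]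
    [ChartedSpace ℂ X] [IsManifold 𝓘(ℂ) ω X] (S : Finset X) (hS : S.Nonempty)
    (𝔹 : TwistedForm S (jetBundle S)) (D : LogConnection S (jetBundle S))
    (h : AdmissiblePair 𝔹 D)
    (hdiscr : ¬ CompactSpace X →
      ∃ g : X → ℂ, MDifferentiable 𝓘(ℂ) 𝓘(ℂ) g ∧ ∀ x, g x ^ 2 = discr 𝔹 x) :
    DefinesBranchedOper 𝔹 D ↔
      ∀ y ∈ S, ∀ φ : AdaptedChart S, y ∈ φ.chart.source → IsPhi D φ y 0 := by
  constructor
  · exact fun hdef y hyS φ hy => isPhi_zero_of_definesBranchedOper h hdef hy hyS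
  · intro hφ
    have L (x : X) : LocalFrame 𝔹 D x := (exists_localFrame h
      (fun y hyS => hφ y hyS _ (mem_adaptedChartAt S y)) x).some
    obtain ⟨g, hg, hg2⟩ := exists_sqrt_discr h L hdiscr
    obtain ⟨s, hs0, hs, hsC⟩ := exists_operSecondForm L h
    exact ⟨X, operBundle L, inferInstance, branchedOper L s h hg hg2 hs0 hs hsC, operIncl L,
      identifies_branchedOper L s h hg hg2 hs0 hs hsC⟩
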